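/- Let $\rho>0$, $v\in\mathbb R^3$, $e>0$ and let $M(\xi)=\rho\,(4\pi e/3)^{-3/2}\,e^{-|\xi-v|^2/(4e/3)}$ be the associated Maxwellian on $\mathbb R^3$. Let $$Q(g,h)(\xi)=\int_{\mathbb R^3}\int_{S^2}\big(g(\xi')h(\xi'_*)-g(\xi)h(\xi_*)\big)\,|\Omega\cdot(\xi-\xi_*)|\,d\Omega\,d\xi_*,$$ with $\xi'=\xi+(\Omega\cdot(\xi_*-\xi))\Omega$ and $\xi'_*=\xi_*-(\Omega\cdot(\xi_*-\xi))\Omega$, be the hard-sphere collision operator, and let $\underline L g=Q(M,g)+Q(g,M)$ be its linearization at $M$. Write $\langle\xi\rangle=(1+|\xi|^2)^{1/2}$, let $\mathbb H^s$ be the space of (classes of) complex-valued functions with $\|f\|_{\mathbb H^s}^2=\int M^{-2s}|f|^2\,d\xi<\infty$, and $\langle\xi\rangle^{-a}\mathbb H^s=\{f:\langle\xi\rangle^a f\in\mathbb H^s\}$ with norm $\|\langle\xi\rangle^a f\|_{\mathbb H^s}$. Let $Rf=\int \Psi f\,d\xi$ with $\Psi(\xi)=(1,\xi_1,\xi_2,\xi_3,\tfrac12|\xi|^2)$,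 let $\mathbb V=\ker R\cap\mathbb H^{1/2}$, $\mathbb V^s=\ker R\cap\mathbb H^s$, and let $\mathbb P_{\mathbb V}$ be the orthogonal projection of $\mathbb H^{1/2}$ onto $\mathbb V$. Let $\frac12\le s<1$. Then: 1. For $f\in\langle\xi\rangle^{-1/2}\mathbb H^s$ the integrals defining $\underline Lf(\xi)$ converge absolutely for almost every $\xi$. The operator $\underline L$ is linear and continuous from $\langle\xi\rangle^{-1/2}\mathbb H^s$ to $(\langle\xi\rangle^{1/2}\mathbb H^s)\cap\ker R$, which for $s>\frac12$ is $(\langle\xi\rangle^{1/2}\mathbb H^s)\cap\mathbb V$, and from $\langle\xi\rangle^{-1}\mathbb H^s$ to $\mathbb V^s$. 2. There are $\lambda\ge0$ and $\delta>0$ (depending only on $s$ and on $(\rho,v,e)$) such that, with $\|f\|_{\widetilde{\mathbb H}^s}^2=\|f\|_{\mathbb H^s}^2+\lambda\|f\|_{\mathbb H^{1/2}}^2$, which is equivalent to $\|f\|_{\mathbb H^s}^2$ on $\mathbb H^s$, and $$(f,g)_{\widetilde{\mathbb H}^s}=\int\big(M^{-2s}+\lambda M^{-1}\big)f\,\overline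 g\,d\xi,$$ one has $$\delta\,\big\|\langle\xi\rangle^{1/2}\mathbb P_{\mathbb V}f\big\|_{\widetilde{\mathbb H}^s}^2\le-\mathrm{Re}\,\big(\underline Lf,f\big)_{\widetilde{\mathbb H}^s}$$ for every $f\in\langle\xi\rangle^{-1}\mathbb H^s$ such that $f\in\mathbb V$ or $\langle\xi\rangle f\in\mathbb V$ (both sides being finite, given by absolutely convergent integrals). -/

import Mathlib

noncomputable section

namespace HardSphere

open MeasureTheory

/-- Velocity space `ℝ³` with its Euclidean structure. -/
abbrev Vel : Type := EuclideanSpace ℝ (Fin 3)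

/-- A fluid-dynamical reference state: density `ρ > 0`, velocity `v`, internal energy `e > 0`. -/
structure FluidState where
  rho : ℝ
  v : Vel
  e : ℝ
  rho_pos : 0 < rho
  e_pos : 0 < e

/-- The Maxwellian `M_u(ξ) = ρ (4πe/3)^{-3/2} exp(-|ξ - v|² / (4e/3))`. -/
def maxwellian (u : FluidState) (ξ : Vel) : ℝ :=
  u.rho / Real.sqrt ((4 * Real.pi * u.e / 3) ^ 3) * Real.exp (-(‖ξ - u.v‖ ^ 2 / (4 * u.e / 3)))

/-- The Maxwellian as a complex valued function. -/
def maxwellianC (u : FluidState) (ξ : Vel) : ℂ := (maxwellian u ξ : ℂ)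

/-- The bracket `⟨ξ⟩ = (1 + |ξ|²)^{1/2}`. -/
def bracket (ξ : Vel) : ℝ := Real.sqrt (1 + ‖ξ‖ ^ 2)

/-- The unit sphere `S²`. -/
abbrev S2 : Type := Metric.sphere (0 : Vel) 1

/-- The measure `dξ_* dΩ`, with `dΩ` the surface measure of `S²`. -/
def collisionMeasure : Measure (Vel × S2) :=
  (volume : Measure Vel).prod (volume : Measure Vel).toSphere

/-- The hard-sphere kernel `C(Ω, z) = |Ω · z|`. -/
def hardSphereKernel (Ω : S2) (z : Vel) : ℝ := |inner ℝ (Ω : Vel) z|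

/-- `ξ' = ξ + (Ω · (ξ_* - ξ)) Ω`. -/
def post (ξ ξs : Vel) (Ω : S2) : Vel := ξ + (inner ℝ (Ω : Vel) (ξs - ξ)) • (Ω : Vel)

/-- `ξ'_* = ξ_* - (Ω · (ξ_* - ξ)) Ω`. -/
def postStar (ξ ξs : Vel) (Ω : S2) : Vel := ξs - (inner ℝ (Ω : Vel) (ξs - ξ)) • (Ω : Vel)

/-- The integrand of the collision integral, as a function of `(ξ_*, Ω)`. -/
def collisionIntegrand (g h : Vel → ℂ) (ξ : Vel) (p : Vel × S2) : ℂ :=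
  (g (post ξ p.1 p.2) * h (postStar ξ p.1 p.2) - g ξ * h p.1) *
    (hardSphereKernel p.2 (ξ - p.1) : ℂ)

/-- The hard-sphere collision operator `Q(g, h)`. -/
def collision (g h : Vel → ℂ) (ξ : Vel) : ℂ :=
  ∫ p, collisionIntegrand g h ξ p ∂collisionMeasure

/-- The linearized operator `L g = Q(M, g) + Q(g, M)` at the Maxwellian `M = M_u`. -/
def linearized (u : FluidState) (g : Vel → ℂ) (ξ : Vel) : ℂ :=
  collision (maxwellianC u) g ξ + collision g (maxwellianC u) ξ

/-- The collision invariants `Ψ = (1, ξ₁, ξ₂, ξ₃, |ξ|²/2)`. -/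
def invariant : Fin 5 → Vel → ℝ :=
  ![fun _ => 1, fun ξ => ξ 0, fun ξ => ξ 1, fun ξ => ξ 2, fun ξ => ‖ξ‖ ^ 2 / 2]

/-- `f ∈ ker R`: the moments `R f = ∫ Ψ f dξ` converge and vanish. -/
def InKerR (f : Vel → ℂ) : Prop :=
  ∀ j, Integrable (fun ξ => (invariant j ξ : ℂ) * f ξ) ∧
    ∫ ξ, (invariant j ξ : ℂ) * f ξ = 0

/-- The measure `⟨ξ⟩^{2a} M_u(ξ)^{-2s} dξ`. -/
def weightedMeasure (u : FluidState) (s a : ℝ) : Measure Vel :=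
  (volume : Measure Vel).withDensity
    (fun ξ => ENNReal.ofReal (bracket ξ ^ (2 * a) * maxwellian u ξ ^ (-2 * s)))

/-- Membership in `⟨ξ⟩^{-a} ℍ^s`, i.e. `⟨ξ⟩^a f ∈ ℍ^s`. -/
def MemH (u : FluidState) (s a : ℝ) (f : Vel → ℂ) : Prop := MemLp f 2 (weightedMeasure u s a)

/-- The Hilbert space `⟨ξ⟩^{-a} ℍ^s`, with norm `‖⟨ξ⟩^a f‖_{ℍ^s}`. -/
abbrev HSpace (u : FluidState) (s a : ℝ) : Type := Lp ℂ 2 (weightedMeasure u s a)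

/-- The space `ℍ^{1/2}`. -/
abbrev HHalf (u : FluidState) : Type := HSpace u (1 / 2) 0

/-- The integrand of the scalar product of `ℍ^s`. -/
def hIntegrand (u : FluidState) (s : ℝ) (f g : Vel → ℂ) (ξ : Vel) : ℂ :=
  ((maxwellian u ξ ^ (-2 * s) : ℝ) : ℂ) * (f ξ * (starRingEnd ℂ) (g ξ))

/-- `‖f‖²_{ℍ^s} = ∫ M_u^{-2s} |f|² dξ`. -/
def hNormSq (u : FluidState) (s : ℝ) (f : Vel → ℂ) : ℝ :=
  ∫ ξ, maxwellian u ξ ^ (-2 * s) * ‖f ξ‖ ^ 2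

/-- The squared norm `‖f‖²_{ℍ^s} + lam ‖f‖²_{ℍ^{1/2}}`. -/
def tildeNormSq (u : FluidState) (s lam : ℝ) (f : Vel → ℂ) : ℝ :=
  hNormSq u s f + lam * hNormSq u (1 / 2) f

/-- The scalar product `∫ (M_u^{-2s} + lam M_u^{-1}) f \bar g dξ` of the norm `tildeNormSq`. -/
def tildeInner (u : FluidState) (s lam : ℝ) (f g : Vel → ℂ) : ℂ :=
  (∫ ξ, hIntegrand u s f g ξ) + (lam : ℂ) * ∫ ξ, hIntegrand u (1 / 2) f g ξ

lemma maxwellian_pos (u : FluidState) (ξ : Vel) : 0 < maxwellian u ξ := by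
  have h1 := u.rho_pos
  have h2 := u.e_pos
  have h3 := Real.pi_pos
  unfold maxwellian
  positivity

lemma continuous_maxwellian (u : FluidState) : Continuous (maxwellian u) := by
  unfold maxwellian
  fun_prop

lemma bracket_pos (ξ : Vel) : 0 < bracket ξ := by
  unfold bracket
  positivity

lemma continuous_bracket : Continuous bracket := by
  unfold bracket
  fun_prop

lemma continuous_invariant (j : Fin 5) : Continuous (invariant j) := by
  fin_cases j <;> simp [invariant] <;> fun_prop

lemma continuous_weight (u : FluidState) (s a : ℝ) :
    Continuous (fun ξ => bracket ξ ^ (2 * a) * maxwellian u ξ ^ (-2 * s)) :=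
  (continuous_bracket.rpow_const fun ξ => Or.inl (bracket_pos ξ).ne').mul
    ((continuous_maxwellian u).rpow_const fun ξ => Or.inl (maxwellian_pos u ξ).ne')

lemma weight_pos (u : FluidState) (s a : ℝ) (ξ : Vel) :
    0 < bracket ξ ^ (2 * a) * maxwellian u ξ ^ (-2 * s) :=
  mul_pos (Real.rpow_pos_of_pos (bracket_pos ξ) _) (Real.rpow_pos_of_pos (maxwellian_pos u ξ) _)

lemma volume_ac_weightedMeasure (u : FluidState) (s a : ℝ) :
    (volume : Measure Vel) ≪ weightedMeasure u s a := by
  refine withDensity_absolutelyContinuous'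
    (continuous_weight u s a).measurable.ennreal_ofReal.aemeasurable (.of_forall fun ξ => ?_)
  exact (ENNReal.ofReal_pos.2 (weight_pos u s a ξ)).ne'

lemma integrable_weighted_iff (u : FluidState) (s a : ℝ) (f : Vel → ℂ) :
    Integrable f (weightedMeasure u s a) ↔
      Integrable (fun ξ => (bracket ξ ^ (2 * a) * maxwellian u ξ ^ (-2 * s)) • f ξ) := by
  unfold weightedMeasure
  rw [integrable_withDensity_iff_integrable_smul'
    (continuous_weight u s a).measurable.ennreal_ofReal (.of_forall fun _ => ENNReal.ofReal_lt_top)]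
  simp only [ENNReal.toReal_ofReal (weight_pos u s a _).le]

lemma integral_weighted (u : FluidState) (s a : ℝ) (f : Vel → ℂ) :
    ∫ ξ, f ξ ∂(weightedMeasure u s a) =
      ∫ ξ, (bracket ξ ^ (2 * a) * maxwellian u ξ ^ (-2 * s)) • f ξ := by
  unfold weightedMeasure
  rw [integral_withDensity_eq_integral_toReal_smul
    (continuous_weight u s a).measurable.ennreal_ofReal (.of_forall fun _ => ENNReal.ofReal_lt_top)]
  simp only [ENNReal.toReal_ofReal (weight_pos u s a _).le]

lemma abs_invariant_le (j : Fin 5) (ξ : Vel) : |invariant j ξ| ≤ 1 + ‖ξ‖ ^ 2 := by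
  have hc : ∀ i : Fin 3, |ξ i| ≤ 1 + ‖ξ‖ ^ 2 := fun i => by
    have h : |ξ i| ≤ ‖ξ‖ := by simpa using PiLp.norm_apply_le ξ i
    nlinarith [sq_nonneg (‖ξ‖ - 1)]
  have h4 : |‖ξ‖ ^ 2 / 2| ≤ 1 + ‖ξ‖ ^ 2 := by
    rw [abs_of_nonneg (by positivity)]
    nlinarith [sq_nonneg ‖ξ‖]
  fin_cases j
  · simp only [invariant, Fin.zero_eta, Matrix.cons_val_zero, abs_one]
    nlinarith [sq_nonneg ‖ξ‖]
  · exact hc 0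
  · exact hc 1
  · exact hc 2
  · exact h4

lemma integrable_invariant_sq_mul (u : FluidState) (j : Fin 5) :
    Integrable (fun ξ => invariant j ξ ^ 2 * maxwellian u ξ) := by
  have he := u.e_pos
  set c : ℝ := 1 / (4 * (4 * u.e / 3)) with hc
  have hcpos : 0 < c := by positivity
  set B : ℝ := 1 + 2 * ‖u.v‖ ^ 2 + 2 / c with hB
  set A : ℝ := u.rho / Real.sqrt ((4 * Real.pi * u.e / 3) ^ 3) with hA
  have hApos : 0 < A := by
    have h1 := u.rho_pos
    have h3 := Real.pi_pos
    positivity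
  have hgauss : Integrable (fun ξ : Vel => Real.exp (-(2 * c) * ‖ξ - u.v‖ ^ 2)) := by
    have h0 : Integrable (fun ξ : Vel => Real.exp (-(2 * c) * ‖ξ‖ ^ 2)) := by
      have h := (GaussianFourier.integrable_cexp_neg_mul_sq_norm_add (V := Vel)
        (b := ((2 * c : ℝ) : ℂ)) (by simpa using hcpos) 0 0).norm
      refine h.congr (.of_forall fun ξ => ?_)
      simp [Complex.norm_exp, ← Complex.ofReal_pow]
    exact h0.comp_sub_right u.v
  refine (hgauss.const_mul (B ^ 2 * A)).mono' ?_ (.of_forall fun ξ => ?_)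
  · exact (((continuous_invariant j).pow 2).mul (continuous_maxwellian u)).aestronglyMeasurable
  · have hb : |invariant j ξ| ≤ B * Real.exp (c * ‖ξ - u.v‖ ^ 2) := by
      have h1 := abs_invariant_le j ξ
      have h2 : ‖ξ‖ ≤ ‖ξ - u.v‖ + ‖u.v‖ := by simpa using norm_add_le (ξ - u.v) u.v
      have h3 : ‖ξ‖ ^ 2 ≤ 2 * ‖ξ - u.v‖ ^ 2 + 2 * ‖u.v‖ ^ 2 := by
        nlinarith [norm_nonneg ξ, sq_nonneg (‖ξ - u.v‖ - ‖u.v‖)]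
      have h4 := Real.add_one_le_exp (c * ‖ξ - u.v‖ ^ 2)
      have h5 : 0 ≤ c * ‖ξ - u.v‖ ^ 2 := by positivity
      have h6 : 2 * ‖ξ - u.v‖ ^ 2 = 2 / c * (c * ‖ξ - u.v‖ ^ 2) := by field_simp
      have h7 : 2 / c * (c * ‖ξ - u.v‖ ^ 2) ≤ 2 / c * Real.exp (c * ‖ξ - u.v‖ ^ 2) :=
        mul_le_mul_of_nonneg_left (by linarith) (by positivity)
      have h8 : (1 + 2 * ‖u.v‖ ^ 2) * 1 ≤ (1 + 2 * ‖u.v‖ ^ 2) * Real.exp (c * ‖ξ - u.v‖ ^ 2) :=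
        mul_le_mul_of_nonneg_left (by linarith) (by positivity)
      rw [hB, add_mul]
      linarith
    have hsq : invariant j ξ ^ 2 ≤ B ^ 2 * Real.exp (2 * c * ‖ξ - u.v‖ ^ 2) := by
      rw [← sq_abs]
      calc |invariant j ξ| ^ 2 ≤ (B * Real.exp (c * ‖ξ - u.v‖ ^ 2)) ^ 2 := by gcongr
        _ = B ^ 2 * Real.exp (2 * c * ‖ξ - u.v‖ ^ 2) := by
          rw [mul_pow, ← Real.exp_nat_mul]
          push_cast
          ring_nf
    have hM : maxwellian u ξ = A * Real.exp (-(4 * c) * ‖ξ - u.v‖ ^ 2) := by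
      unfold maxwellian
      rw [← hA, hc]
      congr 2
      field_simp
    rw [Real.norm_of_nonneg (mul_nonneg (sq_nonneg _) (maxwellian_pos u ξ).le), hM]
    calc invariant j ξ ^ 2 * (A * Real.exp (-(4 * c) * ‖ξ - u.v‖ ^ 2))
        ≤ B ^ 2 * Real.exp (2 * c * ‖ξ - u.v‖ ^ 2) *
          (A * Real.exp (-(4 * c) * ‖ξ - u.v‖ ^ 2)) := by gcongr
      _ = B ^ 2 * A * (Real.exp (2 * c * ‖ξ - u.v‖ ^ 2) *
          Real.exp (-(4 * c) * ‖ξ - u.v‖ ^ 2)) := by ring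
      _ = B ^ 2 * A * Real.exp (-(2 * c) * ‖ξ - u.v‖ ^ 2) := by
          rw [← Real.exp_add]
          ring_nf

lemma half_weight (u : FluidState) (ξ : Vel) :
    bracket ξ ^ (2 * (0 : ℝ)) * maxwellian u ξ ^ (-2 * (1 / 2 : ℝ)) = (maxwellian u ξ)⁻¹ := by
  rw [mul_zero, Real.rpow_zero, one_mul, show (-2 * (1 / 2 : ℝ)) = -1 by norm_num,
    Real.rpow_neg_one]

/-- The functions `ψ_j M_u` belong to `ℍ^{1/2}`. -/
lemma memLp_invariant_mul (u : FluidState) (j : Fin 5) :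
    MemLp (fun ξ => ((invariant j ξ * maxwellian u ξ : ℝ) : ℂ)) 2
      (weightedMeasure u (1 / 2) 0) := by
  have hcont : Continuous (fun ξ => ((invariant j ξ * maxwellian u ξ : ℝ) : ℂ)) :=
    Complex.continuous_ofReal.comp ((continuous_invariant j).mul (continuous_maxwellian u))
  rw [memLp_two_iff_integrable_sq_norm hcont.aestronglyMeasurable]
  have h : Integrable (fun ξ => ((invariant j ξ ^ 2 * maxwellian u ξ ^ 2 : ℝ) : ℂ))
      (weightedMeasure u (1 / 2) 0) := by
    rw [integrable_weighted_iff]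
    have h0 : Integrable (fun ξ => ((invariant j ξ ^ 2 * maxwellian u ξ : ℝ) : ℂ)) :=
      (integrable_invariant_sq_mul u j).ofReal
    refine h0.congr (.of_forall fun ξ => ?_)
    have hM := (maxwellian_pos u ξ).ne'
    simp only [half_weight, Complex.real_smul]
    push_cast
    field_simp [Complex.ofReal_ne_zero.2 hM]
  refine h.norm.congr (.of_forall fun ξ => ?_)
  simp [mul_pow]

/-- For `f ∈ ℍ^{1/2}`, the moment `∫ ψ_j f` is the scalar product of `ψ_j M_u` and `f`. -/
lemma integrable_and_moment (u : FluidState) (j : Fin 5) (f : HHalf u) :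
    Integrable (fun ξ => (invariant j ξ : ℂ) * f ξ) ∧
      ∫ ξ, (invariant j ξ : ℂ) * f ξ =
        inner ℂ ((memLp_invariant_mul u j).toLp _ : HHalf u) f := by
  set Φ : HHalf u := (memLp_invariant_mul u j).toLp _ with hΦ
  have hae : ∀ᵐ ξ, Φ ξ = ((invariant j ξ * maxwellian u ξ : ℝ) : ℂ) :=
    (volume_ac_weightedMeasure u _ _).ae_le (memLp_invariant_mul u j).coeFn_toLp
  have key : (fun ξ => (bracket ξ ^ (2 * (0 : ℝ)) * maxwellian u ξ ^ (-2 * (1 / 2 : ℝ))) •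
      inner ℂ (Φ ξ) (f ξ)) =ᵐ[volume] fun ξ => (invariant j ξ : ℂ) * f ξ := by
    filter_upwards [hae] with ξ h
    have hM : ((maxwellian u ξ : ℝ) : ℂ) ≠ 0 := by exact_mod_cast (maxwellian_pos u ξ).ne'
    rw [half_weight, h]
    simp only [Complex.real_smul, RCLike.inner_apply, Complex.conj_ofReal]
    push_cast
    field_simp
  refine ⟨((integrable_weighted_iff u _ _ _).1 (L2.integrable_inner Φ f)).congr key, ?_⟩
  rw [L2.inner_def, integral_weighted]
  exact (integral_congr_ae key).symm

/-- `𝕍 = ker R ∩ ℍ^{1/2}`. -/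
def kerR (u : FluidState) : Submodule ℂ (HHalf u) where
  carrier := {f | InKerR f}
  zero_mem' := fun j =>
    ⟨(integrable_and_moment u j _).1, by
      rw [(integrable_and_moment u j _).2, inner_zero_right]⟩
  add_mem' := fun {f g} hf hg j =>
    ⟨(integrable_and_moment u j _).1, by
      rw [(integrable_and_moment u j _).2, inner_add_right, ← (integrable_and_moment u j f).2,
        ← (integrable_and_moment u j g).2, (hf j).2, (hg j).2, add_zero]⟩
  smul_mem' := fun c f hf j =>
    ⟨(integrable_and_moment u j _).1, by
      rw [(integrable_and_moment u j _).2, inner_smul_right, ← (integrable_and_moment u j f).2,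
        (hf j).2, mul_zero]⟩

lemma isClosed_kerR (u : FluidState) : IsClosed (kerR u : Set (HHalf u)) := by
  have h : (kerR u : Set (HHalf u)) =
      ⋂ j, {f | inner ℂ ((memLp_invariant_mul u j).toLp _ : HHalf u) f = 0} := by
    ext f
    simp only [Set.mem_iInter, Set.mem_ofPred_eq]
    exact ⟨fun hf j => by rw [← (integrable_and_moment u j f).2]; exact (hf j).2,
      fun hf j => ⟨(integrable_and_moment u j f).1, by
        rw [(integrable_and_moment u j f).2]; exact hf j⟩⟩
  rw [h]
  exact isClosed_iInter fun j => isClosed_eq (by fun_prop) continuous_const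

instance (u : FluidState) : CompleteSpace (kerR u) :=
  (isClosed_kerR u).completeSpace_coe

/-- The orthogonal projection `ℙ_𝕍` of `ℍ^{1/2}` onto `𝕍`. -/
def projV (u : FluidState) (f : HHalf u) : HHalf u := (kerR u).starProjection f

end HardSphere

end

/-! The operator splits as `linearized = nonlocal - freq`, a multiplication by the collision
frequency and an integral operator with an explicit kernel. The frequency is bounded above and below
by multiples of `⟨ξ⟩` (`exists_freq_le`, `exists_le_freq`), because the relative speed is averaged
against a Maxwellian. The kernel of the gain terms is computed by integrating the Maxwellian over
the planes orthogonal to `Ω` (`lintegral_gain`); the second gain term has the same kernel, since the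
two post-collisional velocities can be exchanged (`lintegral_surf_swap`). Conjugating by `M^s` and
completing squares bounds the kernel by a convolution kernel `(|z|⁻¹ + |z|) exp(-β|z|²)` with `β`
proportional to `s(1 - s)`, positive exactly because `0 < s < 1` (`conj_kernel_add_le`). This kernel
lies in `L¹` and in `L²`: the first gives boundedness of the nonlocal part on `ℍ^s`, the second its
pointwise convergence. The continuity claims follow.

For `s = 1/2` the operator is symmetric. The maps exchanging the colliding particles and performing
the collision preserve `|Ω·(ξ-ξ_*)| M M_* dξ dξ_* dΩ`, whence `(Lf, g) = -1/4 ∫ D(f/M) conj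
(D(g/M))`, where `D` is the collisional increment (`linearized_weak_form`). Taking `g = Ψ_j M` gives
the conservation laws; taking `g = f` gives dissipation. Dissipation vanishes only if `f/M` is a
collision invariant, that is a combination of the `Ψ_j` (`exists_coeff_of_ae_increment`): after
mollification, invariance is a functional equation on rectangles that forces quadratic polynomials.

The gap `exists_spectral_gap` comes from compactness. A normalized sequence with vanishing
dissipation and vanishing moments converges weakly to zero along a subsequence; the nonlocal part
makes this convergence strong, which contradicts the lower bound on the frequency.

For general `s`, the frequency gives coercivity in `ℍ^s` up to a multiple of the `ℍ^{1/2}` norm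
weighted by `⟨ξ⟩^{1/2}` (`exists_coercive_sub`). A large multiple `lam` of the `ℍ^{1/2}` product
absorbs this error through the gap. The part of `f` removed by the projection is a combination of
the `Ψ_j M`; either condition on `f` bounds it by the projected part (`hnorm_hydro_le` in the second
case). -/

noncomputable section
namespace HardSphere
open MeasureTheory Set
open scoped ENNReal

/-! ### Integration on the sphere and the exchange of post-collisional velocities -/

/-- The surface measure of `S²`. -/
abbrev surf : Measure S2 := (volume : Measure Vel).toSphere

lemma exists_orthonormalBasis_zero (Ω : Vel) (h : ‖Ω‖ = 1) :
    ∃ b : OrthonormalBasis (Fin 3) ℝ Vel, b 0 = Ω := by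
  have hv : Orthonormal ℝ (({0} : Set (Fin 3)).domRestrict (fun _ => Ω)) := by
    refine ⟨fun i => by simpa using h, fun i j hij => ?_⟩
    exact absurd (Subsingleton.elim i j) hij
  obtain ⟨b, hb⟩ := hv.exists_orthonormalBasis_extension_of_card_eq (by simp)
  exact ⟨b, hb 0 rfl⟩

/-- Integration in the coordinates of an orthonormal basis. -/
lemma lintegral_eq_coordinates (b : OrthonormalBasis (Fin 3) ℝ Vel) {F : Vel → ℝ≥0∞}
    (hF : Measurable F) :
    ∫⁻ w, F w = ∫⁻ x : ℝ, ∫⁻ z : ℝ × ℝ, F (x • b 0 + z.1 • b 1 + z.2 • b 2) := by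
  have e1 : MeasurePreserving (fun x : EuclideanSpace ℝ (Fin 3) => b.repr.symm x) :=
    b.measurePreserving_repr_symm
  have e2 := PiLp.volume_preserving_toLp (Fin 3)
  have e3 := (volume_preserving_piFinSuccAbove (fun _ : Fin 3 => ℝ) 0).symm
  have e4 := (MeasurePreserving.id (volume : Measure ℝ)).prod
    (volume_preserving_finTwoArrow ℝ).symm
  have e := e1.comp (e2.comp (e3.comp e4))
  rw [← e.lintegral_comp hF, lintegral_prod]
  · refine lintegral_congr fun x => lintegral_congr fun z => ?_
    congr 1
    simp only [Function.comp_apply]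
    rw [← OrthonormalBasis.sum_repr_symm, Fin.sum_univ_three]
    simp [MeasurableEquiv.piFinSuccAbove, MeasurableEquiv.finTwoArrow, Fin.insertNthEquiv]
  · exact (hF.comp e.measurable).aemeasurable

/-- Polar coordinates in `ℝ³`. -/
lemma lintegral_polar {F : Vel → ℝ≥0∞} (hF : Measurable F) :
    ∫⁻ x, F x = ∫⁻ Ω : S2, ∫⁻ r in Ioi (0 : ℝ), ENNReal.ofReal (r ^ 2) * F (r • (Ω : Vel)) ∂volume
      ∂surf := by
  have h := (volume : Measure Vel).measurePreserving_homeomorphUnitSphereProd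
  have hd : Module.finrank ℝ Vel - 1 = 2 := by simp
  rw [hd] at h
  have h1 : ∫⁻ x, F x = ∫⁻ x : ({0}ᶜ : Set Vel), F x ∂((volume : Measure Vel).comap Subtype.val) := by
    rw [lintegral_subtype_comap (measurableSet_singleton _).compl, restrict_compl_singleton]
  have h2 : ∀ x : ({0}ᶜ : Set Vel), F x =
      (fun p : S2 × Ioi (0 : ℝ) => F ((p.2 : ℝ) • (p.1 : Vel))) (homeomorphUnitSphereProd Vel x) := by
    intro x
    have hx : ‖(x : Vel)‖ ≠ 0 := norm_ne_zero_iff.2 x.2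
    simp [smul_smul, hx]
  have hm : Measurable (fun p : S2 × Ioi (0 : ℝ) => F ((p.2 : ℝ) • (p.1 : Vel))) :=
    hF.comp (by fun_prop)
  rw [h1, lintegral_congr h2, h.lintegral_comp hm, lintegral_prod _ hm.aemeasurable]
  refine lintegral_congr fun Ω => ?_
  rw [Measure.volumeIoiPow, lintegral_withDensity_eq_lintegral_mul _ (by fun_prop) (by fun_prop)]
  simp only [Pi.mul_apply]
  exact lintegral_subtype_comap measurableSet_Ioi
    (fun r : ℝ => ENNReal.ofReal (r ^ 2) * F (r • (Ω : Vel)))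

lemma lintegral_Ioo_sq :
    ∫⁻ r in Ioi (0 : ℝ), ENNReal.ofReal (r ^ 2) * (Iio (1 : ℝ)).indicator 1 r = ENNReal.ofReal (1 / 3) := by
  have : ∀ r : ℝ, ENNReal.ofReal (r ^ 2) * (Iio (1 : ℝ)).indicator 1 r =
      (Iio (1 : ℝ)).indicator (fun r => ENNReal.ofReal (r ^ 2)) r := by
    intro r; by_cases h : r < 1 <;> simp [indicator, h]
  simp_rw [this]
  rw [lintegral_indicator measurableSet_Iio, Measure.restrict_restrict measurableSet_Iio,
    inter_comm, Ioi_inter_Iio, Measure.restrict_congr_set Ioo_ae_eq_Ioc,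
    ← ofReal_integral_eq_lintegral_ofReal (intervalIntegral.intervalIntegrable_pow 2).1
      (.of_forall fun r => sq_nonneg r), ← intervalIntegral.integral_of_le zero_le_one]
  norm_num

/-- Integrals over the sphere as integrals over the unit ball. -/
lemma lintegral_ball_eq_surf {H : Vel → ℝ≥0∞} (hH : Measurable H) :
    ∫⁻ x : Vel, (Iio (1 : ℝ)).indicator 1 ‖x‖ * H (‖x‖⁻¹ • x) =
      ENNReal.ofReal (1 / 3) * ∫⁻ Ω : S2, H Ω ∂surf := by
  have hm : Measurable (fun x : Vel => (Iio (1 : ℝ)).indicator (1 : ℝ → ℝ≥0∞) ‖x‖ *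
      H (‖x‖⁻¹ • x)) :=
    ((measurable_one.indicator measurableSet_Iio).comp measurable_norm).mul
      (hH.comp (by fun_prop))
  rw [lintegral_polar hm, ← lintegral_const_mul _ (f := fun Ω : S2 => H Ω) (by fun_prop)]
  refine lintegral_congr fun Ω => ?_
  rw [← lintegral_Ioo_sq, ← lintegral_mul_const _ (by
    exact Measurable.mul (by fun_prop) (measurable_one.indicator measurableSet_Iio))]
  refine setLIntegral_congr_fun measurableSet_Ioi fun r hr => ?_
  have hr' : (0 : ℝ) < r := hr
  have hn : ‖r • (Ω : Vel)‖ = r := by simp [norm_smul, abs_of_pos hr']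
  simp only [hn, smul_smul, inv_mul_cancel₀ hr'.ne', one_smul, mul_assoc]

/-- The surface measure is reached only through polar coordinates. Extending functions of the
direction to the unit ball multiplies their integrals by the same factor `1/3 = ∫₀¹ r² dr`, so
identities on the sphere can be proved by changes of variables for Lebesgue measure. -/
lemma lintegral_surf_congr_of_ball {H G : Vel → ℝ≥0∞} (hH : Measurable H) (hG : Measurable G)
    (h : ∫⁻ x : Vel, (Iio (1 : ℝ)).indicator 1 ‖x‖ * H (‖x‖⁻¹ • x) =
      ∫⁻ x : Vel, (Iio (1 : ℝ)).indicator 1 ‖x‖ * G (‖x‖⁻¹ • x)) :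
    ∫⁻ Ω : S2, H Ω ∂surf = ∫⁻ Ω : S2, G Ω ∂surf := by
  rw [lintegral_ball_eq_surf hH, lintegral_ball_eq_surf hG] at h
  refine (ENNReal.mul_right_inj ?_ ENNReal.ofReal_ne_top).1 h
  simp

lemma lintegral_surf_neg {H : Vel → ℝ≥0∞} (hH : Measurable H) :
    ∫⁻ Ω : S2, H (-Ω) ∂surf = ∫⁻ Ω : S2, H Ω ∂surf := by
  refine lintegral_surf_congr_of_ball (H := fun x => H (-x)) (hH.comp measurable_neg) hH ?_
  rw [← lintegral_neg_eq_self]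
  simp


lemma lintegral_eq_Ioi_add {f : ℝ → ℝ≥0∞} (hf : Measurable f) :
    ∫⁻ x, f x = ∫⁻ x in Ioi (0 : ℝ), (f x + f (-x)) := by
  rw [lintegral_add_left hf, ← lintegral_add_compl f (measurableSet_Ioi (a := (0 : ℝ))), compl_Ioi]
  congr 1
  rw [Measure.restrict_congr_set Iio_ae_eq_Iic.symm]
  have h := (Measure.measurePreserving_neg (volume : Measure ℝ)).setLIntegral_comp_preimage
    (measurableSet_Ioi (a := (0 : ℝ))) (f := fun x => f (-x)) (hf.comp measurable_neg)
  simpa using h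

/-- The upper and the right half-plane share the first quadrant, and the central symmetry maps their
remaining quadrants onto each other. -/
lemma lintegral_upper_eq_right {V : ℝ → ℝ → ℝ≥0∞} (hV : Measurable (Function.uncurry V))
    (hev : ∀ x y, V (-x) (-y) = V x y) :
    ∫⁻ x, ∫⁻ y in Ioi (0 : ℝ), V x y = ∫⁻ x in Ioi (0 : ℝ), ∫⁻ y, V x y := by
  have hV1 : ∀ x, Measurable (V x) := fun x => hV.comp measurable_prodMk_left
  have e1 : Measurable fun x => ∫⁻ y in Ioi (0 : ℝ), V x y := hV.lintegral_prod_right'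
  rw [lintegral_eq_Ioi_add e1]
  refine lintegral_congr fun x => ?_
  rw [lintegral_eq_Ioi_add (hV1 x), lintegral_add_left (hV1 x)]
  congr 1
  refine lintegral_congr fun y => ?_
  rw [← hev, neg_neg]

/-- Exchanging the roles of the two post-collisional velocities. -/
lemma lintegral_surf_swap (w : Vel) {Φ : Vel → ℝ≥0∞} (hΦ : Measurable Φ) :
    ∫⁻ Ω : S2, ENNReal.ofReal |inner ℝ (Ω : Vel) w| * Φ ((inner ℝ (Ω : Vel) w) • (Ω : Vel)) ∂surf =
    ∫⁻ Ω : S2, ENNReal.ofReal |inner ℝ (Ω : Vel) w| * Φ (w - (inner ℝ (Ω : Vel) w) • (Ω : Vel))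
      ∂surf := by
  rcases eq_or_ne w 0 with rfl | hw
  · simp
  set c : ℝ := ‖w‖ with hc
  have hcpos : 0 < c := norm_pos_iff.2 hw
  obtain ⟨b, hb⟩ := exists_orthonormalBasis_zero (c⁻¹ • w) (by
    rw [norm_smul, norm_inv, Real.norm_of_nonneg hcpos.le, inv_mul_cancel₀ hcpos.ne'])
  have hw' : w = c • b 0 := by rw [hb, smul_smul, mul_inv_cancel₀ hcpos.ne', one_smul]
  -- Cylindrical coordinates with axis `w`, for the direction of `x b₀ + y (cos θ b₁ + sin θ b₂)`,
  -- `y > 0`. The Jacobian `y` times `|Ω·w|` gives `c |xy| / √(x² + y²)`, which is symmetric in `x`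
  -- and `y`. Replacing `(Ω·w)Ω` by `w - (Ω·w)Ω` is then the quarter turn `(x, y) ↦ (y, -x)`.
  set U : ℝ → ℝ → ℝ → ℝ≥0∞ := fun x y θ =>
    (Iio (1 : ℝ)).indicator 1 (√(x ^ 2 + y ^ 2)) * ENNReal.ofReal (c * |x * y| / √(x ^ 2 + y ^ 2)) *
      Φ ((c / (x ^ 2 + y ^ 2)) • (x ^ 2 • b 0 + (x * y) • (Real.cos θ • b 1 + Real.sin θ • b 2)))
    with hU
  have hind : Measurable ((Iio (1 : ℝ)).indicator (1 : ℝ → ℝ≥0∞)) :=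
    measurable_one.indicator measurableSet_Iio
  have hUm : Measurable (fun q : (ℝ × ℝ) × ℝ => U q.1.1 q.1.2 q.2) := by
    refine Measurable.mul (Measurable.mul ?_ ?_) ?_
    · exact hind.comp (by fun_prop)
    · fun_prop
    · exact hΦ.comp (by fun_prop)
  set V : ℝ → ℝ → ℝ≥0∞ := fun x y => ∫⁻ θ in Ioo (-Real.pi) Real.pi, U x y θ with hV
  have hVm : Measurable (Function.uncurry V) := hUm.lintegral_prod_right'
  have hVev : ∀ x y, V (-x) (-y) = V x y := fun x y => by simp [hV, hU]
  have key : ∀ (J : Vel → ℝ≥0∞) (V' : ℝ → ℝ → ℝ → ℝ≥0∞), Measurable J →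
      (∀ x y θ, 0 < y → ENNReal.ofReal y * ((Iio (1 : ℝ)).indicator 1 (√(x ^ 2 + y ^ 2)) *
        J ((√(x ^ 2 + y ^ 2))⁻¹ • (x • b 0 + (y * Real.cos θ) • b 1 + (y * Real.sin θ) • b 2))) =
        V' x y θ) → 
      ∫⁻ x : Vel, (Iio (1 : ℝ)).indicator 1 ‖x‖ * J (‖x‖⁻¹ • x) = 
        ∫⁻ x, ∫⁻ y in Ioi (0 : ℝ), ∫⁻ θ in Ioo (-Real.pi) Real.pi, V' x y θ := by
    intro J V' hJ h
    have hm : Measurable (fun x : Vel => (Iio (1 : ℝ)).indicator (1 : ℝ → ℝ≥0∞) ‖x‖ *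
        J (‖x‖⁻¹ • x)) := (hind.comp measurable_norm).mul (hJ.comp (by fun_prop))
    rw [lintegral_eq_coordinates b hm]
    refine lintegral_congr fun x => ?_
    rw [← lintegral_comp_polarCoord_symm, polarCoord_target, Measure.volume_eq_prod,
      ← Measure.prod_restrict, lintegral_prod]
    · refine setLIntegral_congr_fun measurableSet_Ioi fun y hy => ?_
      refine lintegral_congr fun θ => ?_
      rw [← h x y θ hy]
      have hn : ‖x • b 0 + (y * Real.cos θ) • b 1 + (y * Real.sin θ) • b 2‖ = √(x ^ 2 + y ^ 2) := by
        have := b.sum_sq_inner_right (x • b 0 + (y * Real.cos θ) • b 1 + (y * Real.sin θ) • b 2)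
        rw [← Real.sqrt_sq (norm_nonneg _), ← this, Fin.sum_univ_three]
        simp only [inner_add_right, inner_smul_right, b.inner_eq_ite]
        simp
        congr 1
        linear_combination y ^ 2 * (Real.sin_sq_add_cos_sq θ)
      simp only [polarCoord_symm_apply, smul_eq_mul, hn]
    · refine (Measurable.mul (by fun_prop) (hm.comp ?_)).aemeasurable
      simp only [polarCoord_symm_apply]
      fun_prop
  refine lintegral_surf_congr_of_ball
    (H := fun x => ENNReal.ofReal |inner ℝ x w| * Φ ((inner ℝ x w) • x))
    (G := fun x => ENNReal.ofReal |inner ℝ x w| * Φ (w - (inner ℝ x w) • x))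
    (Measurable.mul (by fun_prop) (hΦ.comp (by fun_prop)))
    (Measurable.mul (by fun_prop) (hΦ.comp (by fun_prop))) ?_
  have hin : ∀ x y θ, inner ℝ ((√(x ^ 2 + y ^ 2))⁻¹ • (x • b 0 + (y * Real.cos θ) • b 1 +
      (y * Real.sin θ) • b 2)) w = (√(x ^ 2 + y ^ 2))⁻¹ * (c * x) := by
    intro x y θ
    rw [hw']
    simp only [inner_smul_left, inner_add_left, inner_smul_right, b.inner_eq_ite]
    simp
    ring
  have hfac : ∀ x y : ℝ, 0 < y → ENNReal.ofReal y * ENNReal.ofReal |(√(x ^ 2 + y ^ 2))⁻¹ * (c * x)| =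
      ENNReal.ofReal (c * |x * y| / √(x ^ 2 + y ^ 2)) := by
    intro x y hy
    rw [← ENNReal.ofReal_mul hy.le, abs_mul, abs_mul, abs_mul, abs_of_pos hcpos, abs_of_pos hy,
      abs_of_nonneg (inv_nonneg.2 (Real.sqrt_nonneg _))]
    congr 1
    ring
  rw [key (fun x => ENNReal.ofReal |inner ℝ x w| * Φ ((inner ℝ x w) • x))
      (fun x y θ => U x y θ) (by fun_prop),
    key (fun x => ENNReal.ofReal |inner ℝ x w| * Φ (w - (inner ℝ x w) • x))
      (fun x y θ => U y (-x) θ) (by fun_prop)]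
  · change ∫⁻ x, ∫⁻ y in Ioi (0 : ℝ), V x y = ∫⁻ x, ∫⁻ y in Ioi (0 : ℝ), V y (-x)
    -- The quarter turn changes the half-plane of integration; evenness of `V` makes the two
    -- half-planes equivalent.
    rw [lintegral_upper_eq_right hVm hVev, ← lintegral_neg_eq_self (fun x => ∫⁻ y in Ioi (0 : ℝ), V y (-x))]
    simp only [neg_neg]
    exact lintegral_lintegral_swap hVm.aemeasurable
  · intro x y θ hy
    have hN : 0 < y ^ 2 + x ^ 2 := by positivity
    have hN' : 0 < x ^ 2 + y ^ 2 := by positivity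
    simp only [hin, hU]
    rw [neg_sq, add_comm (y ^ 2), mul_neg, abs_neg, mul_comm y x, ← hfac x y hy]
    have hv : w - ((√(x ^ 2 + y ^ 2))⁻¹ * (c * x)) • (√(x ^ 2 + y ^ 2))⁻¹ •
        (x • b 0 + (y * Real.cos θ) • b 1 + (y * Real.sin θ) • b 2) =
        (c / (x ^ 2 + y ^ 2)) • (y ^ 2 • b 0 + (-(x * y)) • (Real.cos θ • b 1 + Real.sin θ • b 2)) := by
      rw [hw']
      have hs : (√(x ^ 2 + y ^ 2))⁻¹ * (√(x ^ 2 + y ^ 2))⁻¹ = (x ^ 2 + y ^ 2)⁻¹ := by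
        rw [← mul_inv, Real.mul_self_sqrt hN'.le]
      rw [smul_smul, mul_right_comm, hs]
      match_scalars <;> field_simp <;> ring
    rw [hv]
    ring
  · intro x y θ hy
    have hN' : 0 < x ^ 2 + y ^ 2 := by positivity
    simp only [hin, hU]
    rw [← hfac x y hy]
    have hv : ((√(x ^ 2 + y ^ 2))⁻¹ * (c * x)) • (√(x ^ 2 + y ^ 2))⁻¹ •
        (x • b 0 + (y * Real.cos θ) • b 1 + (y * Real.sin θ) • b 2) =
        (c / (x ^ 2 + y ^ 2)) • (x ^ 2 • b 0 + (x * y) • (Real.cos θ • b 1 + Real.sin θ • b 2)) := by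
      have hs : (√(x ^ 2 + y ^ 2))⁻¹ * (√(x ^ 2 + y ^ 2))⁻¹ = (x ^ 2 + y ^ 2)⁻¹ := by
        rw [← mul_inv, Real.mul_self_sqrt hN'.le]
      rw [smul_smul, mul_right_comm, hs]
      match_scalars <;> field_simp
    rw [hv]
    ring

end HardSphere

end

/-! ### The explicit kernel of the gain terms -/

noncomputable section
namespace HardSphere
open MeasureTheory Set
open scoped ENNReal

/-- The rate `3 / (4e)` of the Maxwellian. -/
def rate (u : FluidState) : ℝ := 3 / (4 * u.e)

/-- The maximum of the Maxwellian. -/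
def amp (u : FluidState) : ℝ := u.rho / Real.sqrt ((4 * Real.pi * u.e / 3) ^ 3)

lemma rate_pos (u : FluidState) : 0 < rate u := by
  have := u.e_pos
  unfold rate
  positivity

lemma amp_pos (u : FluidState) : 0 < amp u := by
  have h1 := u.rho_pos
  have h2 := u.e_pos
  have h3 := Real.pi_pos
  unfold amp
  positivity

lemma maxwellian_eq (u : FluidState) (ξ : Vel) :
    maxwellian u ξ = amp u * Real.exp (-rate u * ‖ξ - u.v‖ ^ 2) := by
  have h2 := u.e_pos
  unfold maxwellian amp rate
  congr 2
  field_simp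

lemma lintegral_gaussian_shift {a : ℝ} (ha : 0 < a) (c : ℝ) :
    ∫⁻ x : ℝ, ENNReal.ofReal (Real.exp (-a * (c + x) ^ 2)) = ENNReal.ofReal (√(Real.pi / a)) := by
  rw [lintegral_add_left_eq_self (fun x : ℝ => ENNReal.ofReal (Real.exp (-a * x ^ 2))),
    ← integral_gaussian a, ofReal_integral_eq_lintegral_ofReal (integrable_exp_neg_mul_sq ha)]
  exact .of_forall fun x => (Real.exp_pos _).le

/-- Integration of a Gaussian over the planes orthogonal to a direction. -/
lemma lintegral_line_gaussian {a : ℝ} (ha : 0 < a) (Ω c : Vel) (hΩ : ‖Ω‖ = 1) {g : ℝ → ℝ≥0∞}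
    (hg : Measurable g) :
    ∫⁻ w : Vel, g (inner ℝ Ω w) *
      ENNReal.ofReal (Real.exp (-a * ‖c + w - (inner ℝ Ω w) • Ω‖ ^ 2)) =
      ENNReal.ofReal (Real.pi / a * Real.exp (-a * (inner ℝ Ω c) ^ 2)) * ∫⁻ r, g r := by
  obtain ⟨b, hb⟩ := exists_orthonormalBasis_zero Ω hΩ
  rw [lintegral_eq_coordinates b (by fun_prop)]
  have hin : ∀ (x : ℝ) (z : ℝ × ℝ), inner ℝ Ω (x • b 0 + z.1 • b 1 + z.2 • b 2) = x := by
    intro x z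
    rw [← hb]
    simp only [inner_add_right, inner_smul_right, b.inner_eq_ite]
    simp
  have hn : ∀ (x : ℝ) (z : ℝ × ℝ), ‖c + (x • b 0 + z.1 • b 1 + z.2 • b 2) - x • Ω‖ ^ 2 =
      (inner ℝ Ω c) ^ 2 + ((inner ℝ (b 1) c + z.1) ^ 2 + (inner ℝ (b 2) c + z.2) ^ 2) := by
    intro x z
    rw [← b.sum_sq_inner_right, Fin.sum_univ_three, ← hb]
    simp only [inner_add_right, inner_sub_right, inner_smul_right, b.inner_eq_ite]
    simp
    ring
  rw [← lintegral_const_mul _ hg]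
  refine lintegral_congr fun x => ?_
  simp only [hin, hn, mul_add (-a), Real.exp_add]
  rw [lintegral_const_mul _ (by fun_prop), mul_comm]
  congr 1
  simp only [ENNReal.ofReal_mul (Real.exp_pos _).le]
  rw [lintegral_const_mul _ (by fun_prop), mul_comm, Measure.volume_eq_prod,
    lintegral_prod_mul (f := fun x : ℝ => ENNReal.ofReal (Real.exp (-a * (inner ℝ (b 1) c + x) ^ 2)))
      (g := fun x : ℝ => ENNReal.ofReal (Real.exp (-a * (inner ℝ (b 2) c + x) ^ 2)))
      (by fun_prop) (by fun_prop),
    lintegral_gaussian_shift ha, lintegral_gaussian_shift ha, ← ENNReal.ofReal_mul (Real.sqrt_nonneg _),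
    Real.mul_self_sqrt (by have := Real.pi_pos; positivity), ← ENNReal.ofReal_mul (by
      have := Real.pi_pos; positivity)]

/-- The kernel of the gain terms of the linearized operator. -/
def gainKernel (u : FluidState) (ξ y : Vel) : ℝ :=
  2 * amp u * (Real.pi / rate u) * ‖y - ξ‖⁻¹ *
    Real.exp (-rate u * (‖y - ξ‖⁻¹ * inner ℝ (y - ξ) (ξ - u.v)) ^ 2)

lemma gainKernel_nonneg (u : FluidState) (ξ y : Vel) : 0 ≤ gainKernel u ξ y := by
  have h1 := amp_pos u
  have h2 := rate_pos u
  have h3 := Real.pi_pos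
  unfold gainKernel
  positivity

lemma measurable_gainKernel (u : FluidState) :
    Measurable (fun p : Vel × Vel => gainKernel u p.1 p.2) := by
  unfold gainKernel
  fun_prop

lemma measurable_gainKernel_right (u : FluidState) (ξ : Vel) :
    Measurable (fun y => gainKernel u ξ y) := by
  unfold gainKernel
  fun_prop

lemma continuous_post : Continuous (fun q : Vel × Vel × S2 => post q.1 q.2.1 q.2.2) := by
  unfold post
  fun_prop

lemma continuous_postStar : Continuous (fun q : Vel × Vel × S2 => postStar q.1 q.2.1 q.2.2) := by
  unfold postStar
  fun_prop

lemma continuous_kernel :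
    Continuous (fun q : Vel × Vel × S2 => hardSphereKernel q.2.2 (q.1 - q.2.1)) := by
  unfold hardSphereKernel
  fun_prop

lemma measurable_post_right (ξ : Vel) : Measurable (fun p : Vel × S2 => post ξ p.1 p.2) :=
  (continuous_post.comp (f := fun p : Vel × S2 => (ξ, p)) (by fun_prop)).measurable

lemma measurable_postStar_right (ξ : Vel) : Measurable (fun p : Vel × S2 => postStar ξ p.1 p.2) :=
  (continuous_postStar.comp (f := fun p : Vel × S2 => (ξ, p)) (by fun_prop)).measurable

lemma measurable_kernel_right (ξ : Vel) :
    Measurable (fun p : Vel × S2 => hardSphereKernel p.2 (ξ - p.1)) :=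
  (continuous_kernel.comp (f := fun p : Vel × S2 => (ξ, p)) (by fun_prop)).measurable

lemma hardSphereKernel_nonneg (Ω : S2) (z : Vel) : 0 ≤ hardSphereKernel Ω z := abs_nonneg _

/-- Fix `Ω` and write `ξ_* = ξ + w`, `r = Ω·w`. Then `ξ' = ξ + rΩ` sees only the component of `w`
along `Ω`, and `ξ'_*` only the orthogonal one, so the Maxwellian integrates over the orthogonal
plane to a Gaussian in `Ω·(ξ - v)`. The pair `(r, Ω)` becomes polar coordinates of `y - ξ`: the
collision weight `|r|` against the Jacobian `r²` leaves `|y - ξ|⁻¹`, and since `r` runs over the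
whole line every `y` is counted twice. -/
lemma lintegral_gain (u : FluidState) (ξ : Vel) {Φ : Vel → ℝ≥0∞} (hΦ : Measurable Φ) :
    ∫⁻ p, ENNReal.ofReal (hardSphereKernel p.2 (ξ - p.1) * maxwellian u (postStar ξ p.1 p.2)) *
      Φ (post ξ p.1 p.2) ∂collisionMeasure = ∫⁻ y, ENNReal.ofReal (gainKernel u ξ y) * Φ y := by
  have h1 := measurable_post_right ξ
  have h2 := measurable_postStar_right ξ
  have h3 := measurable_kernel_right ξ
  have h4 := (continuous_maxwellian u).measurable
  have ha := rate_pos u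
  have hA := amp_pos u
  have hpi := Real.pi_pos
  unfold collisionMeasure
  rw [lintegral_prod_symm _ (by fun_prop)]
  have inner_eq : ∀ Ω : S2, ∫⁻ y, ENNReal.ofReal (hardSphereKernel Ω (ξ - y) *
      maxwellian u (postStar ξ y Ω)) * Φ (post ξ y Ω) =
      ENNReal.ofReal (amp u * (Real.pi / rate u) *
        Real.exp (-rate u * (inner ℝ (Ω : Vel) (ξ - u.v)) ^ 2)) *
      ∫⁻ r in Ioi (0 : ℝ), ENNReal.ofReal r * (Φ (ξ + r • (Ω : Vel)) + Φ (ξ + r • (-(Ω : Vel)))) := by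
    intro Ω
    have hΩ : ‖(Ω : Vel)‖ = 1 := by simp
    rw [← lintegral_add_left_eq_self _ ξ]
    have : ∀ w : Vel, ENNReal.ofReal (hardSphereKernel Ω (ξ - (ξ + w)) *
        maxwellian u (postStar ξ (ξ + w) Ω)) * Φ (post ξ (ξ + w) Ω) =
        ENNReal.ofReal (amp u) * ((fun r : ℝ => ENNReal.ofReal |r| * Φ (ξ + r • (Ω : Vel)))
          (inner ℝ (Ω : Vel) w) * ENNReal.ofReal (Real.exp (-rate u *
          ‖(ξ - u.v) + w - (inner ℝ (Ω : Vel) w) • (Ω : Vel)‖ ^ 2))) := by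
      intro w
      have e1 : hardSphereKernel Ω (ξ - (ξ + w)) = |inner ℝ (Ω : Vel) w| := by
        simp [hardSphereKernel]
      have e2 : maxwellian u (postStar ξ (ξ + w) Ω) = amp u * Real.exp (-rate u *
          ‖(ξ - u.v) + w - (inner ℝ (Ω : Vel) w) • (Ω : Vel)‖ ^ 2) := by
        rw [maxwellian_eq, postStar]
        congr 4
        rw [add_sub_cancel_left]
        congr 1
        abel
      rw [e1, e2, post, add_sub_cancel_left, ENNReal.ofReal_mul (abs_nonneg _),
        ENNReal.ofReal_mul hA.le]
      ring
    simp_rw [this]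
    rw [lintegral_const_mul _ (by fun_prop), lintegral_line_gaussian ha _ _ hΩ
      (g := fun r : ℝ => ENNReal.ofReal |r| * Φ (ξ + r • (Ω : Vel))) (by fun_prop),
      ← mul_assoc, ← ENNReal.ofReal_mul hA.le, ← mul_assoc]
    congr 1
    rw [lintegral_eq_Ioi_add (by fun_prop)]
    refine setLIntegral_congr_fun measurableSet_Ioi fun r hr => ?_
    have hr' : (0 : ℝ) < r := hr
    simp only [abs_neg, abs_of_pos hr', mul_add, neg_smul, smul_neg]
  rw [lintegral_congr inner_eq]
  have e1 : ∫⁻ y, ENNReal.ofReal (gainKernel u ξ y) * Φ y =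
      ∫⁻ Ω : S2, 2 * (ENNReal.ofReal (amp u * (Real.pi / rate u) *
        Real.exp (-rate u * (inner ℝ (Ω : Vel) (ξ - u.v)) ^ 2)) *
      ∫⁻ r in Ioi (0 : ℝ), ENNReal.ofReal r * Φ (ξ + r • (Ω : Vel))) ∂surf := by
    have h5 := measurable_gainKernel_right u ξ
    rw [← lintegral_add_left_eq_self _ ξ, lintegral_polar (by fun_prop)]
    refine lintegral_congr fun Ω => ?_
    rw [← mul_assoc, ← lintegral_const_mul _ (by fun_prop)]
    refine setLIntegral_congr_fun measurableSet_Ioi fun r hr => ?_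
    have hr' : (0 : ℝ) < r := hr
    have hn : ‖r • (Ω : Vel)‖ = r := by simp [norm_smul, abs_of_pos hr']
    have hk : r ^ 2 * gainKernel u ξ (ξ + r • (Ω : Vel)) = 2 * (amp u * (Real.pi / rate u) *
        Real.exp (-rate u * (inner ℝ (Ω : Vel) (ξ - u.v)) ^ 2)) * r := by
      unfold gainKernel
      rw [add_sub_cancel_left, hn, real_inner_smul_left, inv_mul_cancel_left₀ hr'.ne']
      field_simp
    beta_reduce
    rw [← mul_assoc, ← ENNReal.ofReal_mul (by positivity), hk, ENNReal.ofReal_mul (by positivity),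
      ENNReal.ofReal_mul (by positivity), ENNReal.ofReal_ofNat, mul_assoc]
  set W : Vel → ℝ≥0∞ := fun x => ENNReal.ofReal (amp u * (Real.pi / rate u) *
        Real.exp (-rate u * (inner ℝ x (ξ - u.v)) ^ 2)) *
      ∫⁻ r in Ioi (0 : ℝ), ENNReal.ofReal r * Φ (ξ + r • x) with hW
  have hWm : Measurable W := by
    refine Measurable.mul (by fun_prop) ?_
    exact Measurable.lintegral_prod_right'
      (f := fun q : Vel × ℝ => ENNReal.ofReal q.2 * Φ (ξ + q.2 • q.1)) (by fun_prop)
  rw [e1, lintegral_const_mul _ (f := fun Ω : S2 => W Ω) (by fun_prop), two_mul]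
  -- The factor two is distributed over `Ω` and `-Ω`, which correspond to the two half-lines `r > 0`
  -- and `r < 0`.
  nth_rewrite 2 [← lintegral_surf_neg hWm]
  rw [← lintegral_add_left (by fun_prop)]
  refine lintegral_congr fun Ω => ?_
  simp only [hW, inner_neg_left, neg_sq]
  rw [← mul_add, ← lintegral_add_left (by fun_prop)]
  simp only [mul_add]

/-- For fixed `ξ_*`, `lintegral_surf_swap` with `w = ξ_* - ξ` exchanges `ξ'` and `ξ'_*`, so both
gain terms of the linearization have the same kernel. -/
lemma lintegral_gainStar (u : FluidState) (ξ : Vel) {Φ : Vel → ℝ≥0∞} (hΦ : Measurable Φ) :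
    ∫⁻ p, ENNReal.ofReal (hardSphereKernel p.2 (ξ - p.1) * maxwellian u (post ξ p.1 p.2)) *
      Φ (postStar ξ p.1 p.2) ∂collisionMeasure = ∫⁻ y, ENNReal.ofReal (gainKernel u ξ y) * Φ y := by
  have h1 := measurable_post_right ξ
  have h2 := measurable_postStar_right ξ
  have h3 := measurable_kernel_right ξ
  have h4 := (continuous_maxwellian u).measurable
  rw [← lintegral_gain u ξ hΦ]
  unfold collisionMeasure
  rw [lintegral_prod _ (by fun_prop), lintegral_prod _ (by fun_prop)]
  refine lintegral_congr fun y => ?_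
  have h := lintegral_surf_swap (y - ξ) (Φ := fun p => ENNReal.ofReal (maxwellian u (ξ + p)) *
    Φ (y - p)) (by fun_prop)
  have e : ∀ Ω : S2, hardSphereKernel Ω (ξ - y) = |inner ℝ (Ω : Vel) (y - ξ)| := by
    intro Ω
    rw [hardSphereKernel, ← neg_sub, inner_neg_right, abs_neg]
  simp only [e, ENNReal.ofReal_mul (abs_nonneg _), mul_assoc, post, postStar]
  refine h.trans (lintegral_congr fun Ω => ?_)
  congr 3
  · congr 1; abel
  · abel

end HardSphere

end

/-! ### Loss terms and the splitting into a nonlocal and a local part -/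

noncomputable section
namespace HardSphere
open MeasureTheory Set
open scoped ENNReal

/-- An identity between weighted integrals of nonnegative functions along a map extends to
Bochner integrals. -/
lemma integrable_and_integral_of_lintegral_eq {X Y : Type*} [MeasurableSpace X] [MeasurableSpace Y]
    {μ : Measure X} {ν : Measure Y} {w : X → ℝ} {m : X → Y} {k : Y → ℝ}
    (hw : Measurable w) (hw0 : ∀ p, 0 ≤ w p) (hm : Measurable m) (hk : Measurable k)
    (hk0 : ∀ y, 0 ≤ k y)
    (H : ∀ Φ : Y → ℝ≥0∞, Measurable Φ →
      ∫⁻ p, ENNReal.ofReal (w p) * Φ (m p) ∂μ = ∫⁻ y, ENNReal.ofReal (k y) * Φ y ∂ν)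
    {f : Y → ℂ} (hf : AEStronglyMeasurable f ν) :
    (Integrable (fun p => w p • f (m p)) μ ↔ Integrable (fun y => k y • f y) ν) ∧
      ∫ p, w p • f (m p) ∂μ = ∫ y, k y • f y ∂ν := by
  -- Tested on indicators, `H` says that `m` pushes `w μ` forward to `k ν`. In this form it applies
  -- to `f` that is only almost everywhere strongly measurable, as null sets of `ν` pull back to
  -- null sets of `w μ`.
  have hmap : (μ.withDensity (fun p => ENNReal.ofReal (w p))).map m =
      ν.withDensity (fun y => ENNReal.ofReal (k y)) := by
    ext s hs
    have := H (s.indicator 1) (measurable_one.indicator hs)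
    rw [Measure.map_apply hm hs, withDensity_apply _ (hm hs), withDensity_apply _ hs,
      ← lintegral_indicator (hm hs), ← lintegral_indicator hs]
    convert! this using 2
    · ext p; by_cases h : m p ∈ s <;> simp [indicator, h]
    · ext y; by_cases h : y ∈ s <;> simp [indicator, h]
  have hf' : AEStronglyMeasurable f ((μ.withDensity (fun p => ENNReal.ofReal (w p))).map m) := by
    rw [hmap]
    exact hf.mono_ac (withDensity_absolutelyContinuous _ _)
  constructor
  · have h1 := integrable_withDensity_iff_integrable_smul' (μ := μ) hw.ennreal_ofReal
      (.of_forall fun _ => ENNReal.ofReal_lt_top) (g := fun p => f (m p))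
    have h2 := integrable_withDensity_iff_integrable_smul' (μ := ν) hk.ennreal_ofReal
      (.of_forall fun _ => ENNReal.ofReal_lt_top) (g := f)
    simp only [ENNReal.toReal_ofReal (hw0 _), ENNReal.toReal_ofReal (hk0 _)] at h1 h2
    rw [← h1, ← h2, ← hmap, integrable_map_measure hf' hm.aemeasurable]
    rfl
  · have h1 := integral_withDensity_eq_integral_toReal_smul (μ := μ) hw.ennreal_ofReal
      (.of_forall fun _ => ENNReal.ofReal_lt_top) (g := fun p => f (m p))
    have h2 := integral_withDensity_eq_integral_toReal_smul (μ := ν) hk.ennreal_ofReal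
      (.of_forall fun _ => ENNReal.ofReal_lt_top) (g := f)
    simp only [ENNReal.toReal_ofReal (hw0 _), ENNReal.toReal_ofReal (hk0 _)] at h1 h2
    rw [← h1, ← h2, ← hmap, integral_map hm.aemeasurable hf']

/-- The total cross section at unit relative velocity. -/
def crossSection : ℝ := ∫ Ω : S2, |inner ℝ (Ω : Vel) (EuclideanSpace.single 0 1)| ∂surf

lemma continuous_abs_inner (z : Vel) : Continuous (fun Ω : S2 => |inner ℝ (Ω : Vel) z|) := by
  fun_prop

lemma integrable_abs_inner (z : Vel) : Integrable (fun Ω : S2 => |inner ℝ (Ω : Vel) z|) surf :=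
  (continuous_abs_inner z).integrable_of_hasCompactSupport (.of_compactSpace _)

lemma crossSection_pos : 0 < crossSection := by
  refine (continuous_abs_inner _).integral_pos_of_hasCompactSupport_nonneg_nonzero
    (.of_compactSpace _) (fun Ω => abs_nonneg _)
    (x := ⟨EuclideanSpace.single 0 1, by simp⟩) ?_
  simp

/-- Rotation invariance, obtained by writing the ball integral in two orthonormal bases, reduces
unit vectors to the one in `crossSection`; homogeneity does the rest. -/
lemma lintegral_abs_inner (z : Vel) :
    ∫⁻ Ω : S2, ENNReal.ofReal |inner ℝ (Ω : Vel) z| ∂surf = ENNReal.ofReal (crossSection * ‖z‖) := by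
  have hbase : ∀ b b' : OrthonormalBasis (Fin 3) ℝ Vel,
      ∫⁻ Ω : S2, ENNReal.ofReal |inner ℝ (Ω : Vel) (b 0)| ∂surf =
      ∫⁻ Ω : S2, ENNReal.ofReal |inner ℝ (Ω : Vel) (b' 0)| ∂surf := by
    intro b b'
    have hind : Measurable ((Iio (1 : ℝ)).indicator (1 : ℝ → ℝ≥0∞)) :=
      measurable_one.indicator measurableSet_Iio
    refine lintegral_surf_congr_of_ball (H := fun x => ENNReal.ofReal |inner ℝ x (b 0)|)
      (G := fun x => ENNReal.ofReal |inner ℝ x (b' 0)|) (by fun_prop) (by fun_prop) ?_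
    have hc : ∀ b : OrthonormalBasis (Fin 3) ℝ Vel, ∀ (x : ℝ) (z : ℝ × ℝ),
        inner ℝ (x • b 0 + z.1 • b 1 + z.2 • b 2) (b 0) = x ∧
        ‖x • b 0 + z.1 • b 1 + z.2 • b 2‖ = √(x ^ 2 + z.1 ^ 2 + z.2 ^ 2) := by
      intro b x z
      constructor
      · simp only [inner_add_left, inner_smul_left, b.inner_eq_ite]
        simp
      · rw [← Real.sqrt_sq (norm_nonneg _), ← b.sum_sq_inner_right, Fin.sum_univ_three]
        simp only [inner_add_right, inner_smul_right, b.inner_eq_ite]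
        simp
    rw [lintegral_eq_coordinates b (by fun_prop), lintegral_eq_coordinates b' (by fun_prop)]
    refine lintegral_congr fun x => lintegral_congr fun y => ?_
    simp only [real_inner_smul_left, (hc b x y).1, (hc b x y).2, (hc b' x y).1, (hc b' x y).2]
  have hunit : ∀ e : Vel, ‖e‖ = 1 → ∫⁻ Ω : S2, ENNReal.ofReal |inner ℝ (Ω : Vel) e| ∂surf =
      ENNReal.ofReal crossSection := by
    intro e he
    obtain ⟨b, rfl⟩ := exists_orthonormalBasis_zero e he
    obtain ⟨b', hb'⟩ := exists_orthonormalBasis_zero (EuclideanSpace.single 0 1) (by simp)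
    rw [hbase b b', hb', crossSection, ofReal_integral_eq_lintegral_ofReal (integrable_abs_inner _)
      (.of_forall fun _ => abs_nonneg _)]
  rcases eq_or_ne z 0 with rfl | hz
  · simp
  have hz' : ‖z‖ ≠ 0 := norm_ne_zero_iff.2 hz
  have h := hunit (‖z‖⁻¹ • z) (by rw [norm_smul, norm_inv, norm_norm, inv_mul_cancel₀ hz'])
  rw [mul_comm, ENNReal.ofReal_mul (norm_nonneg _), ← h,
    ← lintegral_const_mul _ (by fun_prop)]
  refine lintegral_congr fun Ω => ?_
  rw [← ENNReal.ofReal_mul (norm_nonneg _), real_inner_smul_right, abs_mul, abs_inv, abs_norm,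
    mul_inv_cancel_left₀ hz']

lemma lintegral_loss (ξ : Vel) {Φ : Vel → ℝ≥0∞} (hΦ : Measurable Φ) :
    ∫⁻ p, ENNReal.ofReal (hardSphereKernel p.2 (ξ - p.1)) * Φ p.1 ∂collisionMeasure =
      ∫⁻ y, ENNReal.ofReal (crossSection * ‖ξ - y‖) * Φ y := by
  have h3 := measurable_kernel_right ξ
  unfold collisionMeasure
  rw [lintegral_prod _ (by fun_prop)]
  refine lintegral_congr fun y => ?_
  dsimp only
  rw [lintegral_mul_const _ (by unfold hardSphereKernel; fun_prop), ← lintegral_abs_inner]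
  rfl

/-- The collision frequency. -/
def freq (u : FluidState) (ξ : Vel) : ℝ := ∫ y, (crossSection * ‖ξ - y‖) * maxwellian u y

/-- The kernel of the nonlocal part of the linearized operator. -/
def nonlocalKernel (u : FluidState) (ξ y : Vel) : ℝ :=
  2 * gainKernel u ξ y - maxwellian u ξ * (crossSection * ‖ξ - y‖)

/-- The nonlocal part of the linearized operator. -/
def nonlocal (u : FluidState) (f : Vel → ℂ) (ξ : Vel) : ℂ := ∫ y, nonlocalKernel u ξ y • f y

/-- Convergence of the collision integrals, and the splitting of the linearized operator. -/
lemma linearized_eq_nonlocal_sub (u : FluidState) {f : Vel → ℂ} (hf : AEStronglyMeasurable f volume)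
    (ξ : Vel) (h1 : Integrable (fun y => gainKernel u ξ y • f y))
    (h2 : Integrable (fun y => (crossSection * ‖ξ - y‖) • f y))
    (h3 : Integrable (fun y => (crossSection * ‖ξ - y‖) * maxwellian u y)) :
    Integrable (collisionIntegrand (maxwellianC u) f ξ) collisionMeasure ∧
    Integrable (collisionIntegrand f (maxwellianC u) ξ) collisionMeasure ∧
    linearized u f ξ = nonlocal u f ξ - freq u ξ * f ξ := by
  have m1 := measurable_post_right ξ
  have m2 := measurable_postStar_right ξ
  have m3 := measurable_kernel_right ξ
  have m4 := (continuous_maxwellian u).measurable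
  have m5 := measurable_gainKernel_right u ξ
  have hB : ∀ p : Vel × S2, 0 ≤ hardSphereKernel p.2 (ξ - p.1) :=
    fun p => hardSphereKernel_nonneg _ _
  have hM := fun x => (maxwellian_pos u x).le
  have hc := crossSection_pos.le
  obtain ⟨a1, a2⟩ := integrable_and_integral_of_lintegral_eq (μ := collisionMeasure)
    (w := fun p => hardSphereKernel p.2 (ξ - p.1) * maxwellian u (postStar ξ p.1 p.2))
    (by fun_prop) (fun p => mul_nonneg (hB p) (hM _)) m1 m5 (gainKernel_nonneg u ξ)
    (fun Φ hΦ => lintegral_gain u ξ hΦ) hf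
  obtain ⟨b1, b2⟩ := integrable_and_integral_of_lintegral_eq (μ := collisionMeasure)
    (w := fun p => hardSphereKernel p.2 (ξ - p.1) * maxwellian u (post ξ p.1 p.2))
    (by fun_prop) (fun p => mul_nonneg (hB p) (hM _)) m2 m5 (gainKernel_nonneg u ξ)
    (fun Φ hΦ => lintegral_gainStar u ξ hΦ) hf
  obtain ⟨c1, c2⟩ := integrable_and_integral_of_lintegral_eq (μ := collisionMeasure)
    (w := fun p => hardSphereKernel p.2 (ξ - p.1)) (k := fun y => crossSection * ‖ξ - y‖)
    (by fun_prop) hB measurable_fst (by fun_prop) (fun y => by positivity)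
    (fun Φ hΦ => lintegral_loss ξ hΦ) hf
  obtain ⟨d1, d2⟩ := integrable_and_integral_of_lintegral_eq (μ := collisionMeasure)
    (w := fun p => hardSphereKernel p.2 (ξ - p.1)) (k := fun y => crossSection * ‖ξ - y‖)
    (by fun_prop) hB measurable_fst (by fun_prop) (fun y => by positivity)
    (fun Φ hΦ => lintegral_loss ξ hΦ) (f := maxwellianC u)
    (Complex.continuous_ofReal.comp (continuous_maxwellian u)).aestronglyMeasurable
  have A := a1.2 h1
  have B := b1.2 h1
  have C := c1.2 h2
  have D := d1.2 (by
    refine h3.ofReal (𝕜 := ℂ) |>.congr (.of_forall fun y => ?_)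
    simp [maxwellianC])
  have e1 : collisionIntegrand (maxwellianC u) f ξ = fun p =>
      (hardSphereKernel p.2 (ξ - p.1) * maxwellian u (post ξ p.1 p.2)) • f (postStar ξ p.1 p.2) -
      (maxwellian u ξ : ℂ) * (hardSphereKernel p.2 (ξ - p.1) • f p.1) := by
    ext p
    simp only [collisionIntegrand, maxwellianC, Complex.real_smul]
    push_cast
    ring
  have e2 : collisionIntegrand f (maxwellianC u) ξ = fun p =>
      (hardSphereKernel p.2 (ξ - p.1) * maxwellian u (postStar ξ p.1 p.2)) • f (post ξ p.1 p.2) -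
      f ξ * (hardSphereKernel p.2 (ξ - p.1) • maxwellianC u p.1) := by
    ext p
    simp only [collisionIntegrand, maxwellianC, Complex.real_smul]
    push_cast
    ring
  refine ⟨?_, ?_, ?_⟩
  · rw [e1]; exact B.sub (C.const_mul _)
  · rw [e2]; exact A.sub (D.const_mul _)
  · have hfr : ∫ y, (crossSection * ‖ξ - y‖) • maxwellianC u y = (freq u ξ : ℂ) := by
      rw [freq, ← integral_complex_ofReal]
      refine integral_congr_ae (.of_forall fun y => ?_)
      simp [maxwellianC]
    have hnl : nonlocal u f ξ = (∫ y, gainKernel u ξ y • f y) + (∫ y, gainKernel u ξ y • f y) -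
        (maxwellian u ξ : ℂ) * ∫ y, (crossSection * ‖ξ - y‖) • f y := by
      have h11 : Integrable (fun y => gainKernel u ξ y • f y + gainKernel u ξ y • f y) := h1.add h1
      rw [← integral_add h1 h1, ← integral_const_mul, ← integral_sub h11 (h2.const_mul _)]
      refine integral_congr_ae (.of_forall fun y => ?_)
      simp only [nonlocalKernel, Complex.real_smul]
      push_cast
      ring
    unfold linearized collision
    rw [e1, e2, integral_sub B (C.const_mul _), integral_sub A (D.const_mul _), integral_const_mul,
      integral_const_mul, a2, b2, c2, d2, hfr, hnl]
    ring

end HardSphere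

end

/-! ### Gaussian domination of the conjugated kernels -/

noncomputable section
namespace HardSphere
open MeasureTheory Set
open scoped ENNReal

/-- A convolution kernel which dominates the nonlocal part of the linearized operator. -/
def profile (b : ℝ) (z : Vel) : ℝ := (‖z‖⁻¹ + ‖z‖) * Real.exp (-b * ‖z‖ ^ 2)

lemma profile_nonneg (b : ℝ) (z : Vel) : 0 ≤ profile b z := by
  unfold profile
  positivity

lemma measurable_profile (b : ℝ) : Measurable (profile b) := by
  unfold profile
  fun_prop

lemma integrableOn_pow_mul_gaussian {b : ℝ} (hb : 0 < b) (n : ℕ) :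
    IntegrableOn (fun y : ℝ => y ^ n * Real.exp (-b * y ^ 2)) (Ioi 0) := by
  have h := (integrable_rpow_mul_exp_neg_mul_sq hb (s := (n : ℝ))
    (by have : (0 : ℝ) ≤ n := n.cast_nonneg; linarith)).integrableOn (s := Ioi (0 : ℝ))
  refine h.congr_fun (fun y _ => ?_) measurableSet_Ioi
  simp only [Real.rpow_natCast]

lemma integrable_profile {b : ℝ} (hb : 0 < b) : Integrable (profile b) := by
  refine (integrable_fun_norm_addHaar (volume : Measure Vel)
    (f := fun r : ℝ => (r⁻¹ + r) * Real.exp (-b * r ^ 2))).2 ?_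
  refine IntegrableOn.congr_fun ((integrableOn_pow_mul_gaussian hb 1).add
    (integrableOn_pow_mul_gaussian hb 3)) (fun y hy => ?_) measurableSet_Ioi
  have hy' : (0 : ℝ) < y := hy
  simp
  field_simp

/-- The singularity `|z|⁻²` is cancelled by the factor `r²` of polar coordinates in dimension three.
-/
lemma integrable_profile_sq {b : ℝ} (hb : 0 < b) : Integrable (fun z => profile b z ^ 2) := by
  have hb2 : 0 < 2 * b := by positivity
  refine (integrable_fun_norm_addHaar (volume : Measure Vel)
    (f := fun r : ℝ => ((r⁻¹ + r) * Real.exp (-b * r ^ 2)) ^ 2)).2 ?_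
  refine IntegrableOn.congr_fun (((integrableOn_pow_mul_gaussian hb2 0).add
    ((integrableOn_pow_mul_gaussian hb2 2).const_mul 2)).add
    (integrableOn_pow_mul_gaussian hb2 4)) (fun y hy => ?_) measurableSet_Ioi
  have hy' : (0 : ℝ) < y := hy
  have : Real.exp (-b * y ^ 2) ^ 2 = Real.exp (-(2 * b) * y ^ 2) := by
    rw [← Real.exp_nat_mul]; push_cast; ring_nf
  simp only [Pi.add_apply, mul_pow, this]
  simp
  field_simp
  ring

lemma maxwellian_rpow_mul (u : FluidState) (s : ℝ) (x y : Vel) :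
    maxwellian u x ^ (-s) * maxwellian u y ^ s =
      Real.exp (rate u * s * (‖x - u.v‖ ^ 2 - ‖y - u.v‖ ^ 2)) := by
  have hA := amp_pos u
  rw [maxwellian_eq, maxwellian_eq, Real.mul_rpow hA.le (Real.exp_pos _).le,
    Real.mul_rpow hA.le (Real.exp_pos _).le, ← Real.exp_mul, ← Real.exp_mul, Real.rpow_neg hA.le]
  have : amp u ^ s ≠ 0 := (Real.rpow_pos_of_pos hA s).ne'
  field_simp
  rw [← Real.exp_add]
  congr 1
  ring

/-- The constant in front of the dominating convolution kernel. -/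
def profileConst (u : FluidState) : ℝ :=
  4 * amp u * (Real.pi / rate u) + amp u * crossSection

lemma profileConst_pos (u : FluidState) : 0 < profileConst u := by
  have h1 := amp_pos u
  have h2 := rate_pos u
  have h3 := Real.pi_pos
  have h4 := crossSection_pos
  unfold profileConst
  positivity

/-- With `r = |y - x|` and `t` the component of `x - v` along `y - x`, the exponent divided by the
rate is `s(|x-v|² - |y-v|²) - t² = -(t + sr)² - s(1-s) r²`. -/
lemma conj_gainKernel_le (u : FluidState) (s : ℝ) (x y : Vel) :
    2 * (maxwellian u x ^ (-s) * gainKernel u x y * maxwellian u y ^ s) ≤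
      4 * amp u * (Real.pi / rate u) *
        (‖x - y‖⁻¹ * Real.exp (-(rate u * (s * (1 - s))) * ‖x - y‖ ^ 2)) := by
  have h1 := amp_pos u
  have h2 := rate_pos u
  have h3 := Real.pi_pos
  rw [mul_right_comm (maxwellian u x ^ (-s)), maxwellian_rpow_mul, gainKernel, norm_sub_rev x y]
  set r := ‖y - x‖ with hr
  set t := r⁻¹ * inner ℝ (y - x) (x - u.v) with ht
  have key : Real.exp (rate u * s * (‖x - u.v‖ ^ 2 - ‖y - u.v‖ ^ 2)) * (r⁻¹ *
      Real.exp (-rate u * t ^ 2)) ≤ r⁻¹ * Real.exp (-(rate u * (s * (1 - s))) * r ^ 2) := by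
    rw [mul_left_comm, ← Real.exp_add]
    -- On the diagonal both sides vanish, as `0⁻¹ = 0`.
    rcases eq_or_ne r 0 with h0 | h0
    · simp [h0]
    have hrt : inner ℝ (y - x) (x - u.v) = r * t := by rw [ht, mul_inv_cancel_left₀ h0]
    have hy : ‖y - u.v‖ ^ 2 = r ^ 2 + 2 * (r * t) + ‖x - u.v‖ ^ 2 := by
      rw [← hrt, hr, ← norm_add_sq_real]
      congr 2
      abel
    refine mul_le_mul_of_nonneg_left (Real.exp_le_exp.2 ?_) (by positivity)
    rw [hy]
    have := mul_nonneg h2.le (sq_nonneg (t + s * r))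
    linarith
  calc _ = 4 * amp u * (Real.pi / rate u) *
      (Real.exp (rate u * s * (‖x - u.v‖ ^ 2 - ‖y - u.v‖ ^ 2)) * (r⁻¹ *
      Real.exp (-rate u * t ^ 2))) := by ring
    _ ≤ _ := mul_le_mul_of_nonneg_left key (by positivity)

/-- With `X = x - v` and `Y = y - v`, the exponent divided by the rate is `-(1-s)|X|² - s|Y|² =
-s(1-s)|X-Y|² - |(1-s)X + sY|²`. -/
lemma conj_lossKernel_le (u : FluidState) (s : ℝ) (x y : Vel) :
    maxwellian u x ^ (-s) * (maxwellian u x * (crossSection * ‖x - y‖)) * maxwellian u y ^ s ≤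
      amp u * crossSection *
        (‖x - y‖ * Real.exp (-(rate u * (s * (1 - s))) * ‖x - y‖ ^ 2)) := by
  have h1 := amp_pos u
  have h2 := rate_pos u
  have h4 := crossSection_pos
  rw [mul_right_comm (maxwellian u x ^ (-s)), maxwellian_rpow_mul, maxwellian_eq u x]
  have key : Real.exp (rate u * s * (‖x - u.v‖ ^ 2 - ‖y - u.v‖ ^ 2)) *
      Real.exp (-rate u * ‖x - u.v‖ ^ 2) ≤ Real.exp (-(rate u * (s * (1 - s))) * ‖x - y‖ ^ 2) := by
    rw [← Real.exp_add, Real.exp_le_exp]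
    have e1 : ‖x - y‖ ^ 2 = ‖x - u.v‖ ^ 2 - 2 * inner ℝ (x - u.v) (y - u.v) + ‖y - u.v‖ ^ 2 := by
      rw [← norm_sub_sq_real, sub_sub_sub_cancel_right]
    have e2 : ‖(1 - s) • (x - u.v) + s • (y - u.v)‖ ^ 2 = (1 - s) ^ 2 * ‖x - u.v‖ ^ 2 +
        2 * ((1 - s) * s * inner ℝ (x - u.v) (y - u.v)) + s ^ 2 * ‖y - u.v‖ ^ 2 := by
      rw [norm_add_sq_real, norm_smul, norm_smul, real_inner_smul_left, real_inner_smul_right,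
        mul_pow, mul_pow, Real.norm_eq_abs, Real.norm_eq_abs, sq_abs, sq_abs]
      ring
    have := mul_nonneg h2.le (sq_nonneg ‖(1 - s) • (x - u.v) + s • (y - u.v)‖)
    rw [e2] at this
    rw [e1]
    linarith
  calc _ = amp u * crossSection * ‖x - y‖ *
      (Real.exp (rate u * s * (‖x - u.v‖ ^ 2 - ‖y - u.v‖ ^ 2)) *
      Real.exp (-rate u * ‖x - u.v‖ ^ 2)) := by ring
    _ ≤ _ := by
      rw [mul_assoc (amp u * crossSection)]
      gcongr

/-- Domination of the conjugated kernels by a convolution kernel. -/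
lemma conj_kernel_add_le (u : FluidState) (s : ℝ) (x y : Vel) :
    2 * (maxwellian u x ^ (-s) * gainKernel u x y * maxwellian u y ^ s) +
    maxwellian u x ^ (-s) * (maxwellian u x * (crossSection * ‖x - y‖)) * maxwellian u y ^ s ≤
      profileConst u * profile (rate u * (s * (1 - s))) (x - y) := by
  refine (add_le_add (conj_gainKernel_le u s x y) (conj_lossKernel_le u s x y)).trans ?_
  have h1 := amp_pos u
  have h2 := rate_pos u
  have h3 := Real.pi_pos
  have h4 := crossSection_pos
  unfold profileConst profile
  set E := Real.exp (-(rate u * (s * (1 - s))) * ‖x - y‖ ^ 2)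
  have : 0 ≤ 4 * amp u * (Real.pi / rate u) * (‖x - y‖ * E) + amp u * crossSection * (‖x - y‖⁻¹ * E) := by
    positivity
  linarith

lemma lintegral_mul_sq_le {X : Type*} [MeasurableSpace X] {μ : Measure X} {f g : X → ℝ≥0∞}
    (hf : AEMeasurable f μ) (hg : AEMeasurable g μ) :
    (∫⁻ x, f x * g x ∂μ) ^ 2 ≤ (∫⁻ x, f x ^ 2 ∂μ) * ∫⁻ x, g x ^ 2 ∂μ := by
  have h := ENNReal.lintegral_mul_le_Lp_mul_Lq μ Real.HolderConjugate.two_two hf hg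
  calc _ ≤ ((∫⁻ x, f x ^ (2 : ℝ) ∂μ) ^ (1 / 2 : ℝ) * (∫⁻ x, g x ^ (2 : ℝ) ∂μ) ^ (1 / 2 : ℝ)) ^ 2 := by
        gcongr
        exact h
    _ = _ := by
      rw [mul_pow, ← ENNReal.rpow_natCast, ← ENNReal.rpow_natCast, ← ENNReal.rpow_mul,
        ← ENNReal.rpow_mul]
      norm_num

/-- Young's inequality for the convolution of an integrable and a square integrable function. -/
lemma lintegral_conv_sq_le {J g : Vel → ℝ≥0∞} (hJ : Measurable J) (hg : AEMeasurable g) :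
    ∫⁻ x, (∫⁻ y, J (x - y) * g y) ^ 2 ≤ (∫⁻ z, J z) ^ 2 * ∫⁻ y, g y ^ 2 := by
  have h1 : ∀ x, (∫⁻ y, J (x - y) * g y) ^ 2 ≤ (∫⁻ z, J z) * ∫⁻ y, J (x - y) * g y ^ 2 := by
    intro x
    -- Cauchy-Schwarz for the measure `J(x - y) dy`, applied to the product of `1` and `g`.
    have h := lintegral_mul_sq_le (μ := (volume : Measure Vel).withDensity (fun y => J (x - y)))
      (f := fun _ => 1) (g := g) (by fun_prop)
      (hg.mono_ac (withDensity_absolutelyContinuous _ _))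
    have hJx : Measurable (fun y => J (x - y)) := by fun_prop
    rw [lintegral_withDensity_eq_lintegral_mul₀ hJx.aemeasurable (by fun_prop),
      lintegral_withDensity_eq_lintegral_mul₀ hJx.aemeasurable (by fun_prop),
      lintegral_withDensity_eq_lintegral_mul₀ hJx.aemeasurable (by fun_prop)] at h
    simpa [lintegral_sub_left_eq_self J x] using h
  have hm : AEMeasurable (fun p : Vel × Vel => J (p.1 - p.2) * g p.2 ^ 2)
      ((volume : Measure Vel).prod volume) :=
    AEMeasurable.mul (by fun_prop) (hg.comp_snd.pow_const 2)
  calc _ ≤ ∫⁻ x, (∫⁻ z, J z) * ∫⁻ y, J (x - y) * g y ^ 2 := lintegral_mono h1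
    _ = (∫⁻ z, J z) * ∫⁻ x, ∫⁻ y, J (x - y) * g y ^ 2 :=
        lintegral_const_mul'' _ hm.lintegral_prod_right'
    _ = (∫⁻ z, J z) * ∫⁻ y, ∫⁻ x, J (x - y) * g y ^ 2 := by
        rw [lintegral_lintegral_swap hm]
    _ = (∫⁻ z, J z) * ∫⁻ y, (∫⁻ z, J z) * g y ^ 2 := by
        congr 1
        refine lintegral_congr fun y => ?_
        rw [lintegral_mul_const _ (by fun_prop), lintegral_sub_right_eq_self J y]
    _ = _ := by
        rw [lintegral_const_mul'' _ (hg.pow_const 2)]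
        ring

/-- A square integrable kernel gives a bound uniform in `x`, which yields convergence at every point
and later a constant majorant for dominated convergence. -/
lemma conv_sq_le {J g : Vel → ℝ≥0∞} (hJ : Measurable J) (hg : AEMeasurable g) (x : Vel) :
    (∫⁻ y, J (x - y) * g y) ^ 2 ≤ (∫⁻ z, J z ^ 2) * ∫⁻ y, g y ^ 2 := by
  refine (lintegral_mul_sq_le (by fun_prop) hg).trans_eq ?_
  rw [lintegral_sub_left_eq_self (fun z => J z ^ 2) x]

end HardSphere

end

/-! ### Weighted spaces and boundedness of the nonlocal part -/

noncomputable section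
namespace HardSphere
open MeasureTheory Set
open scoped ENNReal

lemma eLpNorm_two_sq {X E : Type*} [MeasurableSpace X] [NormedAddCommGroup E] (f : X → E)
    (μ : Measure X) : eLpNorm f 2 μ ^ 2 = ∫⁻ x, ‖f x‖ₑ ^ 2 ∂μ := by
  have h := eLpNorm_nnreal_pow_eq_lintegral (f := f) (μ := μ) (p := 2) two_ne_zero
  rw [show ((2 : NNReal) : ℝ) = ((2 : ℕ) : ℝ) by norm_num] at h
  simpa only [ENNReal.rpow_natCast, ENNReal.coe_ofNat] using h

lemma ennreal_le_of_sq_le {a b : ℝ≥0∞} (h : a ^ 2 ≤ b ^ 2) : a ≤ b :=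
  (ENNReal.pow_le_pow_left_iff two_ne_zero).1 h

/-- The weight `⟨ξ⟩^a M^{-s}`. -/
def wt (u : FluidState) (s a : ℝ) (ξ : Vel) : ℝ := bracket ξ ^ a * maxwellian u ξ ^ (-s)

lemma wt_pos (u : FluidState) (s a : ℝ) (ξ : Vel) : 0 < wt u s a ξ :=
  mul_pos (Real.rpow_pos_of_pos (bracket_pos ξ) _) (Real.rpow_pos_of_pos (maxwellian_pos u ξ) _)

lemma continuous_wt (u : FluidState) (s a : ℝ) : Continuous (wt u s a) :=
  (continuous_bracket.rpow_const fun ξ => Or.inl (bracket_pos ξ).ne').mul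
    ((continuous_maxwellian u).rpow_const fun ξ => Or.inl (maxwellian_pos u ξ).ne')

lemma wt_sq (u : FluidState) (s a : ℝ) (ξ : Vel) :
    wt u s a ξ ^ 2 = bracket ξ ^ (2 * a) * maxwellian u ξ ^ (-2 * s) := by
  rw [wt, mul_pow, ← Real.rpow_natCast, ← Real.rpow_natCast, ← Real.rpow_mul (bracket_pos ξ).le,
    ← Real.rpow_mul (maxwellian_pos u ξ).le]
  push_cast
  ring_nf

lemma one_le_bracket (ξ : Vel) : 1 ≤ bracket ξ := by
  unfold bracket
  rw [Real.one_le_sqrt]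
  nlinarith [sq_nonneg ‖ξ‖]

lemma wt_mono (u : FluidState) (s : ℝ) {a b : ℝ} (h : a ≤ b) (ξ : Vel) : wt u s a ξ ≤ wt u s b ξ :=
  mul_le_mul_of_nonneg_right (Real.rpow_le_rpow_of_exponent_le (one_le_bracket ξ) h)
    (Real.rpow_pos_of_pos (maxwellian_pos u ξ) _).le

lemma wt_zero (u : FluidState) (s : ℝ) (ξ : Vel) : wt u s 0 ξ = maxwellian u ξ ^ (-s) := by
  rw [wt, Real.rpow_zero, one_mul]

lemma wt_add (u : FluidState) (s a b : ℝ) (ξ : Vel) :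
    wt u s (a + b) ξ = bracket ξ ^ a * wt u s b ξ := by
  rw [wt, wt, Real.rpow_add (bracket_pos ξ), mul_assoc]

lemma weightedMeasure_ac (u : FluidState) (s a : ℝ) : weightedMeasure u s a ≪ volume :=
  withDensity_absolutelyContinuous _ _

lemma aestronglyMeasurable_weighted_iff (u : FluidState) (s a : ℝ) (f : Vel → ℂ) :
    AEStronglyMeasurable f (weightedMeasure u s a) ↔ AEStronglyMeasurable f volume :=
  ⟨fun h => h.mono_ac (volume_ac_weightedMeasure u s a), fun h => h.mono_ac (weightedMeasure_ac u s a)⟩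

lemma MemH.aesm {u : FluidState} {s a : ℝ} {f : Vel → ℂ} (h : MemH u s a f) :
    AEStronglyMeasurable f volume :=
  (aestronglyMeasurable_weighted_iff u s a f).1 h.1

lemma eLpNorm_weighted (u : FluidState) (s a : ℝ) (f : Vel → ℂ) :
    eLpNorm f 2 (weightedMeasure u s a) = eLpNorm (fun ξ => wt u s a ξ • f ξ) 2 volume := by
  have : eLpNorm f 2 (weightedMeasure u s a) ^ 2 =
      eLpNorm (fun ξ => wt u s a ξ • f ξ) 2 volume ^ 2 := by
    rw [eLpNorm_two_sq, eLpNorm_two_sq, weightedMeasure,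
      lintegral_withDensity_eq_lintegral_mul_non_measurable _
        (continuous_weight u s a).measurable.ennreal_ofReal (.of_forall fun _ => ENNReal.ofReal_lt_top)]
    refine lintegral_congr fun ξ => ?_
    rw [Pi.mul_apply, enorm_smul, mul_pow, ← wt_sq, Real.enorm_of_nonneg (wt_pos u s a ξ).le,
      ENNReal.ofReal_pow (wt_pos u s a ξ).le]
  exact le_antisymm (ennreal_le_of_sq_le this.le) (ennreal_le_of_sq_le this.ge)

lemma memH_iff (u : FluidState) (s a : ℝ) (f : Vel → ℂ) :
    MemH u s a f ↔ MemLp (fun ξ => wt u s a ξ • f ξ) 2 volume := by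
  constructor
  · intro h
    refine ⟨(continuous_wt u s a).aestronglyMeasurable.smul h.aesm, ?_⟩
    rw [← eLpNorm_weighted]
    exact h.2
  · intro h
    refine ⟨(aestronglyMeasurable_weighted_iff u s a f).2 ?_, ?_⟩
    · have := ((continuous_wt u s a).inv₀ fun ξ => (wt_pos u s a ξ).ne').aestronglyMeasurable
        (μ := (volume : Measure Vel)) |>.smul h.1
      refine this.congr (.of_forall fun ξ => ?_)
      simp [(wt_pos u s a ξ).ne']
    · rw [eLpNorm_weighted]
      exact h.2

/-- Comparison of weighted norms under a pointwise bound. -/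
lemma eLpNorm_weighted_le {u : FluidState} {s a t b C : ℝ} {f g : Vel → ℂ}
    (h : ∀ᵐ ξ, wt u s a ξ * ‖f ξ‖ ≤ C * (wt u t b ξ * ‖g ξ‖)) :
    eLpNorm f 2 (weightedMeasure u s a) ≤ ENNReal.ofReal C * eLpNorm g 2 (weightedMeasure u t b) := by
  rw [eLpNorm_weighted, eLpNorm_weighted]
  refine eLpNorm_le_mul_eLpNorm_of_ae_le_mul (c := C) ?_ 2
  filter_upwards [h] with ξ hξ
  rwa [norm_smul, norm_smul, Real.norm_of_nonneg (wt_pos _ _ _ _).le,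
    Real.norm_of_nonneg (wt_pos _ _ _ _).le]

lemma MemH.of_le {u : FluidState} {s a t b C : ℝ} {f g : Vel → ℂ} (hg : MemH u t b g)
    (hf : AEStronglyMeasurable f volume)
    (h : ∀ᵐ ξ, wt u s a ξ * ‖f ξ‖ ≤ C * (wt u t b ξ * ‖g ξ‖)) : MemH u s a f :=
  ⟨(aestronglyMeasurable_weighted_iff u s a f).2 hf, (eLpNorm_weighted_le h).trans_lt
    (ENNReal.mul_lt_top ENNReal.ofReal_lt_top hg.2)⟩

lemma MemH.mono {u : FluidState} {s a b : ℝ} {f : Vel → ℂ} (hf : MemH u s b f) (h : a ≤ b) :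
    MemH u s a f :=
  hf.of_le (C := 1) hf.aesm (.of_forall fun ξ => by
    rw [one_mul]
    exact mul_le_mul_of_nonneg_right (wt_mono u s h ξ) (norm_nonneg _))

lemma maxwellian_le_amp (u : FluidState) (ξ : Vel) : maxwellian u ξ ≤ amp u := by
  rw [maxwellian_eq]
  refine mul_le_of_le_one_right (amp_pos u).le (Real.exp_le_one_iff.2 ?_)
  have := rate_pos u
  nlinarith [sq_nonneg ‖ξ - u.v‖]

/-- The Maxwellian is bounded by `amp u`, so a smaller exponent costs only the constant `amp u ^ (s
- t)`. -/
lemma wt_le_of_exponent_le (u : FluidState) {s t : ℝ} (h : t ≤ s) (a : ℝ) (ξ : Vel) :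
    wt u t a ξ ≤ amp u ^ (s - t) * wt u s a ξ := by
  have h1 : maxwellian u ξ ^ (-t) = maxwellian u ξ ^ (s - t) * maxwellian u ξ ^ (-s) := by
    rw [← Real.rpow_add (maxwellian_pos u ξ)]; ring_nf
  have h2 : maxwellian u ξ ^ (s - t) ≤ amp u ^ (s - t) :=
    Real.rpow_le_rpow (maxwellian_pos u ξ).le (maxwellian_le_amp u ξ) (by linarith)
  have h3 := Real.rpow_pos_of_pos (bracket_pos ξ) a
  have h4 := Real.rpow_pos_of_pos (maxwellian_pos u ξ) (-s)
  rw [wt, wt, h1]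
  calc _ ≤ bracket ξ ^ a * (amp u ^ (s - t) * maxwellian u ξ ^ (-s)) := by gcongr
    _ = _ := by ring

lemma MemH.of_exponent_le {u : FluidState} {s t a : ℝ} {f : Vel → ℂ} (hf : MemH u s a f)
    (h : t ≤ s) : MemH u t a f :=
  hf.of_le (C := amp u ^ (s - t)) hf.aesm (.of_forall fun ξ => by
    rw [← mul_assoc]
    exact mul_le_mul_of_nonneg_right (wt_le_of_exponent_le u h a ξ) (norm_nonneg _))

/-- The `L²` norm over the dominating kernel. -/
def profileL2 (u : FluidState) (s : ℝ) : ℝ :=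
  profileConst u * √(∫ z, profile (rate u * (s * (1 - s))) z ^ 2)

/-- The `L¹` norm over the dominating kernel. -/
def profileL1 (u : FluidState) (s : ℝ) : ℝ :=
  profileConst u * ∫ z, profile (rate u * (s * (1 - s))) z

lemma profileL1_nonneg (u : FluidState) (s : ℝ) : 0 ≤ profileL1 u s :=
  mul_nonneg (profileConst_pos u).le (integral_nonneg fun _ => profile_nonneg _ _)

/-- The convolution of the dominating kernel with `M^{-s} |f|`. -/
def dominating (u : FluidState) (s : ℝ) (f : Vel → ℂ) (x : Vel) : ℝ≥0∞ :=
  ∫⁻ y, ENNReal.ofReal (profileConst u * profile (rate u * (s * (1 - s))) (x - y)) *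
    ‖wt u s 0 y • f y‖ₑ

lemma beta_pos (u : FluidState) {s : ℝ} (hs0 : 0 < s) (hs1 : s < 1) :
    0 < rate u * (s * (1 - s)) :=
  mul_pos (rate_pos u) (mul_pos hs0 (by linarith))

/-- The `L²` norm of the profile controls the convolution pointwise; its `L¹` norm controls it in
mean square in the next lemma. Both are needed for the compactness of the nonlocal part. -/
lemma dominating_le (u : FluidState) {s : ℝ} (hs0 : 0 < s) (hs1 : s < 1) {f : Vel → ℂ}
    (hf : MemH u s 0 f) (x : Vel) :
    dominating u s f x ≤ ENNReal.ofReal (profileL2 u s) * eLpNorm f 2 (weightedMeasure u s 0) := by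
  have hb := beta_pos u hs0 hs1
  have hc := profileConst_pos u
  have hm := measurable_profile (rate u * (s * (1 - s)))
  refine ennreal_le_of_sq_le ((conv_sq_le (g := fun y => ‖wt u s 0 y • f y‖ₑ)
    (J := fun z => ENNReal.ofReal (profileConst u * profile (rate u * (s * (1 - s))) z))
    (by fun_prop) ((memH_iff u s 0 f).1 hf).1.enorm x).trans_eq ?_)
  rw [mul_pow, eLpNorm_weighted, eLpNorm_two_sq]
  congr 1
  rw [profileL2, ← ENNReal.ofReal_pow (by positivity), mul_pow, Real.sq_sqrt
    (integral_nonneg fun _ => sq_nonneg _), ← integral_const_mul,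
    ofReal_integral_eq_lintegral_ofReal ((integrable_profile_sq hb).const_mul _)
    (.of_forall fun z => by positivity)]
  refine lintegral_congr fun z => ?_
  rw [← ENNReal.ofReal_pow (mul_nonneg hc.le (profile_nonneg _ _)), mul_pow]

lemma lintegral_dominating_sq_le (u : FluidState) {s : ℝ} (hs0 : 0 < s) (hs1 : s < 1) {f : Vel → ℂ}
    (hf : MemH u s 0 f) :
    ∫⁻ x, dominating u s f x ^ 2 ≤
      (ENNReal.ofReal (profileL1 u s) * eLpNorm f 2 (weightedMeasure u s 0)) ^ 2 := by
  have hb := beta_pos u hs0 hs1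
  have hc := profileConst_pos u
  have hm := measurable_profile (rate u * (s * (1 - s)))
  refine (lintegral_conv_sq_le (g := fun y => ‖wt u s 0 y • f y‖ₑ)
    (J := fun z => ENNReal.ofReal (profileConst u * profile (rate u * (s * (1 - s))) z))
    (by fun_prop) ((memH_iff u s 0 f).1 hf).1.enorm).trans_eq ?_
  rw [mul_pow, eLpNorm_weighted, eLpNorm_two_sq]
  congr 2
  rw [profileL1, ← integral_const_mul,
    ofReal_integral_eq_lintegral_ofReal ((integrable_profile hb).const_mul _)
    (.of_forall fun z => mul_nonneg hc.le (profile_nonneg _ _))]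

/-- The hypothesis is phrased for an arbitrary number `k` so that the gain kernel, the loss kernel
and their difference are all covered. -/
lemma wt_mul_abs_kernel_le (u : FluidState) (s : ℝ) (x y : Vel) {k : ℝ}
    (hk : |k| ≤ 2 * gainKernel u x y + maxwellian u x * (crossSection * ‖x - y‖)) :
    wt u s 0 x * |k| ≤ profileConst u * profile (rate u * (s * (1 - s))) (x - y) * wt u s 0 y := by
  have h := conj_kernel_add_le u s x y
  have hy := Real.rpow_pos_of_pos (maxwellian_pos u y) s
  have hx := Real.rpow_pos_of_pos (maxwellian_pos u x) (-s)
  rw [wt_zero, wt_zero, Real.rpow_neg (maxwellian_pos u y).le, ← div_eq_mul_inv, le_div_iff₀ hy]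
  refine le_trans ?_ h
  calc _ ≤ maxwellian u x ^ (-s) * (2 * gainKernel u x y +
      maxwellian u x * (crossSection * ‖x - y‖)) * maxwellian u y ^ s := by gcongr
    _ = _ := by ring

lemma lintegral_kernel_le_dominating (u : FluidState) (s : ℝ) (f : Vel → ℂ) (x : Vel) {k : Vel → ℝ}
    (hk : ∀ y, |k y| ≤ 2 * gainKernel u x y + maxwellian u x * (crossSection * ‖x - y‖)) :
    ENNReal.ofReal (wt u s 0 x) * ∫⁻ y, ‖k y • f y‖ₑ ≤ dominating u s f x := by
  rw [← lintegral_const_mul' _ _ ENNReal.ofReal_ne_top]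
  refine lintegral_mono fun y => ?_
  have h := wt_mul_abs_kernel_le u s x y (hk y)
  have hc := profileConst_pos u
  rw [enorm_smul, enorm_smul, ← mul_assoc, ← mul_assoc]
  gcongr ?_ * _
  rw [Real.enorm_of_nonneg (wt_pos u s 0 y).le, Real.enorm_eq_ofReal_abs,
    ← ENNReal.ofReal_mul (wt_pos u s 0 x).le, ← ENNReal.ofReal_mul
    (mul_nonneg hc.le (profile_nonneg _ _))]
  exact ENNReal.ofReal_le_ofReal h

/-- The dominating convolution is finite at every point and the weight at `x` is a positive constant
in `y`; hence convergence holds everywhere, not only almost everywhere. -/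
lemma integrable_kernel_smul (u : FluidState) {s : ℝ} (hs0 : 0 < s) (hs1 : s < 1) {f : Vel → ℂ}
    (hf : MemH u s 0 f) (x : Vel) {k : Vel → ℝ} (hkm : Measurable k)
    (hk : ∀ y, |k y| ≤ 2 * gainKernel u x y + maxwellian u x * (crossSection * ‖x - y‖)) :
    Integrable (fun y => k y • f y) := by
  refine ⟨hkm.aestronglyMeasurable.smul hf.aesm, ?_⟩
  have h := (lintegral_kernel_le_dominating u s f x hk).trans (dominating_le u hs0 hs1 hf x)
  have hfin : ENNReal.ofReal (profileL2 u s) * eLpNorm f 2 (weightedMeasure u s 0) < ⊤ :=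
    ENNReal.mul_lt_top ENNReal.ofReal_lt_top hf.2
  exact ENNReal.lt_top_of_mul_ne_top_right (h.trans_lt hfin).ne
    (ENNReal.ofReal_pos.2 (wt_pos u s 0 x)).ne'

lemma abs_nonlocalKernel_le (u : FluidState) (x y : Vel) : |nonlocalKernel u x y| ≤
    2 * gainKernel u x y + maxwellian u x * (crossSection * ‖x - y‖) := by
  have h1 := gainKernel_nonneg u x y
  have h2 := maxwellian_pos u x
  have h3 := crossSection_pos
  have h4 : 0 ≤ maxwellian u x * (crossSection * ‖x - y‖) := by positivity
  rw [nonlocalKernel, abs_le]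
  constructor <;> linarith

lemma measurable_nonlocalKernel (u : FluidState) :
    Measurable (fun p : Vel × Vel => nonlocalKernel u p.1 p.2) := by
  have h1 := measurable_gainKernel u
  have h2 := (continuous_maxwellian u).measurable
  unfold nonlocalKernel
  fun_prop

lemma measurable_nonlocalKernel_right (u : FluidState) (x : Vel) :
    Measurable (fun y => nonlocalKernel u x y) :=
  (measurable_nonlocalKernel u).comp (f := fun y => (x, y)) (by fun_prop)

lemma aestronglyMeasurable_nonlocal (u : FluidState) {f : Vel → ℂ}
    (hf : AEStronglyMeasurable f volume) : AEStronglyMeasurable (nonlocal u f) volume := by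
  have h : AEStronglyMeasurable (fun p : Vel × Vel => nonlocalKernel u p.1 p.2 • f p.2)
      ((volume : Measure Vel).prod volume) :=
    (measurable_nonlocalKernel u).aestronglyMeasurable.smul hf.comp_snd
  exact h.integral_prod_right'

lemma enorm_nonlocal_le (u : FluidState) (s : ℝ) (f : Vel → ℂ) (x : Vel) :
    ‖wt u s 0 x • nonlocal u f x‖ₑ ≤ dominating u s f x := by
  refine le_trans ?_ (lintegral_kernel_le_dominating u s f x (abs_nonlocalKernel_le u x))
  rw [enorm_smul, Real.enorm_of_nonneg (wt_pos u s 0 x).le]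
  gcongr
  exact enorm_integral_le_lintegral_enorm _

/-- The nonlocal part is bounded on `ℍ^s`. -/
lemma eLpNorm_nonlocal_le (u : FluidState) {s : ℝ} (hs0 : 0 < s) (hs1 : s < 1) {f : Vel → ℂ}
    (hf : MemH u s 0 f) : eLpNorm (nonlocal u f) 2 (weightedMeasure u s 0) ≤
      ENNReal.ofReal (profileL1 u s) * eLpNorm f 2 (weightedMeasure u s 0) := by
  refine ennreal_le_of_sq_le (le_trans ?_ (lintegral_dominating_sq_le u hs0 hs1 hf))
  rw [eLpNorm_weighted, eLpNorm_two_sq]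
  exact lintegral_mono fun x => pow_le_pow_left' (enorm_nonlocal_le u s f x) 2

lemma memH_nonlocal (u : FluidState) {s : ℝ} (hs0 : 0 < s) (hs1 : s < 1) {f : Vel → ℂ}
    (hf : MemH u s 0 f) : MemH u s 0 (nonlocal u f) :=
  ⟨(aestronglyMeasurable_weighted_iff u s 0 _).2 (aestronglyMeasurable_nonlocal u hf.aesm),
    (eLpNorm_nonlocal_le u hs0 hs1 hf).trans_lt (ENNReal.mul_lt_top ENNReal.ofReal_lt_top hf.2)⟩

end HardSphere

end

/-! ### Two-sided bounds on the collision frequency -/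

noncomputable section
namespace HardSphere
open MeasureTheory Set
open scoped ENNReal

lemma bracket_le (ξ : Vel) : bracket ξ ≤ 1 + ‖ξ‖ := by
  unfold bracket
  rw [Real.sqrt_le_left (by positivity)]
  nlinarith [norm_nonneg ξ]

lemma norm_le_bracket (ξ : Vel) : ‖ξ‖ ≤ bracket ξ := by
  unfold bracket
  exact Real.le_sqrt_of_sq_le (by linarith)

lemma integrable_maxwellian (u : FluidState) : Integrable (maxwellian u) := by
  simpa [invariant] using integrable_invariant_sq_mul u 0

lemma integrable_norm_mul_maxwellian (u : FluidState) :
    Integrable (fun y => ‖y‖ * maxwellian u y) := by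
  have h4 : Integrable (fun y => (‖y‖ ^ 2 / 2) ^ 2 * maxwellian u y) :=
    integrable_invariant_sq_mul u 4
  refine ((integrable_maxwellian u).add (h4.const_mul 4)).mono'
    (continuous_norm.mul (continuous_maxwellian u)).aestronglyMeasurable (.of_forall fun y => ?_)
  have hM := maxwellian_pos u y
  rw [Real.norm_of_nonneg (by positivity)]
  have : ‖y‖ ≤ 1 + 4 * (‖y‖ ^ 2 / 2) ^ 2 := by
    nlinarith [sq_nonneg (‖y‖ ^ 2 - 1), sq_nonneg (‖y‖ - 1), norm_nonneg y, sq_nonneg (‖y‖ ^ 2)]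
  calc _ ≤ (1 + 4 * (‖y‖ ^ 2 / 2) ^ 2) * maxwellian u y := by gcongr
    _ = _ := by simp only [Pi.add_apply]; ring

lemma integrable_norm_sub_mul_maxwellian (u : FluidState) (ξ : Vel) :
    Integrable (fun y => ‖ξ - y‖ * maxwellian u y) := by
  refine (((integrable_maxwellian u).const_mul ‖ξ‖).add (integrable_norm_mul_maxwellian u)).mono'
    (Continuous.mul (by fun_prop) (continuous_maxwellian u)).aestronglyMeasurable
    (.of_forall fun y => ?_)
  have hM := maxwellian_pos u y
  rw [Real.norm_of_nonneg (by positivity)]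
  calc _ ≤ (‖ξ‖ + ‖y‖) * maxwellian u y := by gcongr; exact norm_sub_le _ _
    _ = _ := by simp only [Pi.add_apply]; ring

lemma integrable_freq (u : FluidState) (ξ : Vel) :
    Integrable (fun y => (crossSection * ‖ξ - y‖) * maxwellian u y) := by
  simpa only [mul_assoc] using (integrable_norm_sub_mul_maxwellian u ξ).const_mul crossSection

lemma freq_eq (u : FluidState) (ξ : Vel) :
    freq u ξ = crossSection * ∫ y, ‖ξ - y‖ * maxwellian u y := by
  rw [freq, ← integral_const_mul]
  simp only [mul_assoc]

lemma freq_nonneg (u : FluidState) (ξ : Vel) : 0 ≤ freq u ξ :=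
  integral_nonneg fun y => mul_nonneg (mul_nonneg crossSection_pos.le (norm_nonneg _))
    (maxwellian_pos u y).le

lemma measurable_freq (u : FluidState) : Measurable (freq u) := by
  have h : StronglyMeasurable (fun p : Vel × Vel => (crossSection * ‖p.1 - p.2‖) * maxwellian u p.2) :=
    (Continuous.mul (by fun_prop) ((continuous_maxwellian u).comp continuous_snd)).stronglyMeasurable
  exact h.integral_prod_right'.measurable

lemma exists_freq_le (u : FluidState) : ∃ C, 0 < C ∧ ∀ ξ, freq u ξ ≤ C * bracket ξ := by
  have hc := crossSection_pos
  have h0 : 0 < ∫ y, maxwellian u y :=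
    integral_pos_of_integrable_nonneg_nonzero (x := 0) (continuous_maxwellian u)
      (integrable_maxwellian u) (fun y => (maxwellian_pos u y).le) (maxwellian_pos u _).ne'
  have h1 : 0 ≤ ∫ y, ‖y‖ * maxwellian u y :=
    integral_nonneg fun y => mul_nonneg (norm_nonneg _) (maxwellian_pos u y).le
  refine ⟨crossSection * ((∫ y, maxwellian u y) + ∫ y, ‖y‖ * maxwellian u y), by positivity,
    fun ξ => ?_⟩
  rw [freq_eq, mul_assoc]
  refine mul_le_mul_of_nonneg_left ?_ hc.le
  have h2 : ∫ y, ‖ξ - y‖ * maxwellian u y ≤ ∫ y, (‖ξ‖ * maxwellian u y + ‖y‖ * maxwellian u y) := by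
    refine integral_mono (integrable_norm_sub_mul_maxwellian u ξ)
      (((integrable_maxwellian u).const_mul ‖ξ‖).add (integrable_norm_mul_maxwellian u)) fun y => ?_
    have hM := maxwellian_pos u y
    calc ‖ξ - y‖ * maxwellian u y ≤ (‖ξ‖ + ‖y‖) * maxwellian u y := by
          gcongr; exact norm_sub_le _ _
      _ = _ := by ring
  rw [integral_add ((integrable_maxwellian u).const_mul ‖ξ‖) (integrable_norm_mul_maxwellian u),
    integral_const_mul] at h2
  have h3 := norm_le_bracket ξ
  have h4 := one_le_bracket ξ
  nlinarith

/-- The Maxwellian is symmetric about `v`, so `y` may be averaged with `2v - y`. The triangle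
inequality bounds `|ξ-y| + |ξ-(2v-y)|` below by both `2|ξ-v|` and `2|v-y|`, hence by their mean. The
first gives linear growth, the second positivity near `ξ = v`. -/
lemma exists_le_freq (u : FluidState) : ∃ c, 0 < c ∧ ∀ ξ, c * bracket ξ ≤ freq u ξ := by
  have hc := crossSection_pos
  have hi := integrable_maxwellian u
  have h0 : 0 < ∫ y, maxwellian u y :=
    integral_pos_of_integrable_nonneg_nonzero (x := 0) (continuous_maxwellian u) hi
      (fun y => (maxwellian_pos u y).le) (maxwellian_pos u _).ne'
  have hi1 := integrable_norm_sub_mul_maxwellian u u.v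
  have h1 : 0 < ∫ y, ‖u.v - y‖ * maxwellian u y := by
    refine integral_pos_of_integrable_nonneg_nonzero (x := u.v + EuclideanSpace.single 0 1)
      (Continuous.mul (by fun_prop) (continuous_maxwellian u)) hi1
      (fun y => mul_nonneg (norm_nonneg _) (maxwellian_pos u y).le) ?_
    have := (maxwellian_pos u (u.v + EuclideanSpace.single 0 1)).ne'
    simpa using this
  set m0 := ∫ y, maxwellian u y with hm0
  set m1 := ∫ y, ‖u.v - y‖ * maxwellian u y with hm1
  have hrefl : ∀ ξ, ∫ y, ‖ξ - y‖ * maxwellian u y =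
      ∫ y, ‖ξ - (u.v + u.v - y)‖ * maxwellian u y := by
    intro ξ
    rw [← integral_sub_left_eq_self (fun y => ‖ξ - y‖ * maxwellian u y) volume (u.v + u.v)]
    refine integral_congr_ae (.of_forall fun y => ?_)
    beta_reduce
    congr 1
    rw [maxwellian_eq, maxwellian_eq, ← norm_neg]
    congr 5
    abel
  have hirefl : ∀ ξ, Integrable (fun y => ‖ξ - (u.v + u.v - y)‖ * maxwellian u y) := by
    intro ξ
    refine ((integrable_norm_sub_mul_maxwellian u (u.v + u.v - ξ))).congr (.of_forall fun y => ?_)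
    beta_reduce
    congr 1
    rw [← norm_neg]
    congr 1
    abel
  have hlow : ∀ ξ, m0 * ‖ξ - u.v‖ + m1 ≤ 2 * ∫ y, ‖ξ - y‖ * maxwellian u y := by
    intro ξ
    rw [two_mul]
    nth_rewrite 2 [hrefl ξ]
    rw [← integral_add (integrable_norm_sub_mul_maxwellian u ξ) (hirefl ξ), hm0, hm1,
      mul_comm, ← integral_const_mul, ← integral_add (hi.const_mul _) hi1]
    refine integral_mono ((hi.const_mul _).add hi1)
      ((integrable_norm_sub_mul_maxwellian u ξ).add (hirefl ξ)) fun y => ?_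
    have hM := maxwellian_pos u y
    beta_reduce
    rw [← add_mul, ← add_mul]
    refine mul_le_mul_of_nonneg_right ?_ hM.le
    have e1 : 2 * ‖ξ - u.v‖ ≤ ‖ξ - y‖ + ‖ξ - (u.v + u.v - y)‖ := by
      refine le_trans (le_of_eq ?_) (norm_add_le _ _)
      rw [← abs_two, ← Real.norm_eq_abs, ← norm_smul]
      congr 1
      rw [two_smul]
      abel
    have e2 : 2 * ‖u.v - y‖ ≤ ‖ξ - y‖ + ‖ξ - (u.v + u.v - y)‖ := by
      refine le_trans (le_of_eq ?_) (norm_sub_le _ _)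
      rw [← abs_two, ← Real.norm_eq_abs, ← norm_smul]
      congr 1
      rw [two_smul]
      abel
    linarith
  -- Chosen so that `c⟨ξ⟩ ≤ c(1 + |v|) + c|ξ - v| ≤ m1 + m0 |ξ - v|`.
  set c := min m0 (m1 / (1 + ‖u.v‖)) with hcdef
  have hcpos : 0 < c := lt_min h0 (by positivity)
  refine ⟨crossSection * (c / 2), by positivity, fun ξ => ?_⟩
  rw [freq_eq, mul_assoc]
  refine mul_le_mul_of_nonneg_left ?_ hc.le
  have hb : bracket ξ ≤ (1 + ‖u.v‖) + ‖ξ - u.v‖ := by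
    have h2 : ‖ξ‖ ≤ ‖ξ - u.v‖ + ‖u.v‖ := by simpa using norm_add_le (ξ - u.v) u.v
    linarith [bracket_le ξ]
  have h2 : c * (1 + ‖u.v‖) ≤ m1 := by
    rw [← le_div_iff₀ (by positivity)]
    exact min_le_right _ _
  have h3 : c * ‖ξ - u.v‖ ≤ m0 * ‖ξ - u.v‖ :=
    mul_le_mul_of_nonneg_right (min_le_left _ _) (norm_nonneg _)
  have h4 := hlow ξ
  have h5 : c * bracket ξ ≤ c * ((1 + ‖u.v‖) + ‖ξ - u.v‖) := mul_le_mul_of_nonneg_left hb hcpos.le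
  linarith

/-! ### The linearized operator between weighted spaces -/

section Operator

variable {u : FluidState} {s : ℝ}

/-- Absolute convergence of the collision integrals and the splitting of the operator, on `ℍ^s`. -/
lemma linearized_split (hs0 : 0 < s) (hs1 : s < 1) {f : Vel → ℂ} (hf : MemH u s 0 f) (ξ : Vel) :
    Integrable (collisionIntegrand (maxwellianC u) f ξ) collisionMeasure ∧
    Integrable (collisionIntegrand f (maxwellianC u) ξ) collisionMeasure ∧
    linearized u f ξ = nonlocal u f ξ - freq u ξ * f ξ := by
  have hM := maxwellian_pos u ξ
  have hc := crossSection_pos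
  refine linearized_eq_nonlocal_sub u hf.aesm ξ ?_ ?_ (integrable_freq u ξ)
  · refine integrable_kernel_smul u hs0 hs1 hf ξ (measurable_gainKernel_right u ξ) fun y => ?_
    have h := gainKernel_nonneg u ξ y
    rw [abs_of_nonneg h]
    have : 0 ≤ maxwellian u ξ * (crossSection * ‖ξ - y‖) := by positivity
    linarith
  · have h := (integrable_kernel_smul u hs0 hs1 hf ξ
      (k := fun y => maxwellian u ξ * (crossSection * ‖ξ - y‖)) (by fun_prop) fun y => by
        have h := gainKernel_nonneg u ξ y
        rw [abs_of_nonneg (by positivity)]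
        linarith).smul (maxwellian u ξ)⁻¹
    refine h.congr (.of_forall fun y => ?_)
    simp only [Pi.smul_apply, smul_smul]
    rw [inv_mul_cancel_left₀ hM.ne']

lemma linearized_eq (hs0 : 0 < s) (hs1 : s < 1) {f : Vel → ℂ} (hf : MemH u s 0 f) :
    linearized u f = fun ξ => nonlocal u f ξ - freq u ξ * f ξ :=
  funext fun ξ => (linearized_split hs0 hs1 hf ξ).2.2

lemma nonlocal_congr {f g : Vel → ℂ} (h : f =ᵐ[volume] g) : nonlocal u f = nonlocal u g := by
  ext ξ
  refine integral_congr_ae ?_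
  filter_upwards [h] with y hy
  rw [hy]

lemma linearized_congr (hs0 : 0 < s) (hs1 : s < 1) {f g : Vel → ℂ} (hf : MemH u s 0 f)
    (h : f =ᵐ[volume] g) : linearized u f =ᵐ[volume] linearized u g := by
  have hg : MemH u s 0 g := hf.ae_eq ((weightedMeasure_ac u s 0).ae_le h)
  rw [linearized_eq hs0 hs1 hf, linearized_eq hs0 hs1 hg, nonlocal_congr h]
  filter_upwards [h] with ξ hξ
  rw [hξ]

lemma nonlocal_add (hs0 : 0 < s) (hs1 : s < 1) {f g : Vel → ℂ} (hf : MemH u s 0 f)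
    (hg : MemH u s 0 g) (ξ : Vel) : nonlocal u (f + g) ξ = nonlocal u f ξ + nonlocal u g ξ := by
  have hk := measurable_nonlocalKernel_right u ξ
  rw [nonlocal, nonlocal, nonlocal, ← integral_add
    (integrable_kernel_smul u hs0 hs1 hf ξ hk (abs_nonlocalKernel_le u ξ))
    (integrable_kernel_smul u hs0 hs1 hg ξ hk (abs_nonlocalKernel_le u ξ))]
  simp only [Pi.add_apply, smul_add]

lemma nonlocal_smul (c : ℂ) (f : Vel → ℂ) (ξ : Vel) :
    nonlocal u (c • f) ξ = c * nonlocal u f ξ := by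
  rw [nonlocal, nonlocal, ← integral_const_mul]
  refine integral_congr_ae (.of_forall fun y => ?_)
  simp only [Pi.smul_apply, smul_eq_mul, Complex.real_smul]
  ring

lemma linearized_add (hs0 : 0 < s) (hs1 : s < 1) {f g : Vel → ℂ} (hf : MemH u s 0 f)
    (hg : MemH u s 0 g) (ξ : Vel) :
    linearized u (f + g) ξ = linearized u f ξ + linearized u g ξ := by
  rw [linearized_eq hs0 hs1 hf, linearized_eq hs0 hs1 hg, linearized_eq hs0 hs1 (hf.add hg)]
  simp only [nonlocal_add hs0 hs1 hf hg, Pi.add_apply]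
  ring

lemma linearized_smul (hs0 : 0 < s) (hs1 : s < 1) {f : Vel → ℂ} (hf : MemH u s 0 f) (c : ℂ)
    (ξ : Vel) : linearized u (c • f) ξ = c * linearized u f ξ := by
  rw [linearized_eq hs0 hs1 hf, linearized_eq hs0 hs1 (hf.const_smul c)]
  simp only [nonlocal_smul, Pi.smul_apply, smul_eq_mul]
  ring

/-- Boundedness of the linearized operator between weighted spaces. -/
lemma exists_eLpNorm_linearized_le (u : FluidState) (hs0 : 0 < s) (hs1 : s < 1) {a b : ℝ}
    (ha : 0 ≤ a) (hb : b ≤ 0) (hab : b + 1 ≤ a) :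
    ∃ C, 0 ≤ C ∧ ∀ f, MemH u s a f → MemH u s b (linearized u f) ∧
      eLpNorm (linearized u f) 2 (weightedMeasure u s b) ≤
        ENNReal.ofReal C * eLpNorm f 2 (weightedMeasure u s a) := by
  obtain ⟨C, hC, hfreq⟩ := exists_freq_le u
  have hP := profileL1_nonneg u s
  -- The nonlocal part costs no power of `⟨ξ⟩`, which suffices as `b ≤ 0 ≤ a`; the frequency costs
  -- one power, which `b + 1 ≤ a` pays for.
  refine ⟨profileL1 u s + C, by positivity, fun f hf => ?_⟩
  have hf0 := hf.mono ha
  have h1 : ∀ᵐ ξ, wt u s b ξ * ‖nonlocal u f ξ‖ ≤ 1 * (wt u s 0 ξ * ‖nonlocal u f ξ‖) :=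
    .of_forall fun ξ => by
      rw [one_mul]
      exact mul_le_mul_of_nonneg_right (wt_mono u s hb ξ) (norm_nonneg _)
  have h2 : ∀ᵐ ξ, wt u s b ξ * ‖(freq u ξ : ℂ) * f ξ‖ ≤ C * (wt u s a ξ * ‖f ξ‖) :=
    .of_forall fun ξ => by
      have hw := wt_pos u s b ξ
      rw [norm_mul, Complex.norm_real, Real.norm_of_nonneg (freq_nonneg u ξ), ← mul_assoc,
        ← mul_assoc]
      refine mul_le_mul_of_nonneg_right ?_ (norm_nonneg _)
      calc wt u s b ξ * freq u ξ ≤ wt u s b ξ * (C * bracket ξ) := by gcongr; exact hfreq ξ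
        _ = C * wt u s (1 + b) ξ := by rw [wt_add, Real.rpow_one]; ring
        _ ≤ C * wt u s a ξ := by gcongr; exact wt_mono u s (by linarith) ξ
  have hn := memH_nonlocal u hs0 hs1 hf0
  have m1 : MemH u s b (nonlocal u f) := hn.of_le hn.aesm h1
  have hfm : AEStronglyMeasurable (fun ξ => (freq u ξ : ℂ) * f ξ) volume :=
    (Complex.measurable_ofReal.comp (measurable_freq u)).aestronglyMeasurable.mul hf.aesm
  have m2 : MemH u s b (fun ξ => (freq u ξ : ℂ) * f ξ) := hf.of_le hfm h2
  rw [linearized_eq hs0 hs1 hf0]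
  refine ⟨MemLp.sub m1 m2, ?_⟩
  refine (eLpNorm_sub_le m1.1 m2.1 (by norm_num)).trans ?_
  rw [ENNReal.ofReal_add hP hC.le, add_mul]
  refine add_le_add ?_ (eLpNorm_weighted_le h2)
  refine (eLpNorm_weighted_le h1).trans ?_
  rw [ENNReal.ofReal_one, one_mul]
  refine (eLpNorm_nonlocal_le u hs0 hs1 hf0).trans (mul_le_mul' le_rfl ?_)
  have h3 := eLpNorm_weighted_le (u := u) (s := s) (t := s) (a := 0) (b := a) (C := 1) (f := f)
    (g := f) (.of_forall fun ξ => ?_)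
  · simpa using h3
  rw [one_mul]
  exact mul_le_mul_of_nonneg_right (wt_mono u s ha ξ) (norm_nonneg _)

/-- The linearized operator as a continuous linear map between weighted spaces. -/
lemma exists_linearizedCLM (u : FluidState) (hs0 : 0 < s) (hs1 : s < 1) {a b : ℝ}
    (ha : 0 ≤ a) (hb : b ≤ 0) (hab : b + 1 ≤ a) :
    ∃ T : HSpace u s a →L[ℂ] HSpace u s b, ∀ (f : Vel → ℂ) (hf : MemH u s a f),
      T (MemLp.toLp f hf) =ᵐ[volume] linearized u f := by
  obtain ⟨C, hC, hL⟩ := exists_eLpNorm_linearized_le u hs0 hs1 ha hb hab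
  have hmem : ∀ f : HSpace u s a, MemH u s a f := fun f => Lp.memLp f
  have hae := fun (f : HSpace u s a) => (hmem f).mono ha
  have hmemL : ∀ f : HSpace u s a, MemLp (linearized u f) 2 (weightedMeasure u s b) :=
    fun f => (hL f (hmem f)).1
  let T : HSpace u s a →ₗ[ℂ] HSpace u s b :=
    { toFun := fun f => MemLp.toLp _ (hmemL f)
      map_add' := fun f g => by
        rw [← MemLp.toLp_add, MemLp.toLp_eq_toLp_iff]
        refine (weightedMeasure_ac u s b).ae_le ?_
        refine (linearized_congr hs0 hs1 (hae _)
          ((volume_ac_weightedMeasure u s a).ae_le (Lp.coeFn_add f g))).trans ?_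
        exact .of_forall fun ξ => linearized_add hs0 hs1 (hae f) (hae g) ξ
      map_smul' := fun c f => by
        rw [RingHom.id_apply, ← MemLp.toLp_const_smul, MemLp.toLp_eq_toLp_iff]
        refine (weightedMeasure_ac u s b).ae_le ?_
        refine (linearized_congr hs0 hs1 (hae _)
          ((volume_ac_weightedMeasure u s a).ae_le (Lp.coeFn_smul c f))).trans ?_
        exact .of_forall fun ξ => linearized_smul hs0 hs1 (hae f) c ξ }
  refine ⟨T.mkContinuous C fun f => ?_, fun f hf => ?_⟩
  · change ‖MemLp.toLp _ (hmemL f)‖ ≤ C * ‖f‖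
    rw [Lp.norm_toLp, Lp.norm_def, ← ENNReal.toReal_ofReal hC, ← ENNReal.toReal_mul]
    exact ENNReal.toReal_mono (ENNReal.mul_lt_top ENNReal.ofReal_lt_top (hmem f).2).ne
      (hL f (hmem f)).2
  · have h1 : T (MemLp.toLp f hf) =ᵐ[volume] linearized u (MemLp.toLp f hf) :=
      (volume_ac_weightedMeasure u s b).ae_le (hmemL (MemLp.toLp f hf)).coeFn_toLp
    refine h1.trans ?_
    exact linearized_congr hs0 hs1 (hae _)
      ((volume_ac_weightedMeasure u s a).ae_le (MemLp.coeFn_toLp hf))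

end Operator

end HardSphere

end

/-! ### Symmetries of the equilibrium collision measure -/

noncomputable section
namespace HardSphere
open MeasureTheory Set
open scoped ENNReal

lemma MeasurePreserving.withDensity_invariant {X : Type*} [MeasurableSpace X] {μ : Measure X}
    {T : X → X} (hT : MeasurePreserving T μ μ) {d : X → ℝ≥0∞} (hd : Measurable d)
    (h : ∀ x, d (T x) = d x) : MeasurePreserving T (μ.withDensity d) (μ.withDensity d) := by
  refine ⟨hT.measurable, ?_⟩
  ext s hs
  rw [Measure.map_apply hT.measurable hs, withDensity_apply _ (hT.measurable hs),
    withDensity_apply _ hs, ← hT.setLIntegral_comp_preimage hs hd]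
  simp only [h]

instance : SFinite collisionMeasure := by
  have : SFinite surf := inferInstance
  exact Measure.prod.instSFinite

lemma enorm_complex_ofReal (r : ℝ) : ‖(r : ℂ)‖ₑ = ‖r‖ₑ := by
  rw [← ofReal_norm, ← ofReal_norm, Complex.norm_real]

/-- The space of pairs of velocities and collision directions. -/
abbrev Coll : Type := Vel × Vel × S2

/-- Exchange of the two colliding particles. -/
def exchange (q : Coll) : Coll := (q.2.1, q.1, q.2.2)

/-- The collision transformation. -/
def collide (q : Coll) : Coll := (post q.1 q.2.1 q.2.2, postStar q.1 q.2.1 q.2.2, q.2.2)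

/-- Both symmetries leave `Ω` unchanged, so by the skew product it suffices that each slice
preserves Lebesgue measure on pairs of velocities. -/
lemma measurePreserving_of_skew {g : S2 → Vel × Vel → Vel × Vel}
    (hg : Measurable (Function.uncurry g))
    (h : ∀ Ω, (volume : Measure (Vel × Vel)).map (g Ω) = volume) :
    MeasurePreserving (fun q : Coll => ((g q.2.2 (q.1, q.2.1)).1, (g q.2.2 (q.1, q.2.1)).2, q.2.2))
      ((volume : Measure Vel).prod collisionMeasure) ((volume : Measure Vel).prod collisionMeasure) := by
  have e1 := measurePreserving_prodAssoc (volume : Measure Vel) (volume : Measure Vel) surf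
  have e2 := Measure.measurePreserving_swap (μ := (volume : Measure (Vel × Vel))) (ν := surf)
  have e3 := (MeasurePreserving.id surf).skew_product hg (.of_forall h)
  have e4 := Measure.measurePreserving_swap (μ := surf) (ν := (volume : Measure (Vel × Vel)))
  exact e1.comp (e4.comp (e3.comp (e2.comp e1.symm)))

lemma measurePreserving_exchange : MeasurePreserving exchange
    ((volume : Measure Vel).prod collisionMeasure) ((volume : Measure Vel).prod collisionMeasure) :=
  measurePreserving_of_skew (g := fun _ p => p.swap) (by fun_prop)
    fun _ => Measure.measurePreserving_swap.map_eq

lemma inner_self_S2 (Ω : S2) : inner ℝ (Ω : Vel) (Ω : Vel) = 1 := by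
  rw [real_inner_self_eq_norm_sq]
  simp

lemma post_collide (q : Coll) : post (collide q).1 (collide q).2.1 (collide q).2.2 = q.1 := by
  have h := inner_self_S2 q.2.2
  simp only [collide, post, postStar]
  have : inner ℝ (q.2.2 : Vel) (q.2.1 - (inner ℝ (q.2.2 : Vel) (q.2.1 - q.1)) • (q.2.2 : Vel) -
      (q.1 + (inner ℝ (q.2.2 : Vel) (q.2.1 - q.1)) • (q.2.2 : Vel))) =
      - inner ℝ (q.2.2 : Vel) (q.2.1 - q.1) := by
    simp only [inner_sub_right, inner_add_right, inner_smul_right, h]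
    ring
  rw [this]
  module

lemma postStar_collide (q : Coll) :
    postStar (collide q).1 (collide q).2.1 (collide q).2.2 = q.2.1 := by
  have h := inner_self_S2 q.2.2
  simp only [collide, post, postStar]
  have : inner ℝ (q.2.2 : Vel) (q.2.1 - (inner ℝ (q.2.2 : Vel) (q.2.1 - q.1)) • (q.2.2 : Vel) -
      (q.1 + (inner ℝ (q.2.2 : Vel) (q.2.1 - q.1)) • (q.2.2 : Vel))) =
      - inner ℝ (q.2.2 : Vel) (q.2.1 - q.1) := by
    simp only [inner_sub_right, inner_add_right, inner_smul_right, h]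
    ring
  rw [this]
  module

lemma post_exchange (q : Coll) : post (exchange q).1 (exchange q).2.1 (exchange q).2.2 =
    postStar q.1 q.2.1 q.2.2 := by
  simp only [exchange, post, postStar, inner_sub_right]
  module

lemma postStar_exchange (q : Coll) : postStar (exchange q).1 (exchange q).2.1 (exchange q).2.2 =
    post q.1 q.2.1 q.2.2 := by
  simp only [exchange, post, postStar, inner_sub_right]
  module

/-- The collision transformation in a fixed direction. -/
def collideLinear (Ω : S2) : (Vel × Vel) →ₗ[ℝ] (Vel × Vel) where
  toFun p := (post p.1 p.2 Ω, postStar p.1 p.2 Ω)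
  map_add' p p' := by
    simp only [post, postStar, Prod.fst_add, Prod.snd_add, inner_sub_right, inner_add_right,
      Prod.mk_add_mk]
    congr 1 <;> module
  map_smul' c p := by
    simp only [post, postStar, Prod.smul_fst, Prod.smul_snd, inner_sub_right, inner_smul_right,
      Prod.smul_mk, RingHom.id_apply]
    congr 1 <;> module

/-- For fixed `Ω` the collision is a linear involution, so its determinant is `±1`. -/
lemma map_collideLinear (Ω : S2) :
    (volume : Measure (Vel × Vel)).map (collideLinear Ω) = volume := by
  have hinv : collideLinear Ω ∘ₗ collideLinear Ω = LinearMap.id := by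
    refine LinearMap.ext fun p => ?_
    exact Prod.ext (post_collide (p.1, p.2, Ω)) (postStar_collide (p.1, p.2, Ω))
  have hdet : LinearMap.det (collideLinear Ω) * LinearMap.det (collideLinear Ω) = 1 := by
    rw [← LinearMap.det_comp, hinv, LinearMap.det_id]
  have hne : LinearMap.det (collideLinear Ω) ≠ 0 := by
    intro h
    simp [h] at hdet
  have habs : |(LinearMap.det (collideLinear Ω))⁻¹| = 1 := by
    rcases mul_self_eq_one_iff.1 hdet with h | h <;> simp [h]
  have : (volume : Measure (Vel × Vel)).IsAddHaarMeasure :=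
    inferInstanceAs ((volume : Measure Vel).prod (volume : Measure Vel)).IsAddHaarMeasure
  rw [Measure.map_linearMap_addHaar_eq_smul_addHaar _ hne, habs]
  simp

lemma measurePreserving_collide : MeasurePreserving collide
    ((volume : Measure Vel).prod collisionMeasure) ((volume : Measure Vel).prod collisionMeasure) :=
  measurePreserving_of_skew (g := fun Ω p => collideLinear Ω p)
    (by
      refine Measurable.prodMk ?_ ?_
      · exact (continuous_post.comp (f := fun q : S2 × (Vel × Vel) => (q.2.1, q.2.2, q.1))
          (by fun_prop)).measurable
      · exact (continuous_postStar.comp (f := fun q : S2 × (Vel × Vel) => (q.2.1, q.2.2, q.1))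
          (by fun_prop)).measurable)
    map_collideLinear

/-- The density `|Ω · (ξ - ξ_*)| M(ξ) M(ξ_*)`. -/
def collDensity (u : FluidState) (q : Coll) : ℝ :=
  hardSphereKernel q.2.2 (q.1 - q.2.1) * (maxwellian u q.1 * maxwellian u q.2.1)

/-- The equilibrium collision measure. -/
def equilibrium (u : FluidState) : Measure Coll :=
  ((volume : Measure Vel).prod collisionMeasure).withDensity
    (fun q => ENNReal.ofReal (collDensity u q))

lemma collDensity_nonneg (u : FluidState) (q : Coll) : 0 ≤ collDensity u q :=
  mul_nonneg (hardSphereKernel_nonneg _ _)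
    (mul_nonneg (maxwellian_pos u _).le (maxwellian_pos u _).le)

lemma continuous_collDensity (u : FluidState) : Continuous (collDensity u) := by
  have := continuous_maxwellian u
  exact continuous_kernel.mul (by fun_prop)

/-- Detailed balance: a collision conserves the kinetic energy relative to `v`, and the product of
Maxwellians depends only on that energy. -/
lemma maxwellian_post_mul (u : FluidState) (ξ ξs : Vel) (Ω : S2) :
    maxwellian u (post ξ ξs Ω) * maxwellian u (postStar ξ ξs Ω) =
      maxwellian u ξ * maxwellian u ξs := by
  have h := inner_self_S2 Ω
  have h1 : ‖post ξ ξs Ω - u.v‖ ^ 2 + ‖postStar ξ ξs Ω - u.v‖ ^ 2 =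
      ‖ξ - u.v‖ ^ 2 + ‖ξs - u.v‖ ^ 2 := by
    set t := inner ℝ (Ω : Vel) (ξs - ξ) with ht
    have e1 : post ξ ξs Ω - u.v = (ξ - u.v) + t • (Ω : Vel) := by rw [post]; abel
    have e2 : postStar ξ ξs Ω - u.v = (ξs - u.v) - t • (Ω : Vel) := by rw [postStar]; abel
    have e3 : t = inner ℝ (ξs - u.v) (Ω : Vel) - inner ℝ (ξ - u.v) (Ω : Vel) := by
      rw [ht, ← inner_sub_left, real_inner_comm]
      congr 1
      abel
    rw [e1, e2]
    generalize ξ - u.v = x at e3 ⊢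
    generalize ξs - u.v = y at e3 ⊢
    rw [norm_add_sq_real, norm_sub_sq_real, norm_smul, real_inner_smul_right,
      real_inner_smul_right]
    have hn : (‖t‖ * ‖(Ω : Vel)‖) ^ 2 = t ^ 2 := by simp
    rw [hn]
    linear_combination 2 * t * e3
  simp only [maxwellian_eq]
  rw [mul_mul_mul_comm, mul_mul_mul_comm (amp u) (Real.exp (-rate u * ‖ξ - u.v‖ ^ 2)),
    ← Real.exp_add, ← Real.exp_add, ← mul_add, ← mul_add, h1]

lemma collDensity_exchange (u : FluidState) (q : Coll) :
    collDensity u (exchange q) = collDensity u q := by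
  simp only [collDensity, exchange, hardSphereKernel]
  rw [← neg_sub, inner_neg_right, abs_neg, mul_comm (maxwellian u q.2.1)]

lemma collDensity_collide (u : FluidState) (q : Coll) :
    collDensity u (collide q) = collDensity u q := by
  simp only [collDensity, collide, maxwellian_post_mul]
  congr 1
  have h := inner_self_S2 q.2.2
  simp only [hardSphereKernel, post, postStar]
  rw [← abs_neg]
  congr 1
  simp only [inner_sub_right, inner_add_right, inner_smul_right, h]
  ring

lemma equilibrium_exchange (u : FluidState) :
    MeasurePreserving exchange (equilibrium u) (equilibrium u) :=
  MeasurePreserving.withDensity_invariant measurePreserving_exchange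
    (continuous_collDensity u).measurable.ennreal_ofReal fun q => by rw [collDensity_exchange]

lemma equilibrium_collide (u : FluidState) :
    MeasurePreserving collide (equilibrium u) (equilibrium u) :=
  MeasurePreserving.withDensity_invariant measurePreserving_collide
    (continuous_collDensity u).measurable.ennreal_ofReal fun q => by rw [collDensity_collide]

/-- The collisional increment `h' + h'_* - h - h_*`. -/
def increment (h : Vel → ℂ) (q : Coll) : ℂ :=
  h (collide q).1 + h (collide q).2.1 - h q.1 - h q.2.1

lemma increment_exchange (h : Vel → ℂ) (q : Coll) : increment h (exchange q) = increment h q := by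
  have e1 : (collide (exchange q)).1 = (collide q).2.1 := post_exchange q
  have e2 : (collide (exchange q)).2.1 = (collide q).1 := postStar_exchange q
  simp only [increment, e1, e2]
  simp only [exchange]
  ring

lemma increment_collide (h : Vel → ℂ) (q : Coll) : increment h (collide q) = -increment h q := by
  have e1 : (collide (collide q)).1 = q.1 := post_collide q
  have e2 : (collide (collide q)).2.1 = q.2.1 := postStar_collide q
  simp only [increment, e1, e2]
  ring

/-- The quotient `f / M`. -/
def ratio (u : FluidState) (f : Vel → ℂ) (ξ : Vel) : ℂ := (maxwellian u ξ : ℂ)⁻¹ * f ξ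

lemma maxwellian_mul_ratio (u : FluidState) (f : Vel → ℂ) (ξ : Vel) :
    (maxwellian u ξ : ℂ) * ratio u f ξ = f ξ := by
  rw [ratio, mul_inv_cancel_left₀ (Complex.ofReal_ne_zero.2 (maxwellian_pos u ξ).ne')]

lemma aestronglyMeasurable_ratio (u : FluidState) {f : Vel → ℂ}
    (hf : AEStronglyMeasurable f volume) : AEStronglyMeasurable (ratio u f) volume := by
  have : Measurable fun ξ => (maxwellian u ξ : ℂ)⁻¹ :=
    (Complex.measurable_ofReal.comp (continuous_maxwellian u).measurable).inv
  exact this.aestronglyMeasurable.mul hf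

/-- The first marginal of the equilibrium measure has density `M · freq`, and `freq` is at most a
multiple of `⟨ξ⟩`. This is why `f ∈ ⟨ξ⟩^{-1/2} ℍ^{1/2}` makes `f / M` square integrable over
collisions. -/
lemma lintegral_equilibrium_fst (u : FluidState) {g : Vel → ℝ≥0∞} (hg : AEMeasurable g) :
    ∫⁻ q, g q.1 ∂equilibrium u =
      ∫⁻ ξ, ENNReal.ofReal (maxwellian u ξ * freq u ξ) * g ξ := by
  have hd := (continuous_collDensity u).measurable.ennreal_ofReal
  have hg' : AEMeasurable (fun q : Coll => g q.1) ((volume : Measure Vel).prod collisionMeasure) :=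
    hg.comp_fst
  rw [equilibrium, lintegral_withDensity_eq_lintegral_mul₀ hd.aemeasurable hg',
    lintegral_prod _ (hd.aemeasurable.mul hg')]
  refine lintegral_congr fun ξ => ?_
  simp only [Pi.mul_apply]
  rw [lintegral_mul_const _ (f := fun p : Vel × S2 => ENNReal.ofReal (collDensity u (ξ, p)))
    (hd.comp measurable_prodMk_left)]
  congr 1
  have hM := (continuous_maxwellian u).measurable
  have hMξ := maxwellian_pos u ξ
  have h3 := measurable_kernel_right ξ
  have e : ∀ p : Vel × S2, ENNReal.ofReal (collDensity u (ξ, p)) =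
      ENNReal.ofReal (maxwellian u ξ) * (ENNReal.ofReal (hardSphereKernel p.2 (ξ - p.1)) *
        ENNReal.ofReal (maxwellian u p.1)) := by
    intro p
    rw [← ENNReal.ofReal_mul (hardSphereKernel_nonneg _ _), ← ENNReal.ofReal_mul hMξ.le, collDensity]
    congr 1
    ring
  rw [lintegral_congr e, lintegral_const_mul _ (by fun_prop),
    lintegral_loss ξ (Φ := fun y => ENNReal.ofReal (maxwellian u y)) (by fun_prop),
    ENNReal.ofReal_mul hMξ.le, freq,
    ofReal_integral_eq_lintegral_ofReal (integrable_freq u ξ) (.of_forall fun y =>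
      mul_nonneg (mul_nonneg crossSection_pos.le (norm_nonneg _)) (maxwellian_pos u y).le)]
  congr 1
  refine lintegral_congr fun y => ?_
  rw [← ENNReal.ofReal_mul (mul_nonneg crossSection_pos.le (norm_nonneg _))]

lemma memLp_ratio_fst (u : FluidState) {f : Vel → ℂ} (hf : MemH u (1 / 2) (1 / 2) f) :
    MemLp (fun q : Coll => ratio u f q.1) 2 (equilibrium u) := by
  obtain ⟨C, hC, hfreq⟩ := exists_freq_le u
  have hm : AEStronglyMeasurable (fun q : Coll => ratio u f q.1)
      ((volume : Measure Vel).prod collisionMeasure) :=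
    (aestronglyMeasurable_ratio u hf.aesm).comp_fst
  refine ⟨hm.mono_ac (withDensity_absolutelyContinuous _ _), ?_⟩
  have h2 : eLpNorm (fun q : Coll => ratio u f q.1) 2 (equilibrium u) ^ 2 ≤
      ENNReal.ofReal C * eLpNorm f 2 (weightedMeasure u (1 / 2) (1 / 2)) ^ 2 := by
    rw [eLpNorm_two_sq, lintegral_equilibrium_fst u (g := fun ξ => ‖ratio u f ξ‖ₑ ^ 2)
      ((aestronglyMeasurable_ratio u hf.aesm).enorm.pow_const 2), eLpNorm_weighted, eLpNorm_two_sq,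
      ← lintegral_const_mul' _ _ ENNReal.ofReal_ne_top]
    refine lintegral_mono fun ξ => ?_
    have hM := maxwellian_pos u ξ
    have hw : wt u (1 / 2) (1 / 2) ξ ^ 2 = bracket ξ * (maxwellian u ξ)⁻¹ := by
      rw [wt_sq]
      norm_num
      left
      exact Real.rpow_neg_one _
    have hn : ‖ratio u f ξ‖ₑ = ENNReal.ofReal (maxwellian u ξ)⁻¹ * ‖f ξ‖ₑ := by
      rw [ratio, enorm_mul, ← Complex.ofReal_inv, enorm_complex_ofReal,
        Real.enorm_of_nonneg (inv_pos.2 hM).le]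
    rw [hn, enorm_smul, Real.enorm_of_nonneg (wt_pos _ _ _ _).le, mul_pow, mul_pow, ← mul_assoc,
      ← mul_assoc]
    gcongr ?_ * _
    rw [← ENNReal.ofReal_pow (inv_pos.2 hM).le, ← ENNReal.ofReal_pow (wt_pos _ _ _ _).le, hw,
      ← ENNReal.ofReal_mul (mul_nonneg hM.le (freq_nonneg u ξ)), ← ENNReal.ofReal_mul hC.le]
    refine ENNReal.ofReal_le_ofReal ?_
    calc maxwellian u ξ * freq u ξ * (maxwellian u ξ)⁻¹ ^ 2 =
        freq u ξ * (maxwellian u ξ)⁻¹ := by field_simp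
      _ ≤ C * bracket ξ * (maxwellian u ξ)⁻¹ := by gcongr; exact hfreq ξ
      _ = _ := by ring
  have h3 : ENNReal.ofReal C * eLpNorm f 2 (weightedMeasure u (1 / 2) (1 / 2)) ^ 2 < ⊤ :=
    ENNReal.mul_lt_top ENNReal.ofReal_lt_top (ENNReal.pow_lt_top hf.2)
  have h4 := h2.trans_lt h3
  by_contra hcon
  rw [not_lt, top_le_iff] at hcon
  rw [hcon] at h4
  simp at h4

lemma memLp_ratio_snd (u : FluidState) {f : Vel → ℂ} (hf : MemH u (1 / 2) (1 / 2) f) :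
    MemLp (fun q : Coll => ratio u f q.2.1) 2 (equilibrium u) := by
  change MemLp ((fun q : Coll => ratio u f q.1) ∘ exchange) 2 (equilibrium u)
  exact (memLp_ratio_fst u hf).comp_measurePreserving (equilibrium_exchange u)

lemma memLp_increment (u : FluidState) {f : Vel → ℂ} (hf : MemH u (1 / 2) (1 / 2) f) :
    MemLp (increment (ratio u f)) 2 (equilibrium u) :=
  ((((memLp_ratio_fst u hf).comp_measurePreserving (equilibrium_collide u)).add
    ((memLp_ratio_snd u hf).comp_measurePreserving (equilibrium_collide u))).sub
    (memLp_ratio_fst u hf)).sub (memLp_ratio_snd u hf)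

lemma integrable_mul_conj {X : Type*} [MeasurableSpace X] {μ : Measure X} {f g : X → ℂ}
    (hf : MemLp f 2 μ) (hg : MemLp g 2 μ) :
    Integrable (fun x => f x * (starRingEnd ℂ) (g x)) μ :=
  hf.integrable_mul hg.star

/-- The symmetrized form of integrals against the collisional increment. -/
lemma integral_increment_mul (u : FluidState) {f g : Vel → ℂ} (hf : MemH u (1 / 2) (1 / 2) f)
    (hg : MemH u (1 / 2) (1 / 2) g) :
    ∫ q, increment (ratio u f) q * (starRingEnd ℂ) (ratio u g q.1) ∂equilibrium u =
      -(1 / 4) * ∫ q, increment (ratio u f) q * (starRingEnd ℂ) (increment (ratio u g) q)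
        ∂equilibrium u := by
  have hG := memLp_increment u hf
  set G := increment (ratio u f) with hGdef
  set k := ratio u g with hk
  have i1 := integrable_mul_conj hG (memLp_ratio_fst u hg)
  have i2 := integrable_mul_conj hG (memLp_ratio_snd u hg)
  have i3 := integrable_mul_conj hG ((memLp_ratio_fst u hg).comp_measurePreserving (equilibrium_collide u))
  have i4 := integrable_mul_conj hG ((memLp_ratio_snd u hg).comp_measurePreserving (equilibrium_collide u))
  simp only [← hk, Function.comp_def] at i1 i2 i3 i4
  have hcomp : ∀ {T : Coll → Coll} (_ : MeasurePreserving T (equilibrium u) (equilibrium u))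
      {F : Coll → ℂ}, Integrable F (equilibrium u) →
      ∫ q, F (T q) ∂equilibrium u = ∫ q, F q ∂equilibrium u := by
    intro T hT F hF
    have := integral_map (μ := equilibrium u) hT.aemeasurable (f := F)
      (by rw [hT.map_eq]; exact hF.1)
    rw [← this, hT.map_eq]
  -- The increment is invariant under exchange and odd under collision. Hence the four terms of the
  -- second increment contribute the same integral up to sign, which is the origin of `-1/4`.
  have e2 : ∫ q, G q * (starRingEnd ℂ) (k q.2.1) ∂equilibrium u =
      ∫ q, G q * (starRingEnd ℂ) (k q.1) ∂equilibrium u := by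
    rw [← hcomp (equilibrium_exchange u) i1]
    simp only [hGdef, increment_exchange]
    rfl
  have e3 : ∫ q, G q * (starRingEnd ℂ) (k (collide q).1) ∂equilibrium u =
      -∫ q, G q * (starRingEnd ℂ) (k q.1) ∂equilibrium u := by
    rw [← hcomp (equilibrium_collide u) i1, ← integral_neg]
    simp only [hGdef, increment_collide, neg_mul, neg_neg]
  have e4 : ∫ q, G q * (starRingEnd ℂ) (k (collide q).2.1) ∂equilibrium u =
      -∫ q, G q * (starRingEnd ℂ) (k q.1) ∂equilibrium u := by
    rw [← e2, ← hcomp (equilibrium_collide u) i2, ← integral_neg]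
    simp only [hGdef, increment_collide, neg_mul, neg_neg]
  have e5 : ∫ q, G q * (starRingEnd ℂ) (increment k q) ∂equilibrium u =
      ∫ q, G q * (starRingEnd ℂ) (k (collide q).1) ∂equilibrium u +
      ∫ q, G q * (starRingEnd ℂ) (k (collide q).2.1) ∂equilibrium u -
      ∫ q, G q * (starRingEnd ℂ) (k q.1) ∂equilibrium u -
      ∫ q, G q * (starRingEnd ℂ) (k q.2.1) ∂equilibrium u := by
    have i34 : Integrable (fun q => G q * (starRingEnd ℂ) (k (collide q).1) +
      G q * (starRingEnd ℂ) (k (collide q).2.1)) (equilibrium u) := i3.add i4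
    have i341 : Integrable (fun q => G q * (starRingEnd ℂ) (k (collide q).1) +
      G q * (starRingEnd ℂ) (k (collide q).2.1) - G q * (starRingEnd ℂ) (k q.1))
      (equilibrium u) := i34.sub i1
    rw [← integral_add i3 i4, ← integral_sub i34 i1, ← integral_sub i341 i2]
    refine integral_congr_ae (.of_forall fun q => ?_)
    simp only [increment, map_add, map_sub]
    ring
  rw [e5, e2, e3, e4]
  ring

end HardSphere

end

/-! ### Weak form and conservation laws -/

noncomputable section
namespace HardSphere
open MeasureTheory Set
open scoped ENNReal

/-- With `h = f / M`, detailed balance `M M_* = M' M'_*` turns `M M_* (h' + h'_* - h - h_*)` into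
`M'_* f' + M' f'_* - M_* f - M f_*`, the sum of the two bilinear integrands. -/
lemma collDensity_smul_increment (u : FluidState) (f : Vel → ℂ) (ξ : Vel) (p : Vel × S2) :
    (collDensity u (ξ, p) : ℂ) * increment (ratio u f) (ξ, p) =
      collisionIntegrand (maxwellianC u) f ξ p + collisionIntegrand f (maxwellianC u) ξ p := by
  have h := maxwellian_post_mul u ξ p.1 p.2
  have h' : (maxwellian u (post ξ p.1 p.2) : ℂ) * (maxwellian u (postStar ξ p.1 p.2) : ℂ) =
      (maxwellian u ξ : ℂ) * (maxwellian u p.1 : ℂ) := by exact_mod_cast h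
  have e1 := maxwellian_mul_ratio u f (post ξ p.1 p.2)
  have e2 := maxwellian_mul_ratio u f (postStar ξ p.1 p.2)
  have e3 := maxwellian_mul_ratio u f ξ
  have e4 := maxwellian_mul_ratio u f p.1
  simp only [collisionIntegrand, maxwellianC, collDensity, increment, collide]
  rw [← e1, ← e2, ← e3, ← e4]
  simp only [e1, e2, e3, e4]
  push_cast
  linear_combination (-(hardSphereKernel p.2 (ξ - p.1) : ℂ)) *
    (ratio u f (post ξ p.1 p.2) + ratio u f (postStar ξ p.1 p.2)) * h' +
    (hardSphereKernel p.2 (ξ - p.1) : ℂ) * (maxwellian u (postStar ξ p.1 p.2) : ℂ) * e1 +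
    (hardSphereKernel p.2 (ξ - p.1) : ℂ) * (maxwellian u (post ξ p.1 p.2) : ℂ) * e2 -
    (hardSphereKernel p.2 (ξ - p.1) : ℂ) * (maxwellian u p.1 : ℂ) * e3 -
    (hardSphereKernel p.2 (ξ - p.1) : ℂ) * (maxwellian u ξ : ℂ) * e4

/-- The weak form of the linearized operator. -/
lemma linearized_weak_form (u : FluidState) {f g : Vel → ℂ} (hf : MemH u (1 / 2) (1 / 2) f)
    (hg : MemH u (1 / 2) (1 / 2) g) :
    Integrable (fun ξ => linearized u f ξ * (starRingEnd ℂ) (ratio u g ξ)) ∧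
    ∫ ξ, linearized u f ξ * (starRingEnd ℂ) (ratio u g ξ) =
      -(1 / 4) * ∫ q, increment (ratio u f) q * (starRingEnd ℂ) (increment (ratio u g) q)
        ∂equilibrium u := by
  have hd := (continuous_collDensity u).measurable.ennreal_ofReal
  have hi := integrable_mul_conj (memLp_increment u hf) (memLp_ratio_fst u hg)
  have hi' : Integrable (fun q : Coll => collDensity u q • (increment (ratio u f) q *
      (starRingEnd ℂ) (ratio u g q.1))) ((volume : Measure Vel).prod collisionMeasure) := by
    rw [equilibrium, integrable_withDensity_iff_integrable_smul' hd
      (.of_forall fun _ => ENNReal.ofReal_lt_top)] at hi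
    simpa only [ENNReal.toReal_ofReal (collDensity_nonneg u _)] using hi
  have hinner : ∀ ξ, ∫ p, collDensity u (ξ, p) • (increment (ratio u f) (ξ, p) *
      (starRingEnd ℂ) (ratio u g ξ)) ∂collisionMeasure =
      linearized u f ξ * (starRingEnd ℂ) (ratio u g ξ) := by
    intro ξ
    obtain ⟨h1, h2, -⟩ := linearized_split (u := u) (s := 1 / 2) (by norm_num) (by norm_num)
      (hf.mono (by norm_num)) ξ
    have : ∀ p, collDensity u (ξ, p) • (increment (ratio u f) (ξ, p) *
        (starRingEnd ℂ) (ratio u g ξ)) = (collisionIntegrand (maxwellianC u) f ξ p +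
        collisionIntegrand f (maxwellianC u) ξ p) * (starRingEnd ℂ) (ratio u g ξ) := by
      intro p
      rw [← collDensity_smul_increment, Complex.real_smul, mul_assoc]
    simp_rw [this]
    rw [integral_mul_const, integral_add h1 h2]
    rfl
  refine ⟨?_, ?_⟩
  · have h := hi'.integral_prod_left
    simp only [hinner] at h
    exact h
  · rw [← integral_increment_mul u hf hg]
    have h1 := integral_withDensity_eq_integral_toReal_smul
      (μ := (volume : Measure Vel).prod collisionMeasure) hd
      (.of_forall fun _ => ENNReal.ofReal_lt_top)
      (fun q => increment (ratio u f) q * (starRingEnd ℂ) (ratio u g q.1))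
    simp only [ENNReal.toReal_ofReal (collDensity_nonneg u _)] at h1
    rw [equilibrium, h1, integral_prod _ hi']
    simp only [hinner]

/-- The integrands of the scalar product of `ℍ^{1/2}` in terms of quotients. -/
lemma hIntegrand_half (u : FluidState) (f g : Vel → ℂ) (ξ : Vel) :
    hIntegrand u (1 / 2) f g ξ = f ξ * (starRingEnd ℂ) (ratio u g ξ) := by
  rw [hIntegrand, ratio, show (-2 * (1 / 2 : ℝ)) = -1 by norm_num, Real.rpow_neg_one]
  simp only [map_mul, map_inv₀, Complex.conj_ofReal]
  push_cast
  ring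

lemma integrable_bracket_mul_maxwellian (u : FluidState) (n : ℕ) {t : ℝ} (ht : 0 < t) :
    Integrable (fun ξ => bracket ξ ^ n * maxwellian u ξ ^ t) := by
  have hb : 0 < rate u * t := mul_pos (rate_pos u) ht
  set B := 1 + ‖u.v‖ with hB
  have h0 : Integrable (fun x : Vel => (1 + ‖x‖ ^ n) * Real.exp (-(rate u * t) * ‖x‖ ^ 2)) := by
    refine (integrable_fun_norm_addHaar (volume : Measure Vel)
      (f := fun r : ℝ => (1 + r ^ n) * Real.exp (-(rate u * t) * r ^ 2))).2 ?_
    refine IntegrableOn.congr_fun ((integrableOn_pow_mul_gaussian hb 2).add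
      (integrableOn_pow_mul_gaussian hb (n + 2))) (fun y hy => ?_) measurableSet_Ioi
    simp only [Pi.add_apply, smul_eq_mul, finrank_euclideanSpace, Fintype.card_fin]
    ring
  have h1 := (h0.comp_sub_right u.v).const_mul (B ^ n * 2 ^ (n - 1) * amp u ^ t)
  refine h1.mono' ?_ (.of_forall fun ξ => ?_)
  · exact ((continuous_bracket.pow n).mul ((continuous_maxwellian u).rpow_const fun ξ =>
      Or.inl (maxwellian_pos u ξ).ne')).aestronglyMeasurable
  · have hbr := bracket_pos ξ
    rw [Real.norm_of_nonneg (mul_nonneg (by positivity)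
      (Real.rpow_nonneg (maxwellian_pos u ξ).le _)), maxwellian_eq,
      Real.mul_rpow (amp_pos u).le (Real.exp_pos _).le, ← Real.exp_mul]
    have h2 : bracket ξ ≤ B * (1 + ‖ξ - u.v‖) := by
      have h3 : ‖ξ‖ ≤ ‖ξ - u.v‖ + ‖u.v‖ := by simpa using norm_add_le (ξ - u.v) u.v
      have h4 := bracket_le ξ
      have := mul_nonneg (norm_nonneg u.v) (norm_nonneg (ξ - u.v))
      rw [hB]
      linarith
    have h3 : bracket ξ ^ n ≤ B ^ n * (2 ^ (n - 1) * (1 + ‖ξ - u.v‖ ^ n)) := by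
      refine (pow_le_pow_left₀ hbr.le h2 n).trans ?_
      rw [mul_pow]
      have := add_pow_le zero_le_one (norm_nonneg (ξ - u.v)) n
      rw [one_pow] at this
      gcongr
    have hA := Real.rpow_nonneg (amp_pos u).le t
    have hE : Real.exp (-rate u * ‖ξ - u.v‖ ^ 2 * t) =
        Real.exp (-(rate u * t) * ‖ξ - u.v‖ ^ 2) := by ring_nf
    rw [hE]
    calc _ ≤ B ^ n * (2 ^ (n - 1) * (1 + ‖ξ - u.v‖ ^ n)) *
        (amp u ^ t * Real.exp (-(rate u * t) * ‖ξ - u.v‖ ^ 2)) := by gcongr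
      _ = _ := by ring

/-- The functions `ψ_j M`. -/
def invMaxwellian (u : FluidState) (j : Fin 5) (ξ : Vel) : ℂ :=
  ((invariant j ξ * maxwellian u ξ : ℝ) : ℂ)

lemma continuous_invMaxwellian (u : FluidState) (j : Fin 5) : Continuous (invMaxwellian u j) :=
  Complex.continuous_ofReal.comp ((continuous_invariant j).mul (continuous_maxwellian u))

/-- The squared weight leaves `M^{-2s} M² = M^{2-2s}`, a Gaussian because `s < 1`, and this beats
every power of `⟨ξ⟩`. -/
lemma memH_invMaxwellian (u : FluidState) {s : ℝ} (hs : s < 1) (a : ℝ) (j : Fin 5) :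
    MemH u s a (invMaxwellian u j) := by
  have hcont : Continuous (fun ξ => wt u s a ξ • invMaxwellian u j ξ) :=
    (continuous_wt u s a).smul (continuous_invMaxwellian u j)
  rw [memH_iff, memLp_two_iff_integrable_sq_norm hcont.aestronglyMeasurable]
  obtain ⟨n, hn⟩ := exists_nat_ge (2 * a)
  refine (integrable_bracket_mul_maxwellian u (n + 4) (t := 2 - 2 * s) (by linarith)).mono'
    (hcont.norm.pow 2).aestronglyMeasurable
    (.of_forall fun ξ => ?_)
  have hM := maxwellian_pos u ξ
  have hbr := bracket_pos ξ
  have hinv : |invariant j ξ| ≤ bracket ξ ^ 2 := by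
    rw [bracket, Real.sq_sqrt (by positivity)]
    exact abs_invariant_le j ξ
  have hinv2 : invariant j ξ ^ 2 ≤ bracket ξ ^ 4 := by
    rw [← sq_abs]
    calc _ ≤ (bracket ξ ^ 2) ^ 2 := by gcongr
      _ = _ := by ring
  have hpow : bracket ξ ^ (2 * a) ≤ bracket ξ ^ n := by
    rw [← Real.rpow_natCast]
    exact Real.rpow_le_rpow_of_exponent_le (one_le_bracket ξ) hn
  have hMM : maxwellian u ξ ^ (-2 * s) * maxwellian u ξ ^ 2 = maxwellian u ξ ^ (2 - 2 * s) := by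
    rw [← Real.rpow_natCast, ← Real.rpow_add hM]
    push_cast
    ring_nf
  rw [norm_pow, norm_norm, norm_smul, mul_pow, Real.norm_eq_abs, sq_abs, wt_sq, invMaxwellian,
    Complex.norm_real, Real.norm_eq_abs, sq_abs, mul_pow]
  have hMs := Real.rpow_nonneg hM.le (-2 * s)
  calc _ = bracket ξ ^ (2 * a) * invariant j ξ ^ 2 *
        (maxwellian u ξ ^ (-2 * s) * maxwellian u ξ ^ 2) := by ring
    _ ≤ bracket ξ ^ n * bracket ξ ^ 4 * (maxwellian u ξ ^ (-2 * s) * maxwellian u ξ ^ 2) := by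
        gcongr
    _ = _ := by rw [hMM, pow_add]

lemma ratio_invMaxwellian (u : FluidState) (j : Fin 5) (ξ : Vel) :
    ratio u (invMaxwellian u j) ξ = (invariant j ξ : ℂ) := by
  have hM : (maxwellian u ξ : ℂ) ≠ 0 := Complex.ofReal_ne_zero.2 (maxwellian_pos u ξ).ne'
  rw [ratio, invMaxwellian]
  push_cast
  field_simp

lemma norm_sq_post_add (ξ ξs : Vel) (Ω : S2) :
    ‖post ξ ξs Ω‖ ^ 2 + ‖postStar ξ ξs Ω‖ ^ 2 = ‖ξ‖ ^ 2 + ‖ξs‖ ^ 2 := by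
  set t := inner ℝ (Ω : Vel) (ξs - ξ) with ht
  have e3 : t = inner ℝ ξs (Ω : Vel) - inner ℝ ξ (Ω : Vel) := by
    rw [ht, ← inner_sub_left, real_inner_comm]
  rw [post, postStar, ← ht, norm_add_sq_real, norm_sub_sq_real, norm_smul, real_inner_smul_right,
    real_inner_smul_right]
  have hn : (‖t‖ * ‖(Ω : Vel)‖) ^ 2 = t ^ 2 := by simp
  rw [hn]
  linear_combination 2 * t * e3

lemma increment_invariant (j : Fin 5) (q : Coll) :
    increment (fun ξ => (invariant j ξ : ℂ)) q = 0 := by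
  have hlin : ∀ i : Fin 3, (post q.1 q.2.1 q.2.2) i + (postStar q.1 q.2.1 q.2.2) i -
      q.1 i - q.2.1 i = 0 := by
    intro i
    simp only [post, postStar, PiLp.add_apply, PiLp.sub_apply, PiLp.smul_apply]
    ring
  have hn := norm_sq_post_add q.1 q.2.1 q.2.2
  have h : invariant j (post q.1 q.2.1 q.2.2) + invariant j (postStar q.1 q.2.1 q.2.2) -
      invariant j q.1 - invariant j q.2.1 = 0 := by
    fin_cases j
    · simp [invariant]
    · exact hlin 0
    · exact hlin 1
    · exact hlin 2
    · change ‖post q.1 q.2.1 q.2.2‖ ^ 2 / 2 + ‖postStar q.1 q.2.1 q.2.2‖ ^ 2 / 2 -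
        ‖q.1‖ ^ 2 / 2 - ‖q.2.1‖ ^ 2 / 2 = 0
      linarith
  simp only [increment, collide]
  exact_mod_cast h

/-- The linearized operator conserves mass, momentum and energy. -/
lemma inKerR_linearized (u : FluidState) {f : Vel → ℂ} (hf : MemH u (1 / 2) (1 / 2) f) :
    InKerR (linearized u f) := by
  intro j
  obtain ⟨h1, h2⟩ := linearized_weak_form u hf
    (memH_invMaxwellian u (s := 1 / 2) (by norm_num) (1 / 2) j)
  have e : ∀ ξ, linearized u f ξ * (starRingEnd ℂ) (ratio u (invMaxwellian u j) ξ) =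
      (invariant j ξ : ℂ) * linearized u f ξ := by
    intro ξ
    rw [ratio_invMaxwellian, Complex.conj_ofReal, mul_comm]
  have e' : ratio u (invMaxwellian u j) = fun ξ => (invariant j ξ : ℂ) :=
    funext (ratio_invMaxwellian u j)
  simp only [e] at h1 h2
  rw [e'] at h2
  simp only [increment_invariant, map_zero, mul_zero, integral_zero] at h2
  exact ⟨h1, h2⟩

end HardSphere

end

/-! ### Classification of collision invariants -/

noncomputable section
namespace HardSphere
open MeasureTheory Set Filter Topology
open scoped ENNReal Convolution

lemma additive_eq_mul {r : ℝ → ℂ} (hr : Continuous r) (hadd : ∀ s t, r (s + t) = r s + r t) (t : ℝ) :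
    r t = t * r 1 := by
  have h := map_real_smul (AddMonoidHom.mk' r hadd) hr t 1
  simpa using h

/-- A continuous function on the line whose second differences are translation invariant is a
quadratic polynomial. -/
lemma quadratic_of_second_difference {φ : ℝ → ℂ} (hφ : Continuous φ)
    (hD : ∀ x s t, φ (x + s + t) - φ (x + s) - φ (x + t) + φ x = φ (s + t) - φ s - φ t + φ 0) :
    ∃ b κ : ℂ, ∀ t : ℝ, φ t = φ 0 + b * t + κ * (t : ℂ) ^ 2 := by
  -- The mixed second difference at the origin is additive in each variable and continuous, hence
  -- equal to `s t c(1,1)`. Subtracting `φ 0` and the quadratic `c(1,1) t² / 2` from `φ` leaves an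
  -- additive continuous function, which is linear.
  set c : ℝ → ℝ → ℂ := fun s t => φ (s + t) - φ s - φ t + φ 0 with hc
  have hadd : ∀ t s s', c (s + s') t = c s t + c s' t := by
    intro t s s'
    have h := hD s s' t
    simp only [hc]
    rw [add_right_comm s s' t] at h ⊢
    linear_combination h
  have hsymm : ∀ s t, c s t = c t s := by
    intro s t
    simp only [hc, add_comm s t]
    ring
  have hlin : ∀ s t, c s t = s * c 1 t := fun s t =>
    additive_eq_mul (r := fun s => c s t) (by simp only [hc]; fun_prop) (hadd t) s
  have hbil : ∀ s t, c s t = s * t * c 1 1 := by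
    intro s t
    rw [hlin, hsymm 1 t, hlin t 1]
    ring
  set r : ℝ → ℂ := fun t => φ t - φ 0 - c 1 1 / 2 * (t : ℂ) ^ 2 with hr
  have hradd : ∀ s t, r (s + t) = r s + r t := by
    intro s t
    have h := hbil s t
    simp only [hc] at h
    simp only [hr, hc]
    push_cast
    linear_combination h
  have hrc : Continuous r := by
    simp only [hr]
    fun_prop
  refine ⟨r 1, c 1 1 / 2, fun t => ?_⟩
  have h := additive_eq_mul hrc hradd t
  have h2 : r t = φ t - φ 0 - c 1 1 / 2 * (t : ℂ) ^ 2 := rfl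
  linear_combination h - h2

/-- Collisions are rectangles: if `p ⟂ q`, the collision of `a` and `a + p + q` in the direction `p
/ |p|` produces `a + p` and `a + q`. -/
lemma parallelogram_of_increment {g : Vel → ℂ} (hg : ∀ q, increment g q = 0) (a p q : Vel)
    (hpq : inner ℝ p q = 0) : g a + g (a + p + q) = g (a + p) + g (a + q) := by
  rcases eq_or_ne p 0 with rfl | hp
  · simp
  have hp' : ‖p‖ ≠ 0 := norm_ne_zero_iff.2 hp
  let Ω : S2 := ⟨‖p‖⁻¹ • p, by simp [norm_smul, hp']⟩
  have ht : inner ℝ (Ω : Vel) (a + p + q - a) = ‖p‖ := by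
    have : a + p + q - a = p + q := by abel
    rw [this, show (Ω : Vel) = ‖p‖⁻¹ • p from rfl, real_inner_smul_left, inner_add_right, hpq,
      real_inner_self_eq_norm_sq]
    field_simp
    ring
  have hs : ‖p‖ • (Ω : Vel) = p := by
    rw [show (Ω : Vel) = ‖p‖⁻¹ • p from rfl, smul_smul, mul_inv_cancel₀ hp', one_smul]
  have h := hg (a, a + p + q, Ω)
  simp only [increment, collide, post, postStar, ht, hs] at h
  rw [show a + p + q - p = a + q by abel] at h
  linear_combination -h

/-- Continuous collision invariants are combinations of the classical ones. -/
lemma exists_coeff_of_continuous {g : Vel → ℂ} (hc : Continuous g) (hg : ∀ q, increment g q = 0) :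
    ∃ c : Fin 5 → ℂ, ∀ x, g x = ∑ j, c j * (invariant j x : ℂ) := by
  have hpar := parallelogram_of_increment hg
  set e : Fin 3 → Vel := fun i => EuclideanSpace.single i 1 with he
  have horth : ∀ i j, i ≠ j → inner ℝ (e i) (e j) = 0 := by
    intro i j hij
    simp [he, EuclideanSpace.inner_single_left, hij]
  have hself : ∀ i, inner ℝ (e i) (e i) = 1 := by
    intro i
    simp [he]
  set φ : Fin 3 → ℝ → ℂ := fun i t => g (t • e i) with hφ
  have hφ0 : ∀ i, φ i 0 = g 0 := fun i => by simp [hφ]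
  have hφc : ∀ i, Continuous (φ i) := fun i => by simp only [hφ]; fun_prop
  have hplane : ∀ i j, i ≠ j → ∀ x y : ℝ, g (x • e i + y • e j) = φ i x + φ j y - g 0 := by
    intro i j hij x y
    have h := hpar 0 (x • e i) (y • e j) (by
      rw [real_inner_smul_left, real_inner_smul_right, horth i j hij]; ring)
    simp only [zero_add] at h
    simp only [hφ]
    linear_combination h
  -- Rectangles with sides along `e i + e j` and `e i - e j`. The left side does not depend on `y`
  -- and the right side does not depend on `x`, so the second differences of `φ i` are translation
  -- invariant.
  have hE : ∀ i j, i ≠ j → ∀ x y s t : ℝ,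
      φ i (x + s + t) - φ i (x + s) - φ i (x + t) + φ i x =
        -(φ j (y + s - t) - φ j (y + s) - φ j (y - t) + φ j y) := by
    intro i j hij x y s t
    have h := hpar (x • e i + y • e j) (s • e i + s • e j) (t • e i - t • e j) (by
      simp only [inner_add_left, inner_sub_right, real_inner_smul_left, real_inner_smul_right,
        horth i j hij, horth j i hij.symm, hself]
      ring)
    rw [show x • e i + y • e j + (s • e i + s • e j) + (t • e i - t • e j) =
        (x + s + t) • e i + (y + s - t) • e j by module,
      show x • e i + y • e j + (s • e i + s • e j) = (x + s) • e i + (y + s) • e j by module,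
      show x • e i + y • e j + (t • e i - t • e j) = (x + t) • e i + (y - t) • e j by module,
      hplane i j hij, hplane i j hij, hplane i j hij, hplane i j hij] at h
    linear_combination h
  have hquad : ∀ i, ∃ b κ : ℂ, ∀ t : ℝ, φ i t = φ i 0 + b * t + κ * (t : ℂ) ^ 2 := by
    intro i
    obtain ⟨j, hij⟩ := exists_ne i
    refine quadratic_of_second_difference (hφc i) fun x s t => ?_
    have h1 := hE i j hij.symm x 0 s t
    have h2 := hE i j hij.symm 0 0 s t
    simp only [zero_add] at h1 h2
    rw [h1, h2]
  choose b κ hb using hquad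
  -- The same identity compares the two leading coefficients, so the quadratic parts combine to a
  -- multiple of `|x|²`.
  have hκ : ∀ i j, i ≠ j → κ i = κ j := by
    intro i j hij
    have h := hE i j hij 0 0 1 1
    rw [hb i (0 + 1 + 1), hb i (0 + 1), hb j (0 + 1 - 1), hb j (0 + 1), hb j (0 - 1)] at h
    push_cast at h
    linear_combination h / 2
  refine ⟨![g 0, b 0, b 1, b 2, 2 * κ 0], fun x => ?_⟩
  have hx : x = x 0 • e 0 + (x 1 • e 1 + x 2 • e 2) := by
    ext i
    fin_cases i <;> simp [he]
  have hxn : ‖x‖ ^ 2 = x 0 ^ 2 + x 1 ^ 2 + x 2 ^ 2 := by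
    rw [EuclideanSpace.norm_sq_eq, Fin.sum_univ_three]
    simp
  have h1 := hpar 0 (x 0 • e 0) (x 1 • e 1 + x 2 • e 2) (by
    rw [inner_add_right, real_inner_smul_left, real_inner_smul_right, real_inner_smul_left,
      real_inner_smul_right, horth 0 1 (by decide), horth 0 2 (by decide)]
    ring)
  rw [zero_add, zero_add, ← hx, hplane 1 2 (by decide)] at h1
  have h2 : g (x 0 • e 0) = φ 0 (x 0) := rfl
  rw [h2, hb 0 (x 0), hb 1 (x 1), hb 2 (x 2), hφ0, hφ0, hφ0, ← hκ 0 1 (by decide),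
    ← hκ 0 2 (by decide)] at h1
  rw [Fin.sum_univ_five]
  simp only [invariant, Matrix.cons_val]
  rw [hxn]
  push_cast
  linear_combination h1

/-- Translation of both velocities. -/
def shift (t : Vel) (q : Coll) : Coll := (q.1 - t, q.2.1 - t, q.2.2)

lemma measurePreserving_shift (t : Vel) : MeasurePreserving (shift t)
    ((volume : Measure Vel).prod collisionMeasure) ((volume : Measure Vel).prod collisionMeasure) :=
  have : SFinite ((volume : Measure Vel).prod surf) := inferInstanceAs (SFinite collisionMeasure)
  (measurePreserving_sub_right volume t).prod
    ((measurePreserving_sub_right volume t).prod (MeasurePreserving.id surf))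

lemma increment_shift (h : Vel → ℂ) (t : Vel) (q : Coll) :
    increment h (shift t q) =
      h ((collide q).1 - t) + h ((collide q).2.1 - t) - h (q.1 - t) - h (q.2.1 - t) := by
  simp only [increment, shift, collide, post, postStar, sub_sub_sub_cancel_right]
  rw [sub_add_eq_add_sub, sub_right_comm q.2.1 t]

/-- Shifting both velocities preserves the collision measure, so Fubini turns the hypothesis into a
statement about almost every translate of almost every collision. This is what can be integrated
against a mollifier. -/
lemma ae_ae_increment_shift {h : Vel → ℂ}
    (h0 : ∀ᵐ q ∂((volume : Measure Vel).prod collisionMeasure), increment h q = 0) :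
    ∀ᵐ q ∂((volume : Measure Vel).prod collisionMeasure), ∀ᵐ t : Vel,
      increment h (shift t q) = 0 := by
  have e1 := (MeasurePreserving.id (volume : Measure Vel)).skew_product
    (μc := (volume : Measure Vel).prod collisionMeasure) (g := shift)
    (by unfold shift Function.uncurry; fun_prop)
    (.of_forall fun t => (measurePreserving_shift t).map_eq)
  have e2 : Measure.QuasiMeasurePreserving (fun z : Coll × Vel => shift z.2 z.1)
      (((volume : Measure Vel).prod collisionMeasure).prod volume)
      ((volume : Measure Vel).prod collisionMeasure) :=
    Measure.quasiMeasurePreserving_snd.comp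
      (e1.quasiMeasurePreserving.comp Measure.measurePreserving_swap.quasiMeasurePreserving)
  exact Measure.ae_ae_of_ae_prod (e2.ae h0)

/-- Collisions commute with translations, so the increment of a convolution is the average of
increments of translates and vanishes almost everywhere. It is continuous and the measure charges
open sets, so it vanishes everywhere. -/
lemma increment_convolution {h : Vel → ℂ} (hloc : LocallyIntegrable h)
    (h0 : ∀ᵐ q ∂((volume : Measure Vel).prod collisionMeasure), increment h q = 0)
    {φ : Vel → ℝ} (hφ : Continuous φ) (hφc : HasCompactSupport φ) (q : Coll) :
    increment (φ ⋆[ContinuousLinearMap.lsmul ℝ ℝ, volume] h) q = 0 := by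
  set g := φ ⋆[ContinuousLinearMap.lsmul ℝ ℝ, volume] h with hg
  have hgc : Continuous g := hφc.continuous_convolution_left _ hφ hloc
  have hInt : ∀ x, Integrable (fun t => φ t • h (x - t)) := fun x =>
    hφc.convolutionExists_left (ContinuousLinearMap.lsmul ℝ ℝ) hφ hloc x
  have hae : ∀ᵐ q ∂((volume : Measure Vel).prod collisionMeasure), increment g q = 0 := by
    filter_upwards [ae_ae_increment_shift h0] with q hq
    have e : increment g q = ∫ t, φ t • increment h (shift t q) := by
      have i1 := hInt (collide q).1
      have i2 := hInt (collide q).2.1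
      have i3 := hInt q.1
      have i4 := hInt q.2.1
      have i12 : Integrable (fun t => φ t • h ((collide q).1 - t) + φ t • h ((collide q).2.1 - t)) :=
        i1.add i2
      have i123 : Integrable (fun t => φ t • h ((collide q).1 - t) +
        φ t • h ((collide q).2.1 - t) - φ t • h (q.1 - t)) := i12.sub i3
      have e1 : ∀ x, g x = ∫ t, φ t • h (x - t) := fun x => rfl
      rw [increment, e1, e1, e1, e1, ← integral_add i1 i2, ← integral_sub i12 i3,
        ← integral_sub i123 i4]
      refine integral_congr_ae (.of_forall fun t => ?_)
      beta_reduce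
      rw [increment_shift]
      module
    rw [e]
    refine integral_eq_zero_of_ae ?_
    filter_upwards [hq] with t ht
    rw [ht, smul_zero, Pi.zero_apply]
  have hcol : Continuous collide :=
    continuous_post.prodMk (continuous_postStar.prodMk (by fun_prop))
  have hcont : Continuous (increment g) := by
    have h1 : Continuous (fun q => (collide q).1) := continuous_fst.comp hcol
    have h2 : Continuous (fun q => (collide q).2.1) := (continuous_fst.comp continuous_snd).comp hcol
    exact (((hgc.comp h1).add (hgc.comp h2)).sub (hgc.comp continuous_fst)).sub
      (hgc.comp (continuous_fst.comp continuous_snd))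
  have hpos : ((volume : Measure Vel).prod collisionMeasure).IsOpenPosMeasure := by
    have : collisionMeasure.IsOpenPosMeasure :=
      inferInstanceAs (((volume : Measure Vel).prod surf)).IsOpenPosMeasure
    infer_instance
  have h := (hcont.ae_eq_iff_eq _ continuous_const).1 hae
  exact congrFun h q

/-- Locally integrable collision invariants are combinations of the classical ones. -/
lemma exists_coeff_of_ae_increment {h : Vel → ℂ} (hloc : LocallyIntegrable h)
    (h0 : ∀ᵐ q ∂((volume : Measure Vel).prod collisionMeasure), increment h q = 0) :
    ∃ c : Fin 5 → ℂ, ∀ᵐ x, h x = ∑ j, c j * (invariant j x : ℂ) := by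
  -- The ratio of outer to inner radius is kept equal to `2`, as almost everywhere convergence of
  -- mollifications requires a bounded ratio.
  let φ : ℕ → ContDiffBump (0 : Vel) := fun n =>
    ⟨1 / (n + 1), 2 / (n + 1), by positivity, by
      have : (0 : ℝ) < n + 1 := by positivity
      gcongr
      norm_num⟩
  have hφ : Tendsto (fun n => (φ n).rOut) atTop (𝓝 0) := by
    have := (tendsto_one_div_add_atTop_nhds_zero_nat (𝕜 := ℝ)).const_mul 2
    simpa [φ, div_eq_mul_inv] using this
  have hlim := ContDiffBump.ae_convolution_tendsto_right_of_locallyIntegrable (K := 2) hφ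
    (.of_forall fun n => by simp only [φ]; rw [mul_one_div]) hloc
  set g : ℕ → Vel → ℂ := fun n =>
    (φ n).normed volume ⋆[ContinuousLinearMap.lsmul ℝ ℝ, volume] h with hgdef
  have hg : ∀ n, ∃ c : Fin 5 → ℂ, ∀ x, g n x = ∑ j, c j * (invariant j x : ℂ) := by
    intro n
    refine exists_coeff_of_continuous ?_ ?_
    · exact (φ n).hasCompactSupport_normed.continuous_convolution_left _ (φ n).continuous_normed hloc
    · exact increment_convolution hloc h0 (φ n).continuous_normed (φ n).hasCompactSupport_normed
  -- On the set of convergence the mollifications lie in the span of the five invariants. A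
  -- finite-dimensional subspace of `S → ℂ` is closed under pointwise convergence, so the limit
  -- stays in the span without any control of the coefficients.
  set S : Set Vel := {x | Tendsto (fun n => g n x) atTop (𝓝 (h x))} with hS
  set ψ : Fin 5 → (S → ℂ) := fun j x => (invariant j x : ℂ) with hψ
  set W : Submodule ℂ (S → ℂ) := Submodule.span ℂ (Set.range ψ) with hW
  have hWfin : FiniteDimensional ℂ W := FiniteDimensional.span_of_finite ℂ (Set.finite_range ψ)
  have hclosed : IsClosed (W : Set (S → ℂ)) := W.closed_of_finiteDimensional
  have hmem : (fun x : S => h x) ∈ W := by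
    refine hclosed.mem_of_tendsto (f := fun n (x : S) => g n x) (b := atTop) ?_ (.of_forall fun n => ?_)
    · exact tendsto_pi_nhds.2 fun x => x.2
    · obtain ⟨c, hc⟩ := hg n
      refine (Submodule.mem_span_range_iff_exists_fun ℂ).2 ⟨c, ?_⟩
      ext x
      simp [hψ, hc]
  obtain ⟨c, hc⟩ := (Submodule.mem_span_range_iff_exists_fun ℂ).1 hmem
  refine ⟨c, ?_⟩
  filter_upwards [hlim] with x hx
  have := congrFun hc ⟨x, hx⟩
  simpa [hψ] using this.symm

end HardSphere

end

/-! ### Duality, weak compactness and tails -/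

noncomputable section
namespace HardSphere
open MeasureTheory Set Filter Topology
open scoped ENNReal

lemma norm_integral_mul_conj_le {X : Type*} [MeasurableSpace X] {μ : Measure X} {f g : X → ℂ}
    (hf : MemLp f 2 μ) (hg : MemLp g 2 μ) :
    ‖∫ x, f x * (starRingEnd ℂ) (g x) ∂μ‖ ≤ (eLpNorm f 2 μ).toReal * (eLpNorm g 2 μ).toReal := by
  have h : inner ℂ (hg.toLp g) (hf.toLp f) = ∫ x, f x * (starRingEnd ℂ) (g x) ∂μ := by
    rw [L2.inner_def]
    refine integral_congr_ae ?_
    filter_upwards [hf.coeFn_toLp, hg.coeFn_toLp] with x h1 h2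
    rw [h1, h2, RCLike.inner_apply]
  rw [← h, mul_comm, ← Lp.norm_toLp f hf, ← Lp.norm_toLp g hg]
  exact norm_inner_le_norm _ _

lemma integral_norm_sq_eq {X : Type*} [MeasurableSpace X] {μ : Measure X} {f : X → ℂ}
    (hf : MemLp f 2 μ) : ∫ x, ‖f x‖ ^ 2 ∂μ = (eLpNorm f 2 μ).toReal ^ 2 := by
  have hm : AEStronglyMeasurable (fun x => ‖f x‖ ^ 2) μ := hf.1.norm.pow 2
  rw [← ENNReal.toReal_pow, eLpNorm_two_sq, integral_eq_lintegral_of_nonneg_ae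
    (.of_forall fun x => by positivity) hm]
  congr 1
  refine lintegral_congr fun x => ?_
  rw [ENNReal.ofReal_pow (norm_nonneg _), ofReal_norm]

lemma hIntegrand_eq_wt (u : FluidState) (s a b : ℝ) (hab : a + b = 0) (f g : Vel → ℂ) (ξ : Vel) :
    hIntegrand u s f g ξ = (wt u s a ξ • f ξ) * (starRingEnd ℂ) (wt u s b ξ • g ξ) := by
  have h : wt u s a ξ * wt u s b ξ = maxwellian u ξ ^ (-2 * s) := by
    rw [wt, wt, mul_mul_mul_comm, ← Real.rpow_add (bracket_pos ξ), hab, Real.rpow_zero, one_mul,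
      ← Real.rpow_add (maxwellian_pos u ξ)]
    ring_nf
  rw [hIntegrand, ← h]
  simp only [Complex.real_smul, map_mul, Complex.conj_ofReal]
  push_cast
  ring

/-- The norm of `⟨ξ⟩^{-a} ℍ^s`. -/
def hnorm (u : FluidState) (s a : ℝ) (f : Vel → ℂ) : ℝ :=
  (eLpNorm f 2 (weightedMeasure u s a)).toReal

lemma hnorm_nonneg (u : FluidState) (s a : ℝ) (f : Vel → ℂ) : 0 ≤ hnorm u s a f :=
  ENNReal.toReal_nonneg

/-- The weight is shared between the two factors, so the product of `ℍ^s` pairs spaces with opposite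
powers of `⟨ξ⟩`. This gives meaning to `(Lf, f)` when `Lf` has lost half a power and `f` has half a
power to spare. -/
lemma pairing_le {u : FluidState} {s a b : ℝ} (hab : a + b = 0) {f g : Vel → ℂ}
    (hf : MemH u s a f) (hg : MemH u s b g) :
    Integrable (hIntegrand u s f g) ∧
      ‖∫ ξ, hIntegrand u s f g ξ‖ ≤ hnorm u s a f * hnorm u s b g := by
  have hf' := (memH_iff u s a f).1 hf
  have hg' := (memH_iff u s b g).1 hg
  have e : hIntegrand u s f g = fun ξ => (wt u s a ξ • f ξ) * (starRingEnd ℂ) (wt u s b ξ • g ξ) :=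
    funext (hIntegrand_eq_wt u s a b hab f g)
  rw [e, hnorm, hnorm, eLpNorm_weighted, eLpNorm_weighted]
  exact ⟨integrable_mul_conj hf' hg', norm_integral_mul_conj_le hf' hg'⟩

/-- Functions in the dual weighted space act by the pairing of `ℍ^s`. -/
lemma exists_riesz (u : FluidState) {s a : ℝ} {k : Vel → ℂ} (hk : MemH u s (-a) k) :
    ∃ y : HSpace u s a, ∀ f : HSpace u s a, inner ℂ y f = ∫ ξ, hIntegrand u s f k ξ := by
  -- The factor `⟨ξ⟩^{-2a}` compensates the weight `⟨ξ⟩^{2a}` in the product of `HSpace u s a`.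
  set k' : Vel → ℂ := fun ξ => ((bracket ξ ^ (-(2 * a)) : ℝ) : ℂ) * k ξ with hk'
  have hpow : Continuous (fun ξ => ((bracket ξ ^ (-(2 * a)) : ℝ) : ℂ)) :=
    Complex.continuous_ofReal.comp (continuous_bracket.rpow_const fun ξ => Or.inl (bracket_pos ξ).ne')
  have hmem : MemH u s a k' := by
    refine hk.of_le (C := 1) (hpow.aestronglyMeasurable.mul hk.aesm) (.of_forall fun ξ => ?_)
    have hb := Real.rpow_pos_of_pos (bracket_pos ξ) (-(2 * a))
    rw [one_mul, norm_mul, Complex.norm_real, Real.norm_of_nonneg hb.le, ← mul_assoc,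
      show wt u s (-a) ξ = bracket ξ ^ (-(2 * a)) * wt u s a ξ by rw [← wt_add]; congr 1; ring,
      mul_comm (wt u s a ξ)]
  refine ⟨MemLp.toLp k' hmem, fun f => ?_⟩
  rw [L2.inner_def, integral_weighted]
  refine integral_congr_ae ?_
  have h1 : MemLp.toLp k' hmem =ᵐ[volume] k' :=
    (volume_ac_weightedMeasure u s a).ae_le (MemLp.coeFn_toLp hmem)
  filter_upwards [h1] with ξ h
  have hb : (bracket ξ ^ (2 * a) : ℝ) * bracket ξ ^ (-(2 * a)) = 1 := by
    rw [← Real.rpow_add (bracket_pos ξ), add_neg_cancel, Real.rpow_zero]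
  have hb' : ((bracket ξ ^ (2 * a) : ℝ) : ℂ) * ((bracket ξ ^ (-(2 * a)) : ℝ) : ℂ) = 1 := by
    exact_mod_cast hb
  rw [h, RCLike.inner_apply, hk', hIntegrand]
  simp only [Complex.real_smul, map_mul, Complex.conj_ofReal, Complex.ofReal_mul]
  linear_combination ((maxwellian u ξ ^ (-2 * s) : ℝ) : ℂ) * f ξ * (starRingEnd ℂ) (k ξ) * hb'

/-- Bounded sequences in a separable Hilbert space have weakly convergent subsequences. -/
lemma exists_weak_subseq {E : Type*} [NormedAddCommGroup E] [InnerProductSpace ℂ E]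
    [CompleteSpace E] [TopologicalSpace.SeparableSpace E] (x : ℕ → E) (hx : ∀ n, ‖x n‖ ≤ 1) :
    ∃ (z : E) (φ : ℕ → ℕ), StrictMono φ ∧
      ∀ y, Tendsto (fun n => inner ℂ y (x (φ n))) atTop (𝓝 (inner ℂ y z)) := by
  have hc := WeakDual.isSeqCompact_closedBall ℂ E (0 : StrongDual ℂ E) 1
  obtain ⟨ℓ, -, φ, hφ, hlim⟩ := hc (x := fun n =>
    StrongDual.toWeakDual (InnerProductSpace.toDual ℂ E (x n))) (fun n => by
      simpa using hx n)
  refine ⟨(InnerProductSpace.toDual ℂ E).symm (WeakDual.toStrongDual ℓ), φ, hφ, fun y => ?_⟩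
  have h1 : Tendsto (fun n => inner ℂ (x (φ n)) y) atTop
      (𝓝 (inner ℂ ((InnerProductSpace.toDual ℂ E).symm (WeakDual.toStrongDual ℓ)) y)) := by
    have := ((WeakDual.eval_continuous y).tendsto ℓ).comp hlim
    rw [InnerProductSpace.toDual_symm_apply]
    exact this
  have h2 := (Complex.continuous_conj.tendsto _).comp h1
  simp only [Function.comp_def, inner_conj_symm] at h2
  exact h2

instance (u : FluidState) (s a : ℝ) : SigmaFinite (weightedMeasure u s a) :=
  SigmaFinite.withDensity_ofReal _

instance (u : FluidState) (s a : ℝ) : TopologicalSpace.SeparableSpace (HSpace u s a) := by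
  have : Fact ((2 : ℝ≥0∞) ≠ ⊤) := ⟨by simp⟩
  infer_instance

/-- Bounded sequences converging to zero have vanishing integrals against vanishing weights. -/
lemma tendsto_lintegral_bracket {F : ℕ → Vel → ℝ≥0∞} (hF : ∀ n, AEMeasurable (F n))
    {C₁ C₂ : ℝ≥0∞} (hC₁ : C₁ ≠ ⊤) (hC₂ : C₂ ≠ ⊤) (h1 : ∀ n x, F n x ≤ C₁)
    (h2 : ∀ n, ∫⁻ x, F n x ≤ C₂) (hlim : ∀ x, Tendsto (fun n => F n x) atTop (𝓝 0)) :
    Tendsto (fun n => ∫⁻ x, ENNReal.ofReal (bracket x)⁻¹ * F n x) atTop (𝓝 0) := by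
  rw [ENNReal.tendsto_nhds_zero]
  intro ε hε
  -- Outside the ball of radius `R` the weight is at most `1/R`, so the mass bound `C₂` makes the
  -- tail small; inside, dominated convergence applies with the constant majorant `C₁`.
  obtain ⟨R, hR0, hR⟩ : ∃ R : ℝ, 0 < R ∧ ENNReal.ofReal R⁻¹ * C₂ ≤ ε / 2 := by
    have : Tendsto (fun R : ℝ => ENNReal.ofReal R⁻¹ * C₂) atTop (𝓝 0) := by
      have h := ENNReal.Tendsto.mul_const (b := C₂)
        (ENNReal.tendsto_ofReal (tendsto_inv_atTop_zero (𝕜 := ℝ))) (Or.inr hC₂)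
      simpa using h
    have h' := (ENNReal.tendsto_nhds_zero.1 this (ε / 2) (ENNReal.half_pos hε.ne')).and
      (eventually_gt_atTop 0)
    obtain ⟨R, hR, hR0⟩ := h'.exists
    exact ⟨R, hR0, hR⟩
  have hball : Tendsto (fun n => ∫⁻ x in Metric.ball 0 R, F n x) atTop (𝓝 0) := by
    have h := tendsto_lintegral_of_dominated_convergence' (μ := volume.restrict (Metric.ball (0 : Vel) R))
      (F := F) (f := fun _ => 0) (fun _ => C₁) (fun n => (hF n).restrict)
      (fun n => .of_forall (h1 n)) (by
        rw [lintegral_const, Measure.restrict_apply_univ]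
        exact ENNReal.mul_ne_top hC₁ measure_ball_lt_top.ne) (.of_forall hlim)
    simpa using h
  filter_upwards [ENNReal.tendsto_nhds_zero.1 hball (ε / 2) (ENNReal.half_pos hε.ne')] with n hn
  rw [← lintegral_add_compl _ (Metric.isOpen_ball (x := (0 : Vel)) (ε := R)).measurableSet]
  calc _ ≤ (∫⁻ x in Metric.ball 0 R, F n x) + ∫⁻ x in (Metric.ball 0 R)ᶜ, ENNReal.ofReal R⁻¹ * F n x := by
        refine add_le_add (lintegral_mono fun x => ?_) (setLIntegral_mono_ae' ?_ (.of_forall fun x hx => ?_))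
        · refine mul_le_of_le_one_left zero_le ?_
          rw [ENNReal.ofReal_le_one]
          exact inv_le_one_of_one_le₀ (one_le_bracket x)
        · exact Metric.isOpen_ball.measurableSet.compl
        · gcongr
          have : R ≤ ‖x‖ := by simpa using hx
          exact this.trans (norm_le_bracket x)
    _ ≤ ε / 2 + ε / 2 := by
        refine add_le_add hn (le_trans ?_ hR)
        rw [lintegral_const_mul' _ _ ENNReal.ofReal_ne_top]
        gcongr
        exact (setLIntegral_le_lintegral _ _).trans (h2 n)
    _ = ε := ENNReal.add_halves ε

end HardSphere

end

/-! ### The spectral gap in `ℍ^{1/2}` -/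

noncomputable section
namespace HardSphere
open MeasureTheory Set Filter Topology
open scoped ENNReal

variable {u : FluidState} {s : ℝ}

lemma hnorm_congr {a : ℝ} {f g : Vel → ℂ} (h : f =ᵐ[volume] g) : hnorm u s a f = hnorm u s a g := by
  rw [hnorm, hnorm, eLpNorm_congr_ae ((weightedMeasure_ac u s a).ae_le h)]

lemma hnorm_sq {a : ℝ} {f : Vel → ℂ} (hf : MemH u s a f) :
    hnorm u s a f ^ 2 = ∫ ξ, wt u s a ξ ^ 2 * ‖f ξ‖ ^ 2 := by
  rw [hnorm, eLpNorm_weighted, ← integral_norm_sq_eq ((memH_iff u s a f).1 hf)]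
  refine integral_congr_ae (.of_forall fun ξ => ?_)
  simp only [norm_smul, mul_pow, Real.norm_of_nonneg (wt_pos u s a ξ).le]

lemma integrable_wt_sq {a : ℝ} {f : Vel → ℂ} (hf : MemH u s a f) :
    Integrable (fun ξ => wt u s a ξ ^ 2 * ‖f ξ‖ ^ 2) := by
  have h := (memH_iff u s a f).1 hf
  refine ((memLp_two_iff_integrable_sq_norm h.1).1 h).congr (.of_forall fun ξ => ?_)
  simp only [norm_smul, mul_pow, Real.norm_of_nonneg (wt_pos u s a ξ).le]

lemma hnorm_le {t a b C : ℝ} (hC : 0 ≤ C) {f g : Vel → ℂ} (hg : MemH u t b g)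
    (h : ∀ᵐ ξ, wt u s a ξ * ‖f ξ‖ ≤ C * (wt u t b ξ * ‖g ξ‖)) :
    hnorm u s a f ≤ C * hnorm u t b g := by
  have h1 := ENNReal.toReal_mono (ENNReal.mul_ne_top ENNReal.ofReal_ne_top hg.2.ne)
    (eLpNorm_weighted_le h)
  rwa [ENNReal.toReal_mul, ENNReal.toReal_ofReal hC] at h1

lemma hnorm_mono {a b : ℝ} (hab : a ≤ b) {f : Vel → ℂ} (hf : MemH u s b f) :
    hnorm u s a f ≤ hnorm u s b f := by
  refine (hnorm_le zero_le_one hf (.of_forall fun ξ => ?_)).trans_eq (one_mul _)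
  rw [one_mul]
  exact mul_le_mul_of_nonneg_right (wt_mono u s hab ξ) (norm_nonneg _)

lemma memH_freq_mul (a : ℝ) {f : Vel → ℂ} (hf : MemH u s a f) :
    MemH u s (a - 1) (fun ξ => (freq u ξ : ℂ) * f ξ) := by
  obtain ⟨C, hC, hfreq⟩ := exists_freq_le u
  refine hf.of_le (C := C) ((Complex.measurable_ofReal.comp
    (measurable_freq u)).aestronglyMeasurable.mul hf.aesm) (.of_forall fun ξ => ?_)
  have h := wt_add u s 1 (a - 1) ξ
  rw [Real.rpow_one, add_sub_cancel] at h
  have hw := wt_pos u s (a - 1) ξ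
  rw [norm_mul, Complex.norm_real, Real.norm_of_nonneg (freq_nonneg u ξ), h]
  calc _ = wt u s (a - 1) ξ * ‖f ξ‖ * freq u ξ := by ring
    _ ≤ wt u s (a - 1) ξ * ‖f ξ‖ * (C * bracket ξ) := by gcongr; exact hfreq ξ
    _ = _ := by ring

lemma hIntegrand_sub (f₁ f₂ g : Vel → ℂ) (ξ : Vel) :
    hIntegrand u s (fun ξ => f₁ ξ - f₂ ξ) g ξ = hIntegrand u s f₁ g ξ - hIntegrand u s f₂ g ξ := by
  simp only [hIntegrand]
  ring

/-- The local part of the linearized operator controls the weighted norm, up to the nonlocal part. -/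
lemma le_neg_re_pairing (hs0 : 0 < s) (hs1 : s < 1) {c : ℝ} (hc : ∀ ξ, c * bracket ξ ≤ freq u ξ)
    {a b : ℝ} (hab : b + a = 0) {f : Vel → ℂ} (hf : MemH u s (1 / 2) f) (hfa : MemH u s a f)
    (hn : MemH u s b (nonlocal u f)) :
    Integrable (hIntegrand u s (linearized u f) f) ∧
    c * hnorm u s (1 / 2) f ^ 2 - hnorm u s b (nonlocal u f) * hnorm u s a f ≤
      -(∫ ξ, hIntegrand u s (linearized u f) f ξ).re := by
  have hff := memH_freq_mul (1 / 2) hf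
  obtain ⟨i1, h1⟩ := pairing_le hab hn hfa
  obtain ⟨i2, -⟩ := pairing_le (by norm_num) hff hf
  have e : hIntegrand u s (linearized u f) f = fun ξ => hIntegrand u s (nonlocal u f) f ξ -
      hIntegrand u s (fun ξ => (freq u ξ : ℂ) * f ξ) f ξ := by
    rw [linearized_eq hs0 hs1 (hf.mono (by norm_num))]
    exact funext fun ξ => hIntegrand_sub _ _ _ ξ
  have hre : ∀ ξ, (hIntegrand u s (fun ξ => (freq u ξ : ℂ) * f ξ) f ξ).re =
      freq u ξ * (wt u s 0 ξ ^ 2 * ‖f ξ‖ ^ 2) := by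
    intro ξ
    rw [wt_sq, hIntegrand, mul_assoc, Complex.mul_conj, Complex.normSq_eq_norm_sq, mul_zero,
      Real.rpow_zero, one_mul, ← Complex.ofReal_mul, ← Complex.ofReal_mul, Complex.ofReal_re]
    ring
  have h2 : c * hnorm u s (1 / 2) f ^ 2 ≤
      (∫ ξ, hIntegrand u s (fun ξ => (freq u ξ : ℂ) * f ξ) f ξ).re := by
    have h3 : (∫ ξ, hIntegrand u s (fun ξ => (freq u ξ : ℂ) * f ξ) f ξ).re =
        ∫ ξ, (hIntegrand u s (fun ξ => (freq u ξ : ℂ) * f ξ) f ξ).re := (integral_re i2).symm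
    rw [h3, hnorm_sq hf, ← integral_const_mul]
    refine integral_mono ((integrable_wt_sq hf).const_mul c) i2.re fun ξ => ?_
    change _ ≤ (hIntegrand u s (fun ξ => (freq u ξ : ℂ) * f ξ) f ξ).re
    rw [hre, wt_sq, wt_sq]
    have hM := Real.rpow_pos_of_pos (maxwellian_pos u ξ) (-2 * s)
    have hh := hc ξ
    simp only [mul_zero, Real.rpow_zero, one_mul, show 2 * (1 / 2 : ℝ) = 1 by norm_num,
      Real.rpow_one]
    calc _ = c * bracket ξ * (maxwellian u ξ ^ (-2 * s) * ‖f ξ‖ ^ 2) := by ring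
      _ ≤ _ := by gcongr
  refine ⟨e ▸ i1.sub i2, ?_⟩
  rw [e, integral_sub i1 i2, Complex.sub_re]
  have h4 := Complex.re_le_norm (∫ ξ, hIntegrand u s (nonlocal u f) f ξ)
  linarith

lemma hnorm_nonlocal_le (hs0 : 0 < s) (hs1 : s < 1) {f : Vel → ℂ} (hf : MemH u s 0 f) :
    hnorm u s 0 (nonlocal u f) ≤ profileL1 u s * hnorm u s 0 f := by
  have h := ENNReal.toReal_mono (ENNReal.mul_ne_top ENNReal.ofReal_ne_top hf.2.ne)
    (eLpNorm_nonlocal_le u hs0 hs1 hf)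
  rwa [ENNReal.toReal_mul, ENNReal.toReal_ofReal (profileL1_nonneg u s)] at h

/-- The norm of the collisional increment of `f / M` over the equilibrium collision measure. -/
def dissipation (u : FluidState) (f : Vel → ℂ) : ℝ :=
  (eLpNorm (increment (ratio u f)) 2 (equilibrium u)).toReal

lemma dissipation_nonneg (u : FluidState) (f : Vel → ℂ) : 0 ≤ dissipation u f :=
  ENNReal.toReal_nonneg

/-- The linearized H-theorem, that is the weak form tested with `f` itself. -/
lemma pairing_linearized_self {f : Vel → ℂ} (hf : MemH u (1 / 2) (1 / 2) f) :
    ∫ ξ, hIntegrand u (1 / 2) (linearized u f) f ξ = ((-(1 / 4) * dissipation u f ^ 2 : ℝ) : ℂ) := by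
  simp only [hIntegrand_half]
  rw [(linearized_weak_form u hf hf).2, dissipation, ← integral_norm_sq_eq (memLp_increment u hf)]
  push_cast
  rw [← integral_complex_ofReal]
  congr 1
  refine integral_congr_ae (.of_forall fun q => ?_)
  simp only [Complex.mul_conj, Complex.normSq_eq_norm_sq]

lemma hIntegrand_half_conj (f g : Vel → ℂ) (ξ : Vel) :
    hIntegrand u (1 / 2) f g ξ = (starRingEnd ℂ) (hIntegrand u (1 / 2) g f ξ) := by
  simp only [hIntegrand, map_mul, Complex.conj_conj, Complex.conj_ofReal]
  ring

/-- Cauchy-Schwarz for the dissipation form. If the dissipation of `g` tends to zero, so does its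
pairing with the fixed element `L f`; this identifies the dissipation of a weak limit. -/
lemma norm_pairing_linearized_le {f g : Vel → ℂ} (hf : MemH u (1 / 2) (1 / 2) f)
    (hg : MemH u (1 / 2) (1 / 2) g) :
    ‖∫ ξ, hIntegrand u (1 / 2) g (linearized u f) ξ‖ ≤ dissipation u f * dissipation u g := by
  have h : ∫ ξ, hIntegrand u (1 / 2) g (linearized u f) ξ =
      (starRingEnd ℂ) (∫ ξ, hIntegrand u (1 / 2) (linearized u f) g ξ) := by
    rw [← integral_conj]
    exact integral_congr_ae (.of_forall fun ξ => hIntegrand_half_conj _ _ ξ)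
  rw [h, RCLike.norm_conj]
  simp only [hIntegrand_half]
  rw [(linearized_weak_form u hf hg).2, norm_mul]
  have h1 := norm_integral_mul_conj_le (memLp_increment u hf) (memLp_increment u hg)
  have h2 : ‖(-(1 / 4) : ℂ)‖ ≤ 1 := by norm_num
  exact (mul_le_of_le_one_left (norm_nonneg _) h2).trans h1

lemma locallyIntegrable_ratio {a : ℝ} {f : Vel → ℂ} (hf : MemH u s a f) :
    LocallyIntegrable (ratio u f) volume := by
  have h := ((memH_iff u s a f).1 hf).locallyIntegrable (by norm_num)
  have hc : Continuous (fun ξ => (wt u s a ξ)⁻¹ * (maxwellian u ξ)⁻¹) :=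
    ((continuous_wt u s a).inv₀ fun ξ => (wt_pos u s a ξ).ne').mul
      ((continuous_maxwellian u).inv₀ fun ξ => (maxwellian_pos u ξ).ne')
  have h2 := h.continuous_smul hc
  refine h2.congr (.of_forall fun ξ => ?_)
  have hw : (wt u s a ξ : ℂ) ≠ 0 := Complex.ofReal_ne_zero.2 (wt_pos u s a ξ).ne'
  simp only [ratio, Complex.real_smul]
  push_cast
  field_simp

/-- Vanishing dissipation gives a null increment only where the density is positive. Where it
vanishes, `Ω` is orthogonal to `ξ_* - ξ`, the collision changes nothing and the increment is zero as
well. -/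
lemma ae_increment_eq_zero {f : Vel → ℂ} (hf : MemH u (1 / 2) (1 / 2) f) (h : dissipation u f = 0) :
    ∀ᵐ q ∂((volume : Measure Vel).prod collisionMeasure), increment (ratio u f) q = 0 := by
  have hm := memLp_increment u hf
  have h0 : eLpNorm (increment (ratio u f)) 2 (equilibrium u) = 0 :=
    (ENNReal.toReal_eq_zero_iff _).1 h |>.resolve_right hm.2.ne
  rw [eLpNorm_eq_zero_iff hm.1 two_ne_zero, EventuallyEq, equilibrium,
    ae_withDensity_iff (continuous_collDensity u).measurable.ennreal_ofReal] at h0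
  filter_upwards [h0] with q hq
  by_cases hd : ENNReal.ofReal (collDensity u q) = 0
  · have hk : inner ℝ (q.2.2 : Vel) (q.2.1 - q.1) = 0 := by
      have h1 : collDensity u q = 0 :=
        le_antisymm (ENNReal.ofReal_eq_zero.1 hd) (collDensity_nonneg u q)
      have hM : maxwellian u q.1 * maxwellian u q.2.1 ≠ 0 :=
        (mul_pos (maxwellian_pos u _) (maxwellian_pos u _)).ne'
      have h2 := (mul_eq_zero.1 h1).resolve_right hM
      rw [← neg_sub, inner_neg_right, abs_eq_zero.1 h2, neg_zero]
    simp only [increment, collide, post, postStar, hk, zero_smul, add_zero, sub_zero]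
    ring
  · exact hq hd

lemma integral_hIntegrand_invMaxwellian (f : Vel → ℂ) (j : Fin 5) :
    ∫ ξ, hIntegrand u (1 / 2) f (invMaxwellian u j) ξ = ∫ ξ, (invariant j ξ : ℂ) * f ξ := by
  refine integral_congr_ae (.of_forall fun ξ => ?_)
  simp only [hIntegrand_half, ratio_invMaxwellian, Complex.conj_ofReal]
  ring

/-- Without dissipation, only collision invariants times the Maxwellian are left. -/
lemma ae_eq_zero_of_dissipation {f : Vel → ℂ} (hf : MemH u (1 / 2) (1 / 2) f)
    (hd : dissipation u f = 0) (hk : ∀ j, ∫ ξ, (invariant j ξ : ℂ) * f ξ = 0) : f =ᵐ[volume] 0 := by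
  obtain ⟨c, hc⟩ := exists_coeff_of_ae_increment (locallyIntegrable_ratio hf)
    (ae_increment_eq_zero hf hd)
  have hi : ∀ j, Integrable (fun ξ => (invariant j ξ : ℂ) * f ξ) := fun j => by
    have h := (pairing_le (by norm_num) hf
      (memH_invMaxwellian u (s := 1 / 2) (by norm_num) (-(1 / 2)) j)).1
    refine h.congr (.of_forall fun ξ => ?_)
    simp only [hIntegrand_half, ratio_invMaxwellian, Complex.conj_ofReal]
    ring
  -- Since `f / M = ∑ c_j Ψ_j`, the squared norm of `f` is a combination of the moments of `f`,
  -- which vanish.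
  have hz : ∫ ξ, hIntegrand u (1 / 2) f f ξ = 0 := by
    have e : ∫ ξ, hIntegrand u (1 / 2) f f ξ =
        ∫ ξ, ∑ j, (starRingEnd ℂ) (c j) * ((invariant j ξ : ℂ) * f ξ) := by
      refine integral_congr_ae ?_
      filter_upwards [hc] with ξ h
      rw [hIntegrand_half, h, map_sum, Finset.mul_sum]
      refine Finset.sum_congr rfl fun j _ => ?_
      rw [map_mul, Complex.conj_ofReal]
      ring
    rw [e, integral_finsetSum _ fun j _ => (hi j).const_mul _]
    simp only [integral_const_mul, hk, mul_zero, Finset.sum_const_zero]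
  have h0 : MemH u (1 / 2) 0 f := hf.mono (by norm_num)
  have hn : hnorm u (1 / 2) 0 f ^ 2 = 0 := by
    rw [hnorm_sq h0]
    have e : ∀ ξ, hIntegrand u (1 / 2) f f ξ = ((wt u (1 / 2) 0 ξ ^ 2 * ‖f ξ‖ ^ 2 : ℝ) : ℂ) := by
      intro ξ
      rw [wt_sq, hIntegrand, Complex.mul_conj, Complex.normSq_eq_norm_sq, mul_zero,
        Real.rpow_zero, one_mul, ← Complex.ofReal_mul]
    simp only [e] at hz
    rw [integral_complex_ofReal] at hz
    exact_mod_cast hz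
  have hn' : eLpNorm f 2 (weightedMeasure u (1 / 2) 0) = 0 :=
    (ENNReal.toReal_eq_zero_iff _).1 (pow_eq_zero_iff two_ne_zero |>.1 hn) |>.resolve_right h0.2.ne
  rw [eLpNorm_eq_zero_iff h0.1 two_ne_zero] at hn'
  exact (volume_ac_weightedMeasure u _ _).ae_le hn'

/-- Weak sequential compactness of bounded sets in the weighted spaces. -/
lemma exists_weak_limit {a : ℝ} {g : ℕ → Vel → ℂ} (hg : ∀ n, MemH u s a (g n))
    (hb : ∀ n, hnorm u s a (g n) ≤ 1) :
    ∃ (x : Vel → ℂ) (φ : ℕ → ℕ), MemH u s a x ∧ StrictMono φ ∧ ∀ k, MemH u s (-a) k →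
      Tendsto (fun n => ∫ ξ, hIntegrand u s (g (φ n)) k ξ) atTop
        (𝓝 (∫ ξ, hIntegrand u s x k ξ)) := by
  obtain ⟨z, φ, hφ, hz⟩ := exists_weak_subseq (E := HSpace u s a)
    (fun n => MemLp.toLp (g n) (hg n)) (fun n => (Lp.norm_toLp (g n) (hg n)).trans_le (hb n))
  refine ⟨z, φ, Lp.memLp z, hφ, fun k hk => ?_⟩
  obtain ⟨y, hy⟩ := exists_riesz u hk
  have h := hz y
  simp only [hy] at h
  refine h.congr fun n => integral_congr_ae ?_
  have h1 : MemLp.toLp (g (φ n)) (hg (φ n)) =ᵐ[volume] g (φ n) :=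
    (volume_ac_weightedMeasure u s a).ae_le (MemLp.coeFn_toLp _)
  filter_upwards [h1] with ξ h
  rw [hIntegrand, hIntegrand, h]

/-- This function represents evaluation of the nonlocal part at `ξ` in the product of `ℍ^{1/2}`, so
weak convergence implies pointwise convergence of the nonlocal parts. -/
lemma memH_kernel (ξ : Vel) :
    MemH u (1 / 2) 0 (fun y => ((nonlocalKernel u ξ y * maxwellian u y : ℝ) : ℂ)) := by
  have hm : Measurable (fun y => nonlocalKernel u ξ y * maxwellian u y) :=
    (measurable_nonlocalKernel_right u ξ).mul (continuous_maxwellian u).measurable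
  have hb := beta_pos u (s := 1 / 2) (by norm_num) (by norm_num)
  have hp : MemLp (fun y => ((profile (rate u * (1 / 2 * (1 - 1 / 2))) (ξ - y) : ℝ) : ℂ)) 2
      (volume : Measure Vel) := by
    have hmp : Measurable (fun y => profile (rate u * (1 / 2 * (1 - 1 / 2))) (ξ - y)) :=
      (measurable_profile _).comp (measurable_const.sub measurable_id)
    have hmc : AEStronglyMeasurable (fun y =>
        ((profile (rate u * (1 / 2 * (1 - 1 / 2))) (ξ - y) : ℝ) : ℂ)) (volume : Measure Vel) :=
      (Complex.measurable_ofReal.comp hmp).aestronglyMeasurable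
    rw [memLp_two_iff_integrable_sq_norm hmc]
    have h := (integrable_profile_sq hb).comp_sub_left ξ
    refine h.congr (.of_forall fun y => ?_)
    simp [sq_abs]
  rw [memH_iff]
  refine hp.of_le_mul (c := (wt u (1 / 2) 0 ξ)⁻¹ * profileConst u)
    (((continuous_wt u _ _).measurable.aestronglyMeasurable).smul
      (Complex.measurable_ofReal.comp hm).aestronglyMeasurable) (.of_forall fun y => ?_)
  have h := wt_mul_abs_kernel_le u (1 / 2) ξ y (abs_nonlocalKernel_le u ξ y)
  have hM := maxwellian_pos u y
  have hw := wt_pos u (1 / 2) 0 ξ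
  have hw2 : wt u (1 / 2) 0 y * wt u (1 / 2) 0 y * maxwellian u y = 1 := by
    rw [← sq, wt_sq, half_weight, inv_mul_cancel₀ hM.ne']
  rw [norm_smul, Complex.norm_real, Complex.norm_real, Real.norm_of_nonneg (wt_pos _ _ _ _).le,
    Real.norm_eq_abs, abs_mul, abs_of_pos hM, Real.norm_of_nonneg (profile_nonneg _ _)]
  have hwy := wt_pos u (1 / 2) 0 y
  have h' : |nonlocalKernel u ξ y| ≤ (wt u (1 / 2) 0 ξ)⁻¹ *
      (profileConst u * profile (rate u * (1 / 2 * (1 - 1 / 2))) (ξ - y) * wt u (1 / 2) 0 y) := by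
    rw [inv_mul_eq_div, le_div_iff₀ hw, mul_comm]
    exact h
  calc _ ≤ wt u (1 / 2) 0 y * ((wt u (1 / 2) 0 ξ)⁻¹ *
      (profileConst u * profile (rate u * (1 / 2 * (1 - 1 / 2))) (ξ - y) * wt u (1 / 2) 0 y) *
        maxwellian u y) := by gcongr
    _ = (wt u (1 / 2) 0 ξ)⁻¹ * profileConst u *
        profile (rate u * (1 / 2 * (1 - 1 / 2))) (ξ - y) *
        (wt u (1 / 2) 0 y * wt u (1 / 2) 0 y * maxwellian u y) := by ring
    _ = _ := by rw [hw2, mul_one]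

lemma nonlocal_eq_pairing (f : Vel → ℂ) (ξ : Vel) : nonlocal u f ξ =
    ∫ y, hIntegrand u (1 / 2) f (fun y => ((nonlocalKernel u ξ y * maxwellian u y : ℝ) : ℂ)) y := by
  refine integral_congr_ae (.of_forall fun y => ?_)
  have hM : (maxwellian u y : ℂ) ≠ 0 := Complex.ofReal_ne_zero.2 (maxwellian_pos u y).ne'
  simp only [hIntegrand_half, ratio, Complex.real_smul, map_mul, map_inv₀, Complex.conj_ofReal]
  push_cast
  field_simp

/-- The nonlocal part turns weak convergence into strong convergence. -/
lemma tendsto_hnorm_nonlocal {g : ℕ → Vel → ℂ} (hg : ∀ n, MemH u (1 / 2) (1 / 2) (g n))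
    (hb : ∀ n, hnorm u (1 / 2) (1 / 2) (g n) ≤ 1)
    (hlim : ∀ k, MemH u (1 / 2) (-(1 / 2)) k →
      Tendsto (fun n => ∫ ξ, hIntegrand u (1 / 2) (g n) k ξ) atTop (𝓝 0)) :
    Tendsto (fun n => hnorm u (1 / 2) (-(1 / 2)) (nonlocal u (g n))) atTop (𝓝 0) := by
  have h0 : (0 : ℝ) < 1 / 2 := by norm_num
  have h1 : (1 / 2 : ℝ) < 1 := by norm_num
  have hg0 : ∀ n, MemH u (1 / 2) 0 (g n) := fun n => (hg n).mono (by norm_num)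
  have hb0 : ∀ n, eLpNorm (g n) 2 (weightedMeasure u (1 / 2) 0) ≤ 1 := fun n => by
    have h := (hnorm_mono (by norm_num : (0 : ℝ) ≤ 1 / 2) (hg n)).trans (hb n)
    have h' : eLpNorm (g n) 2 (weightedMeasure u (1 / 2) 0) ≤ ENNReal.ofReal 1 :=
      (ENNReal.le_ofReal_iff_toReal_le (hg0 n).2.ne zero_le_one).2 h
    rwa [ENNReal.ofReal_one] at h'
  -- The pointwise bound comes from the `L²` norm of the profile, the mass bound from Young's
  -- inequality, and the pointwise limit from weak convergence. The vanishing weight `⟨ξ⟩⁻¹` is the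
  -- square of the one in the target norm.
  have key := tendsto_lintegral_bracket
    (F := fun n ξ => ‖wt u (1 / 2) 0 ξ • nonlocal u (g n) ξ‖ₑ ^ 2)
    (C₁ := (ENNReal.ofReal (profileL2 u (1 / 2)) * 1) ^ 2)
    (C₂ := (ENNReal.ofReal (profileL1 u (1 / 2)) * 1) ^ 2)
    (fun n => ((((continuous_wt u _ _).measurable.aestronglyMeasurable).smul
      (aestronglyMeasurable_nonlocal u (hg n).aesm)).enorm.pow_const 2))
    (by simp) (by simp)
    (fun n ξ => pow_le_pow_left' ((enorm_nonlocal_le u _ _ ξ).trans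
      ((dominating_le u h0 h1 (hg0 n) ξ).trans (mul_le_mul_right (hb0 n) _))) 2)
    (fun n => (lintegral_mono fun ξ => pow_le_pow_left' (enorm_nonlocal_le u _ _ ξ) 2).trans
      ((lintegral_dominating_sq_le u h0 h1 (hg0 n)).trans
        (pow_le_pow_left' (mul_le_mul_right (hb0 n) _) 2)))
    (fun ξ => by
      have hk := hlim _ ((memH_kernel (u := u) ξ).mono (by norm_num))
      simp only [← nonlocal_eq_pairing] at hk
      have h2 := (ENNReal.continuous_pow 2).tendsto _ |>.comp (hk.const_smul (wt u (1 / 2) 0 ξ)).enorm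
      simpa [Function.comp_def] using h2)
  have e : ∀ n, ∫⁻ ξ, ENNReal.ofReal (bracket ξ)⁻¹ * ‖wt u (1 / 2) 0 ξ • nonlocal u (g n) ξ‖ₑ ^ 2 =
      eLpNorm (nonlocal u (g n)) 2 (weightedMeasure u (1 / 2) (-(1 / 2))) ^ 2 := by
    intro n
    rw [eLpNorm_weighted, eLpNorm_two_sq]
    refine lintegral_congr fun ξ => ?_
    have hb := bracket_pos ξ
    rw [enorm_smul, enorm_smul, mul_pow, mul_pow, ← mul_assoc,
      Real.enorm_of_nonneg (wt_pos _ _ _ _).le, Real.enorm_of_nonneg (wt_pos _ _ _ _).le,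
      ← ENNReal.ofReal_pow (wt_pos _ _ _ _).le, ← ENNReal.ofReal_pow (wt_pos _ _ _ _).le,
      ← ENNReal.ofReal_mul (by positivity), wt_sq, wt_sq]
    simp only [mul_zero, Real.rpow_zero, one_mul, show 2 * -(1 / 2 : ℝ) = -1 by norm_num,
      Real.rpow_neg_one]
  simp only [e] at key
  have h3 := (ENNReal.tendsto_toReal ENNReal.zero_ne_top).comp key
  simp only [Function.comp_def, ENNReal.toReal_pow, ENNReal.toReal_zero] at h3
  have h4 := h3.sqrt
  rw [Real.sqrt_zero] at h4
  exact h4.congr fun n => Real.sqrt_sq ENNReal.toReal_nonneg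

lemma dissipation_smul (c : ℂ) (f : Vel → ℂ) : dissipation u (c • f) = ‖c‖ * dissipation u f := by
  have e : increment (ratio u (c • f)) = c • increment (ratio u f) := by
    ext q
    simp only [increment, ratio, Pi.smul_apply, smul_eq_mul]
    ring
  rw [dissipation, e, eLpNorm_const_smul, ENNReal.toReal_mul, toReal_enorm, dissipation]

/-- The spectral gap of the linearized operator. -/
theorem exists_spectral_gap (u : FluidState) : ∃ δ : ℝ, 0 < δ ∧ ∀ f, MemH u (1 / 2) (1 / 2) f →
    (∀ j, ∫ ξ, (invariant j ξ : ℂ) * f ξ = 0) →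
      δ * hnorm u (1 / 2) (1 / 2) f ≤ dissipation u f := by
  by_contra! hcon
  have h0 : (0 : ℝ) < 1 / 2 := by norm_num
  have h1 : (1 / 2 : ℝ) < 1 := by norm_num
  choose f hf hk hlt using fun n : ℕ => hcon (1 / ((n : ℝ) + 1)) (by positivity)
  have hpos : ∀ n, 0 < hnorm u (1 / 2) (1 / 2) (f n) := fun n => by
    have h := (dissipation_nonneg u (f n)).trans_lt (hlt n)
    exact pos_of_mul_pos_right h (by positivity)
  -- A failing gap gives counterexamples for the constants `1/(n+1)`; dividing by the norm makes
  -- them unit vectors with dissipation tending to zero.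
  set r : ℕ → ℂ := fun n => (((hnorm u (1 / 2) (1 / 2) (f n))⁻¹ : ℝ) : ℂ) with hr
  have hrn : ∀ n, ‖r n‖ = (hnorm u (1 / 2) (1 / 2) (f n))⁻¹ := fun n => by
    rw [hr, Complex.norm_real, Real.norm_of_nonneg (inv_pos.2 (hpos n)).le]
  have hg : ∀ n, MemH u (1 / 2) (1 / 2) (r n • f n) := fun n => (hf n).const_smul _
  have hgn : ∀ n, hnorm u (1 / 2) (1 / 2) (r n • f n) = 1 := fun n => by
    rw [hnorm, eLpNorm_const_smul, ENNReal.toReal_mul, toReal_enorm, hrn]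
    exact inv_mul_cancel₀ (hpos n).ne'
  have hgd : ∀ n, dissipation u (r n • f n) ≤ 1 / ((n : ℝ) + 1) := fun n => by
    rw [dissipation_smul, hrn, inv_mul_le_iff₀ (hpos n), mul_comm]
    exact (hlt n).le
  have hgk : ∀ n j, ∫ ξ, (invariant j ξ : ℂ) * (r n • f n) ξ = 0 := fun n j => by
    have : ∀ ξ, (invariant j ξ : ℂ) * (r n • f n) ξ = r n * ((invariant j ξ : ℂ) * f n ξ) := by
      intro ξ
      simp only [Pi.smul_apply, smul_eq_mul]
      ring
    simp only [this, integral_const_mul, hk, mul_zero]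
  obtain ⟨x, φ, hx, hφ, hlim⟩ := exists_weak_limit hg fun n => (hgn n).le
  have hdlim : Tendsto (fun n => dissipation u (r (φ n) • f (φ n))) atTop (𝓝 0) := by
    refine squeeze_zero (fun n => dissipation_nonneg u _) (fun n => hgd (φ n)) ?_
    exact tendsto_one_div_add_atTop_nhds_zero_nat.comp hφ.tendsto_atTop
  have hxk : ∀ j, ∫ ξ, (invariant j ξ : ℂ) * x ξ = 0 := fun j => by
    have h := hlim _ (memH_invMaxwellian u h1 (-(1 / 2)) j)
    simp only [integral_hIntegrand_invMaxwellian, hgk] at h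
    exact tendsto_nhds_unique tendsto_const_nhds h |>.symm
  -- The sequence is paired with `L x`: weak convergence gives the limit `(x, Lx)`, and the
  -- dissipation bound gives the limit zero.
  have hxd : dissipation u x = 0 := by
    obtain ⟨C, -, hL⟩ := exists_eLpNorm_linearized_le u h0 h1 (a := 1 / 2) (b := -(1 / 2))
      (by norm_num) (by norm_num) (by norm_num)
    have h2 := hlim _ (hL x hx).1
    have h3 : Tendsto (fun n => ∫ ξ, hIntegrand u (1 / 2) (r (φ n) • f (φ n)) (linearized u x) ξ)
        atTop (𝓝 0) := by
      refine squeeze_zero_norm (fun n => norm_pairing_linearized_le hx (hg (φ n))) ?_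
      simpa using hdlim.const_mul (dissipation u x)
    have h4 := tendsto_nhds_unique h2 h3
    have h5 : ∫ ξ, hIntegrand u (1 / 2) (linearized u x) x ξ = 0 := by
      have e : ∀ ξ, hIntegrand u (1 / 2) (linearized u x) x ξ =
          (starRingEnd ℂ) (hIntegrand u (1 / 2) x (linearized u x) ξ) :=
        hIntegrand_half_conj _ _
      simp only [e]
      rw [integral_conj, h4, map_zero]
    rw [pairing_linearized_self hx] at h5
    have h6 : -(1 / 4) * dissipation u x ^ 2 = 0 := by exact_mod_cast h5
    exact pow_eq_zero_iff two_ne_zero |>.1 (by linarith)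
  have hx0 := ae_eq_zero_of_dissipation hx hxd hxk
  have hzero : ∀ k, ∫ ξ, hIntegrand u (1 / 2) x k ξ = 0 := fun k => by
    rw [integral_eq_zero_of_ae]
    filter_upwards [hx0] with ξ h
    simp [hIntegrand, h]
  have hN := tendsto_hnorm_nonlocal (fun n => hg (φ n)) (fun n => (hgn (φ n)).le) fun k hk => by
    have h := hlim k hk
    rwa [hzero k] at h
  obtain ⟨c, hc, hfreq⟩ := exists_le_freq u
  -- The frequency contributes at least `c` on unit vectors. The nonlocal term is measured with the
  -- exponent `-1/2`, where it tends to zero, against the unit norm with exponent `1/2`; in the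
  -- limit `c ≤ 0`.
  have hfin : ∀ n, c - hnorm u (1 / 2) (-(1 / 2)) (nonlocal u (r (φ n) • f (φ n))) ≤
      1 / 4 * dissipation u (r (φ n) • f (φ n)) ^ 2 := fun n => by
    have h := (le_neg_re_pairing h0 h1 hfreq (a := 1 / 2) (b := -(1 / 2)) (by norm_num) (hg (φ n))
      (hg (φ n)) ((memH_nonlocal u h0 h1 ((hg (φ n)).mono (by norm_num))).mono (by norm_num))).2
    rw [pairing_linearized_self (hg (φ n)), hgn, Complex.ofReal_re] at h
    linarith
  have hl1 : Tendsto (fun n => c - hnorm u (1 / 2) (-(1 / 2)) (nonlocal u (r (φ n) • f (φ n))))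
      atTop (𝓝 c) := by simpa using hN.const_sub c
  have hl2 : Tendsto (fun n => 1 / 4 * dissipation u (r (φ n) • f (φ n)) ^ 2) atTop (𝓝 0) := by
    have h := (hdlim.pow 2).const_mul (1 / 4 : ℝ)
    rwa [zero_pow two_ne_zero, mul_zero] at h
  exact absurd (le_of_tendsto_of_tendsto' hl1 hl2 hfin) (not_le.2 hc)

end HardSphere

end

/-! ### Hydrodynamic part, projection and coercivity in `ℍ^s` -/

noncomputable section
namespace HardSphere
open MeasureTheory Set Filter Topology
open scoped ENNReal

variable {u : FluidState} {s : ℝ}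

/-- A linear combination of the functions `Ψ_j M`. -/
def hydro (u : FluidState) (α : Fin 5 → ℂ) (ξ : Vel) : ℂ := ∑ j, α j * invMaxwellian u j ξ

lemma memH_hydro (hs : s < 1) (a : ℝ) (α : Fin 5 → ℂ) : MemH u s a (hydro u α) :=
  memLp_finsetSum _ fun j _ => (memH_invMaxwellian u hs a j).const_mul (α j)

/-- The class of `Ψ_j M`. -/
def invClass (u : FluidState) (hs : s < 1) (a : ℝ) (j : Fin 5) : HSpace u s a :=
  MemLp.toLp (invMaxwellian u j) (memH_invMaxwellian u hs a j)

lemma linearCombination_invClass_ae (hs : s < 1) (a : ℝ) (α : Fin 5 → ℂ) :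
    Fintype.linearCombination ℂ (invClass u hs a) α =ᵐ[volume] hydro u α := by
  refine (volume_ac_weightedMeasure u s a).ae_le ?_
  rw [Fintype.linearCombination_apply]
  have h1 : ∀ᵐ ξ ∂weightedMeasure u s a, ∀ j, (α j • invClass u hs a j : HSpace u s a) ξ =
      α j * invMaxwellian u j ξ := by
    refine ae_all_iff.2 fun j => ?_
    filter_upwards [Lp.coeFn_smul (α j) (invClass u hs a j),
      MemLp.coeFn_toLp (memH_invMaxwellian u hs a j)] with ξ h2 h3
    rw [h2, Pi.smul_apply, smul_eq_mul, invClass, h3]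
  filter_upwards [Lp.coeFn_finsetSum Finset.univ fun j => α j • invClass u hs a j, h1] with ξ h2 h3
  rw [h2, Finset.sum_apply, hydro]
  exact Finset.sum_congr rfl fun j _ => h3 j

lemma norm_linearCombination_invClass (hs : s < 1) (a : ℝ) (α : Fin 5 → ℂ) :
    ‖Fintype.linearCombination ℂ (invClass u hs a) α‖ = hnorm u s a (hydro u α) := by
  rw [Lp.norm_def, ← hnorm_congr (linearCombination_invClass_ae hs a α), hnorm]

/-- `B` factors through the range of `A`, and linear maps on a finite-dimensional space are bounded.
The kernel condition spares proving that the functions `Ψ_j M` are linearly independent. -/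
lemma exists_norm_le_of_ker_le {V E F : Type*} [AddCommGroup V] [Module ℂ V] [FiniteDimensional ℂ V]
    [NormedAddCommGroup E] [NormedSpace ℂ E] [NormedAddCommGroup F] [NormedSpace ℂ F]
    (A : V →ₗ[ℂ] E) (B : V →ₗ[ℂ] F) (h : LinearMap.ker A ≤ LinearMap.ker B) :
    ∃ C, 0 ≤ C ∧ ∀ v, ‖B v‖ ≤ C * ‖A v‖ := by
  let T : LinearMap.range A →ₗ[ℂ] F :=
    (LinearMap.ker A).liftQ B h ∘ₗ A.quotKerEquivRange.symm.toLinearMap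
  refine ⟨‖T.toContinuousLinearMap‖, T.toContinuousLinearMap.opNorm_nonneg, fun v => ?_⟩
  have e : T ⟨A v, LinearMap.mem_range_self A v⟩ = B v := by
    have : A.quotKerEquivRange.symm ⟨A v, LinearMap.mem_range_self A v⟩ =
        (LinearMap.ker A).mkQ v := by
      rw [LinearEquiv.symm_apply_eq]
      rfl
    simp only [T, LinearMap.comp_apply, LinearEquiv.coe_coe, this, Submodule.mkQ_apply,
      Submodule.liftQ_apply]
  rw [← e]
  exact T.toContinuousLinearMap.le_opNorm ⟨A v, _⟩

/-- The norms on the span of the functions `Ψ_j M` are equivalent. -/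
lemma exists_hnorm_hydro_le (u : FluidState) {t : ℝ} (hs : s < 1) (ht : t < 1) (a b : ℝ) :
    ∃ C, 0 ≤ C ∧ ∀ α, hnorm u s a (hydro u α) ≤ C * hnorm u t b (hydro u α) := by
  obtain ⟨C, hC, h⟩ := exists_norm_le_of_ker_le
    (Fintype.linearCombination ℂ (invClass u ht b)) (Fintype.linearCombination ℂ (invClass u hs a))
    -- Both combinations represent the same function `hydro u α`, so either vanishes exactly when
    -- that function is zero almost everywhere.
    (fun α hα => by
      rw [LinearMap.mem_ker] at hα ⊢
      have h1 := linearCombination_invClass_ae (u := u) ht b α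
      have h2 := linearCombination_invClass_ae (u := u) hs a α
      have h3 : (0 : HSpace u t b) =ᵐ[volume] 0 :=
        (volume_ac_weightedMeasure u t b).ae_le (Lp.coeFn_zero _ _ _)
      rw [hα] at h1
      rw [Lp.eq_zero_iff_ae_eq_zero]
      exact (weightedMeasure_ac u s a).ae_le (h2.trans (h1.symm.trans h3)))
  refine ⟨C, hC, fun α => ?_⟩
  rw [← norm_linearCombination_invClass hs, ← norm_linearCombination_invClass ht]
  exact h α

lemma kerR_eq_orthogonal (u : FluidState) : kerR u =
    (Submodule.span ℂ (range (invClass u (s := 1 / 2) (by norm_num) 0)))ᗮ := by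
  have hmem : ∀ f : HHalf u, f ∈ kerR u ↔
      ∀ j, inner ℂ (invClass u (s := 1 / 2) (by norm_num) 0 j) f = 0 := fun f =>
    ⟨fun hf j => (integrable_and_moment u j f).2.symm.trans (hf j).2,
      fun hf j => ⟨(integrable_and_moment u j f).1, (integrable_and_moment u j f).2.trans (hf j)⟩⟩
  ext f
  rw [hmem, Submodule.mem_orthogonal]
  refine ⟨fun h g hg => ?_, fun h j => h _ (Submodule.subset_span ⟨j, rfl⟩)⟩
  have hle : Submodule.span ℂ (range (invClass u (s := 1 / 2) (by norm_num) 0)) ≤ (ℂ ∙ f)ᗮ := by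
    rw [Submodule.span_le]
    rintro _ ⟨j, rfl⟩
    exact Submodule.mem_orthogonal_singleton_iff_inner_left.2 (h j)
  exact Submodule.mem_orthogonal_singleton_iff_inner_left.1 (hle hg)

/-- The orthogonal projection onto `𝕍` removes a combination of the functions `Ψ_j M`. -/
lemma exists_projV_eq (u : FluidState) (f : HHalf u) : ∃ α, projV u f =ᵐ[volume] f - hydro u α := by
  have h1 : f - projV u f ∈ (kerR u)ᗮ := Submodule.sub_starProjection_mem_orthogonal f
  have : FiniteDimensional ℂ
      (Submodule.span ℂ (range (invClass u (s := 1 / 2) (by norm_num) 0))) :=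
    FiniteDimensional.span_of_finite ℂ (finite_range _)
  rw [kerR_eq_orthogonal, Submodule.orthogonal_orthogonal,
    Submodule.mem_span_range_iff_exists_fun] at h1
  obtain ⟨α, hα⟩ := h1
  refine ⟨α, ?_⟩
  have h2 := linearCombination_invClass_ae (u := u) (s := 1 / 2) (by norm_num) 0 α
  rw [Fintype.linearCombination_apply, hα] at h2
  have h3 := (volume_ac_weightedMeasure u (1 / 2) 0).ae_le (Lp.coeFn_sub f (projV u f))
  filter_upwards [h2, h3] with ξ h4 h5
  rw [Pi.sub_apply] at h5
  rw [Pi.sub_apply, ← h4, h5, sub_sub_cancel]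

/-- The quotient of `hydro u α` by `M` is a collision invariant and has no increment, so the gap for
the projected function is a statement about `f`. -/
lemma dissipation_sub_hydro (f : Vel → ℂ) (α : Fin 5 → ℂ) :
    dissipation u (f - hydro u α) = dissipation u f := by
  have hr : ∀ ξ, ratio u (f - hydro u α) ξ = ratio u f ξ - ∑ j, α j * (invariant j ξ : ℂ) := by
    intro ξ
    simp only [← ratio_invMaxwellian u, ratio, Pi.sub_apply, hydro, mul_sub, Finset.mul_sum]
    congr 1
    exact Finset.sum_congr rfl fun j _ => by ring
  have e : increment (ratio u (f - hydro u α)) = increment (ratio u f) := by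
    ext q
    have h : ∑ j, α j * increment (fun ξ => (invariant j ξ : ℂ)) q = 0 :=
      Finset.sum_eq_zero fun j _ => by rw [increment_invariant, mul_zero]
    simp only [increment, mul_sub, mul_add, Finset.sum_sub_distrib, Finset.sum_add_distrib] at h
    simp only [increment, hr]
    linear_combination -h
  rw [dissipation, e, dissipation]

lemma hnorm_sub_le {a : ℝ} {f g : Vel → ℂ} (hf : MemH u s a f) (hg : MemH u s a g) :
    hnorm u s a (f - g) ≤ hnorm u s a f + hnorm u s a g := by
  rw [hnorm, hnorm, hnorm, ← ENNReal.toReal_add hf.2.ne hg.2.ne]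
  exact ENNReal.toReal_mono (ENNReal.add_ne_top.2 ⟨hf.2.ne, hg.2.ne⟩)
    (eLpNorm_sub_le hf.1 hg.1 (by norm_num))

lemma hnorm_le_sub_add {a : ℝ} {f g : Vel → ℂ} (hf : MemH u s a f) (hg : MemH u s a g) :
    hnorm u s a f ≤ hnorm u s a (f - g) + hnorm u s a g := by
  have h := eLpNorm_add_le (hf.sub hg).1 hg.1 (p := 2) (by norm_num)
  rw [sub_add_cancel] at h
  rw [hnorm, hnorm, hnorm, ← ENNReal.toReal_add (hf.sub hg).2.ne hg.2.ne]
  exact ENNReal.toReal_mono (ENNReal.add_ne_top.2 ⟨(hf.sub hg).2.ne, hg.2.ne⟩) h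

/-- Interpolation between the weighted norms. -/
lemma exists_hnorm_interpolation (u : FluidState) (hs : 1 / 2 ≤ s) {ε : ℝ} (hε : 0 < ε) :
    ∃ K, 0 ≤ K ∧ ∀ f, MemH u s (1 / 2) f →
      hnorm u s 0 f ^ 2 ≤ ε * hnorm u s (1 / 2) f ^ 2 + K * hnorm u (1 / 2) (1 / 2) f ^ 2 := by
  have hcont : Continuous (fun ξ => maxwellian u ξ ^ (1 - 2 * s)) :=
    (continuous_maxwellian u).rpow_const fun ξ => Or.inl (maxwellian_pos u ξ).ne'
  -- Where `⟨ξ⟩ ≥ 1/ε`, the extra weight supplies the small factor. Elsewhere `ξ` lies in this ball,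
  -- on which `M^{-2s} = M^{1-2s} M⁻¹` is at most `K M⁻¹`.
  obtain ⟨K, hK⟩ := (isCompact_closedBall (0 : Vel) (1 / ε)).exists_bound_of_continuousOn
    hcont.continuousOn
  have hK0 : 0 ≤ K := (norm_nonneg _).trans
    (hK 0 (Metric.mem_closedBall_self (by positivity)))
  refine ⟨K, hK0, fun f hf => ?_⟩
  have hf' := hf.of_exponent_le hs
  rw [hnorm_sq (hf.mono (by norm_num : (0 : ℝ) ≤ 1 / 2)), hnorm_sq hf, hnorm_sq hf',
    ← integral_const_mul, ← integral_const_mul,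
    ← integral_add ((integrable_wt_sq hf).const_mul ε) ((integrable_wt_sq hf').const_mul K)]
  refine integral_mono (integrable_wt_sq (hf.mono (by norm_num)))
    (((integrable_wt_sq hf).const_mul ε).add ((integrable_wt_sq hf').const_mul K)) fun ξ => ?_
  have hM := maxwellian_pos u ξ
  have hM1 := Real.rpow_pos_of_pos hM (-2 * s)
  have hB := one_le_bracket ξ
  have key : wt u s 0 ξ ^ 2 ≤ ε * wt u s (1 / 2) ξ ^ 2 + K * wt u (1 / 2) (1 / 2) ξ ^ 2 := by
    simp only [wt_sq, mul_zero, Real.rpow_zero, one_mul, show 2 * (1 / 2 : ℝ) = 1 by norm_num,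
      Real.rpow_one, show -2 * (1 / 2 : ℝ) = -1 by norm_num, Real.rpow_neg_one]
    rcases le_total (1 / ε) (bracket ξ) with h | h
    · have h1 : 1 ≤ ε * bracket ξ := by rwa [div_le_iff₀' hε] at h
      have h2 : 0 ≤ K * (bracket ξ * (maxwellian u ξ)⁻¹) := by positivity
      nlinarith
    · have h1 := hK ξ (by rw [mem_closedBall_zero_iff]; exact (norm_le_bracket ξ).trans h)
      rw [Real.norm_of_nonneg (Real.rpow_pos_of_pos hM _).le] at h1
      have h2 : maxwellian u ξ ^ (-2 * s) =
          maxwellian u ξ ^ (1 - 2 * s) * (maxwellian u ξ)⁻¹ := by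
        rw [← Real.rpow_neg_one, ← Real.rpow_add hM]
        ring_nf
      have h3 : 0 ≤ ε * (bracket ξ * maxwellian u ξ ^ (-2 * s)) := by positivity
      have h4 : maxwellian u ξ ^ (-2 * s) ≤ K * (bracket ξ * (maxwellian u ξ)⁻¹) := by
        rw [h2]
        have h5 := inv_pos.2 hM
        calc _ ≤ K * (maxwellian u ξ)⁻¹ := by gcongr
          _ ≤ K * (bracket ξ * (maxwellian u ξ)⁻¹) := by
            gcongr
            exact le_mul_of_one_le_left h5.le hB
      linarith
  calc _ ≤ (ε * wt u s (1 / 2) ξ ^ 2 + K * wt u (1 / 2) (1 / 2) ξ ^ 2) * ‖f ξ‖ ^ 2 := by gcongr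
    _ = _ := by ring

/-- Coercivity in `ℍ^s` up to lower order terms. -/
lemma exists_coercive_sub (u : FluidState) (hs : 1 / 2 ≤ s) (hs1 : s < 1) :
    ∃ c K, 0 < c ∧ 0 ≤ K ∧ ∀ f, MemH u s (1 / 2) f →
      Integrable (hIntegrand u s (linearized u f) f) ∧
      c * hnorm u s (1 / 2) f ^ 2 - K * hnorm u (1 / 2) (1 / 2) f ^ 2 ≤
        -(∫ ξ, hIntegrand u s (linearized u f) f ξ).re := by
  have hs0 : 0 < s := by linarith
  obtain ⟨c, hc, hfreq⟩ := exists_le_freq u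
  have hP := profileL1_nonneg u s
  -- This `ε` makes the nonlocal contribution at most half of the gain from the frequency; the `+ 1`
  -- only avoids division by zero.
  obtain ⟨K, hK, hInt⟩ := exists_hnorm_interpolation u hs
    (ε := c / (2 * (profileL1 u s + 1))) (by positivity)
  refine ⟨c / 2, profileL1 u s * K, by positivity, by positivity, fun f hf => ?_⟩
  have hf0 : MemH u s 0 f := hf.mono (by norm_num)
  obtain ⟨h1, h2⟩ := le_neg_re_pairing hs0 hs1 hfreq (a := 0) (b := 0) (by norm_num) hf hf0
    (memH_nonlocal u hs0 hs1 hf0)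
  refine ⟨h1, le_trans ?_ h2⟩
  have h3 := mul_le_mul_of_nonneg_right (hnorm_nonlocal_le hs0 hs1 hf0) (hnorm_nonneg u s 0 f)
  have h4 := mul_le_mul_of_nonneg_left (hInt f hf) hP
  have h5 : profileL1 u s * (c / (2 * (profileL1 u s + 1))) ≤ c / 2 := by
    rw [mul_div_assoc', div_le_div_iff₀ (by positivity) (by positivity)]
    nlinarith
  have h6 := mul_le_mul_of_nonneg_right h5 (sq_nonneg (hnorm u s (1 / 2) f))
  nlinarith

/-- If the moments of `⟨ξ⟩ f` vanish, the part of `f` in `𝕍` controls the remaining part. -/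
lemma hnorm_hydro_le {f : Vel → ℂ} (hf : MemH u (1 / 2) (1 / 2) f)
    (hk : InKerR (fun ξ => (bracket ξ : ℂ) * f ξ)) (α : Fin 5 → ℂ) :
    hnorm u (1 / 2) (1 / 2) (hydro u α) ≤ hnorm u (1 / 2) (1 / 2) (f - hydro u α) := by
  have h1 : (1 / 2 : ℝ) < 1 := by norm_num
  have hh := memH_hydro (u := u) h1 (1 / 2) α
  have hp : MemH u (1 / 2) (1 / 2) (f - hydro u α) := hf.sub hh
  have hw : ∀ (g : Vel → ℂ) ξ, wt u (1 / 2) (-(1 / 2)) ξ * ‖(bracket ξ : ℂ) * g ξ‖ =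
      1 * (wt u (1 / 2) (1 / 2) ξ * ‖g ξ‖) := by
    intro g ξ
    have h := wt_add u (1 / 2) 1 (-(1 / 2)) ξ
    rw [Real.rpow_one, show (1 : ℝ) + -(1 / 2) = 1 / 2 by norm_num] at h
    rw [norm_mul, Complex.norm_real, Real.norm_of_nonneg (bracket_pos ξ).le, h]
    ring
  have hmul : ∀ g : Vel → ℂ, MemH u (1 / 2) (1 / 2) g →
      MemH u (1 / 2) (-(1 / 2)) (fun ξ => (bracket ξ : ℂ) * g ξ) := fun g hg =>
    hg.of_le ((Complex.continuous_ofReal.comp continuous_bracket).aestronglyMeasurable.mul hg.aesm)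
      (.of_forall fun ξ => (hw g ξ).le)
  obtain ⟨i1, b1⟩ := pairing_le (by norm_num) (hmul _ hp) hh
  obtain ⟨i2, -⟩ := pairing_le (by norm_num) (hmul _ hh) hh
  -- The moments say that `⟨ξ⟩ f` is orthogonal to the hydrodynamic part `h`. Hence `(⟨ξ⟩ h, h) =
  -- -(⟨ξ⟩ (f - h), h)`, and Cauchy-Schwarz concludes.
  have e0 : ∫ ξ, hIntegrand u (1 / 2) (fun ξ => (bracket ξ : ℂ) * f ξ) (hydro u α) ξ = 0 := by
    have e : ∀ ξ, hIntegrand u (1 / 2) (fun ξ => (bracket ξ : ℂ) * f ξ) (hydro u α) ξ =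
        ∑ j, (starRingEnd ℂ) (α j) * ((invariant j ξ : ℂ) * ((bracket ξ : ℂ) * f ξ)) := by
      intro ξ
      have hr : ratio u (hydro u α) ξ = ∑ j, α j * (invariant j ξ : ℂ) := by
        simp only [← ratio_invMaxwellian u, ratio, hydro, Finset.mul_sum]
        exact Finset.sum_congr rfl fun j _ => by ring
      rw [hIntegrand_half, hr, map_sum, Finset.mul_sum]
      refine Finset.sum_congr rfl fun j _ => ?_
      rw [map_mul, Complex.conj_ofReal]
      ring
    simp only [e]
    rw [integral_finsetSum _ fun j _ => (hk j).1.const_mul _]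
    simp only [integral_const_mul, (hk _).2, mul_zero, Finset.sum_const_zero]
  have e1 : ∫ ξ, hIntegrand u (1 / 2) (fun ξ => (bracket ξ : ℂ) * hydro u α ξ) (hydro u α) ξ =
      ((hnorm u (1 / 2) (1 / 2) (hydro u α) ^ 2 : ℝ) : ℂ) := by
    rw [hnorm_sq hh, ← integral_complex_ofReal]
    refine integral_congr_ae (.of_forall fun ξ => ?_)
    simp only [wt_sq, hIntegrand, mul_assoc, Complex.mul_conj, Complex.normSq_eq_norm_sq]
    rw [show 2 * (1 / 2 : ℝ) = 1 by norm_num, Real.rpow_one]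
    push_cast
    ring
  have e2 : ∫ ξ, hIntegrand u (1 / 2) (fun ξ => (bracket ξ : ℂ) * (f - hydro u α) ξ) (hydro u α) ξ +
      hIntegrand u (1 / 2) (fun ξ => (bracket ξ : ℂ) * hydro u α ξ) (hydro u α) ξ = 0 := by
    rw [← e0]
    refine integral_congr_ae (.of_forall fun ξ => ?_)
    simp only [hIntegrand, Pi.sub_apply]
    ring
  rw [integral_add i1 i2, e1] at e2
  have hN : hnorm u (1 / 2) (1 / 2) (hydro u α) ^ 2 ≤
      hnorm u (1 / 2) (1 / 2) (f - hydro u α) * hnorm u (1 / 2) (1 / 2) (hydro u α) := by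
    have h2 := congrArg norm (eq_neg_of_add_eq_zero_left e2)
    rw [norm_neg, Complex.norm_real, Real.norm_of_nonneg (sq_nonneg _)] at h2
    rw [← h2]
    refine b1.trans (mul_le_mul_of_nonneg_right ?_ (hnorm_nonneg _ _ _ _))
    exact (hnorm_le zero_le_one hp (.of_forall fun ξ => (hw _ ξ).le)).trans_eq (one_mul _)
  rcases (hnorm_nonneg u (1 / 2) (1 / 2) (hydro u α)).eq_or_lt with h | h
  · rw [← h]
    exact hnorm_nonneg _ _ _ _
  · rw [sq] at hN
    exact le_of_mul_le_mul_right hN h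

lemma hNormSq_eq {f : Vel → ℂ} (hf : MemH u s 0 f) : hNormSq u s f = hnorm u s 0 f ^ 2 := by
  rw [hnorm_sq hf, hNormSq]
  refine integral_congr_ae (.of_forall fun ξ => ?_)
  simp only [wt_sq, mul_zero, Real.rpow_zero, one_mul]

lemma hNormSq_bracket {f : Vel → ℂ} (hf : MemH u s (1 / 2) f) :
    hNormSq u s (fun ξ => ((bracket ξ ^ (1 / 2 : ℝ) : ℝ) : ℂ) * f ξ) = hnorm u s (1 / 2) f ^ 2 := by
  rw [hnorm_sq hf, hNormSq]
  refine integral_congr_ae (.of_forall fun ξ => ?_)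
  have hB := bracket_pos ξ
  simp only [wt_sq, norm_mul, mul_pow, Complex.norm_real,
    Real.norm_of_nonneg (Real.rpow_pos_of_pos hB _).le]
  rw [← Real.rpow_natCast (bracket ξ ^ (1 / 2 : ℝ)), ← Real.rpow_mul hB.le]
  push_cast
  rw [mul_comm (1 / 2 : ℝ) 2]
  ring

lemma exists_tildeNormSq_le (u : FluidState) (hs : 1 / 2 ≤ s) {lam : ℝ} (hl : 0 ≤ lam) :
    ∃ C : ℝ, ∀ f : Vel → ℂ, MemH u s 0 f → hNormSq u s f ≤ tildeNormSq u s lam f ∧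
      tildeNormSq u s lam f ≤ C * hNormSq u s f := by
  have hA : 0 ≤ amp u ^ (s - 1 / 2) := (Real.rpow_pos_of_pos (amp_pos u) _).le
  refine ⟨1 + lam * (amp u ^ (s - 1 / 2)) ^ 2, fun f hf => ?_⟩
  have hf' := hf.of_exponent_le hs
  have h : hnorm u (1 / 2) 0 f ≤ amp u ^ (s - 1 / 2) * hnorm u s 0 f := by
    refine hnorm_le hA hf (.of_forall fun ξ => ?_)
    rw [← mul_assoc]
    exact mul_le_mul_of_nonneg_right (wt_le_of_exponent_le u hs 0 ξ) (norm_nonneg _)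
  rw [tildeNormSq, hNormSq_eq hf, hNormSq_eq hf']
  have h2 := pow_le_pow_left₀ (hnorm_nonneg u _ _ f) h 2
  have h3 := mul_le_mul_of_nonneg_left h2 hl
  constructor
  · have := mul_nonneg hl (sq_nonneg (hnorm u (1 / 2) 0 f))
    linarith
  · rw [mul_pow] at h3
    linarith

/-- Coercivity of the linearized operator in the equivalent norm. -/
theorem exists_coercivity (u : FluidState) (hs : 1 / 2 ≤ s) (hs1 : s < 1) :
    ∃ lam δ : ℝ, 0 ≤ lam ∧ 0 < δ ∧ ∀ f : HHalf u, MemH u s 1 f →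
      (f ∈ kerR u ∨ InKerR (fun ξ => (bracket ξ : ℂ) * f ξ)) →
      MemH u s (1 / 2) (projV u f) ∧
      Integrable (hIntegrand u s (linearized u f) f) ∧
      Integrable (hIntegrand u (1 / 2) (linearized u f) f) ∧
      δ * tildeNormSq u s lam
          (fun ξ => ((bracket ξ ^ (1 / 2 : ℝ) : ℝ) : ℂ) * projV u f ξ) ≤
        -(tildeInner u s lam (linearized u f) f).re := by
  have h12 : (1 / 2 : ℝ) < 1 := by norm_num
  obtain ⟨c, K, hc, hK, hcoer⟩ := exists_coercive_sub u hs hs1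
  obtain ⟨_, _, _, _, hcoer'⟩ := exists_coercive_sub u le_rfl h12
  obtain ⟨d, hd, hgap⟩ := exists_spectral_gap u
  obtain ⟨D, hD, hequiv⟩ := exists_hnorm_hydro_le u hs1 h12 (1 / 2) (1 / 2)
  -- The loss relative to `N²` is `4K` from the coercivity error and `(c/2) D²` from passing from
  -- `f` to its projection in `ℍ^s`. The dissipation supplies `(lam / 4) d² N²`, twice this loss,
  -- and the unused half equals `lam (d²/8) N²`; the `ℍ^s` part keeps `(c/4) S²`. These two
  -- remainders fix the minimum.
  refine ⟨8 * (4 * K + c / 2 * D ^ 2) / d ^ 2, min (c / 4) (d ^ 2 / 8), by positivity,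
    by positivity, fun f hf hker => ?_⟩
  obtain ⟨α, hα⟩ := exists_projV_eq u f
  have hfs : MemH u s (1 / 2) f := hf.mono (by norm_num)
  have hfh : MemH u (1 / 2) (1 / 2) f := hfs.of_exponent_le hs
  have hhs := memH_hydro (u := u) hs1 (1 / 2) α
  have hhh := memH_hydro (u := u) h12 (1 / 2) α
  have hps : MemH u s (1 / 2) (f - hydro u α) := hfs.sub hhs
  have hph : MemH u (1 / 2) (1 / 2) (f - hydro u α) := hfh.sub hhh
  have hPs : MemH u s (1 / 2) (projV u f) := hps.ae_eq ((weightedMeasure_ac u _ _).ae_le hα.symm)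
  have hPh : MemH u (1 / 2) (1 / 2) (projV u f) :=
    hph.ae_eq ((weightedMeasure_ac u _ _).ae_le hα.symm)
  refine ⟨hPs, (hcoer f hfs).1, (hcoer' f hfh).1, ?_⟩
  have hmom : ∀ j, ∫ ξ, (invariant j ξ : ℂ) * (f - hydro u α) ξ = 0 := fun j => by
    have hmem : projV u f ∈ kerR u := (kerR u).starProjection_apply_mem f
    rw [← (hmem j).2]
    refine integral_congr_ae ?_
    filter_upwards [hα] with ξ h
    rw [h]
  -- The alternative on `f` enters only here: in the first case the removed part is zero, in the
  -- second it is controlled by orthogonality.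
  have hN : hnorm u (1 / 2) (1 / 2) (hydro u α) ≤ hnorm u (1 / 2) (1 / 2) (f - hydro u α) := by
    rcases hker with h | h
    · have hz : hydro u α =ᵐ[volume] 0 := by
        have : projV u f = f := Submodule.starProjection_eq_self_iff.2 h
        rw [this] at hα
        filter_upwards [hα] with ξ hξ
        rw [Pi.sub_apply] at hξ
        rw [Pi.zero_apply]
        linear_combination hξ
      rw [hnorm_congr hz, hnorm, eLpNorm_zero, ENNReal.toReal_zero]
      exact hnorm_nonneg _ _ _ _
    · exact hnorm_hydro_le hfh h α
  have hg := hgap _ hph hmom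
  rw [dissipation_sub_hydro] at hg
  have hNf := hnorm_le_sub_add hfh hhh
  have hSp := hnorm_sub_le hfs hhs
  have hSh := hequiv α
  have hS := (hcoer f hfs).2
  rw [tildeInner, pairing_linearized_self hfh, tildeNormSq, hNormSq_bracket hPs,
    hNormSq_bracket hPh, hnorm_congr hα, hnorm_congr hα, Complex.add_re, ← Complex.ofReal_mul,
    Complex.ofReal_re]
  set lam := 8 * (4 * K + c / 2 * D ^ 2) / d ^ 2 with hlam
  set N := hnorm u (1 / 2) (1 / 2) (f - hydro u α)
  set S := hnorm u s (1 / 2) (f - hydro u α)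
  set Sf := hnorm u s (1 / 2) f
  have n1 : 0 ≤ N := hnorm_nonneg _ _ _ _
  have n2 : 0 ≤ S := hnorm_nonneg _ _ _ _
  have n3 : 0 ≤ Sf := hnorm_nonneg _ _ _ _
  have hlam0 : 0 ≤ lam := by positivity
  have q1 : hnorm u (1 / 2) (1 / 2) f ^ 2 ≤ 4 * N ^ 2 := by
    have := pow_le_pow_left₀ (hnorm_nonneg u (1 / 2) (1 / 2) f)
      (show hnorm u (1 / 2) (1 / 2) f ≤ 2 * N by linarith) 2
    linarith
  have q2 : S ^ 2 ≤ 2 * Sf ^ 2 + 2 * (D ^ 2 * N ^ 2) := by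
    have h1 : S ≤ Sf + D * N := by
      have := mul_le_mul_of_nonneg_left hN hD
      linarith
    have h2 := pow_le_pow_left₀ n2 h1 2
    nlinarith [sq_nonneg (Sf - D * N)]
  have q3 : d ^ 2 * N ^ 2 ≤ dissipation u f ^ 2 := by
    rw [← mul_pow]
    exact pow_le_pow_left₀ (by positivity) hg 2
  have q4 : lam * d ^ 2 = 8 * (4 * K + c / 2 * D ^ 2) := by
    rw [hlam]
    field_simp
  have q5 := mul_le_mul_of_nonneg_left q1 hK
  have q6 := mul_le_mul_of_nonneg_left q2 (by positivity : 0 ≤ c / 4)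
  have q7 := mul_le_mul_of_nonneg_left q3 hlam0
  have q8 : lam * d ^ 2 * N ^ 2 = 8 * (4 * K + c / 2 * D ^ 2) * N ^ 2 := by rw [q4]
  have q9 := mul_le_mul_of_nonneg_right (min_le_left (c / 4) (d ^ 2 / 8)) (sq_nonneg S)
  have q10 := mul_le_mul_of_nonneg_right (min_le_right (c / 4) (d ^ 2 / 8))
    (mul_nonneg hlam0 (sq_nonneg N))
  have q11 : 0 ≤ c * D ^ 2 * N ^ 2 := by positivity
  have q12 : 0 ≤ K * N ^ 2 := by positivity
  nlinarith

/-- Bounded weights lost in passing to a smaller exponent. -/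
lemma exists_wt_le (u : FluidState) (hs : 1 / 2 < s) :
    ∃ C, ∀ ξ, wt u (1 / 2) 0 ξ ≤ C * wt u s (-(1 / 2)) ξ := by
  have hb : 0 < rate u * (s - 1 / 2) := mul_pos (rate_pos u) (by linarith)
  set β := rate u * (s - 1 / 2) with hβ
  have hA := Real.rpow_pos_of_pos (amp_pos u) (s - 1 / 2)
  refine ⟨(2 + ‖u.v‖ + 1 / β) * amp u ^ (s - 1 / 2), fun ξ => ?_⟩
  have hM := maxwellian_pos u ξ
  have hB := bracket_pos ξ
  set r := ‖ξ - u.v‖ with hr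
  have hr0 : 0 ≤ r := norm_nonneg _
  have e1 : maxwellian u ξ ^ (s - 1 / 2) = amp u ^ (s - 1 / 2) * Real.exp (-(β * r ^ 2)) := by
    rw [maxwellian_eq, Real.mul_rpow (amp_pos u).le (Real.exp_pos _).le, ← Real.exp_mul]
    congr 2
    rw [hβ]
    ring
  have h1 : bracket ξ ^ (1 / 2 : ℝ) ≤ 2 + ‖u.v‖ + r ^ 2 := by
    have h2 : bracket ξ ^ (1 / 2 : ℝ) ≤ bracket ξ ^ (1 : ℝ) :=
      Real.rpow_le_rpow_of_exponent_le (one_le_bracket ξ) (by norm_num)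
    rw [Real.rpow_one] at h2
    have h3 := bracket_le ξ
    have h4 : ‖ξ‖ ≤ r + ‖u.v‖ := by simpa using norm_add_le (ξ - u.v) u.v
    nlinarith [sq_nonneg (r - 1)]
  -- The quadratic bound is absorbed by `exp(β r²) ≥ 1 + β r²`; the term `1/β` of the constant takes
  -- care of `r²`.
  have h2 : bracket ξ ^ (1 / 2 : ℝ) * Real.exp (-(β * r ^ 2)) ≤ 2 + ‖u.v‖ + 1 / β := by
    rw [Real.exp_neg, ← div_eq_mul_inv, div_le_iff₀ (Real.exp_pos _)]
    have h3 := Real.add_one_le_exp (β * r ^ 2)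
    have h4 : 0 ≤ β * r ^ 2 := by positivity
    have h5 : 1 / β * (β * r ^ 2) = r ^ 2 := by field_simp
    have h6 : 0 ≤ 1 / β := by positivity
    have h7 := norm_nonneg u.v
    calc _ ≤ 2 + ‖u.v‖ + r ^ 2 := h1
      _ ≤ (2 + ‖u.v‖ + 1 / β) * (β * r ^ 2 + 1) := by nlinarith
      _ ≤ _ := by gcongr
  have e2 : wt u (1 / 2) 0 ξ =
      bracket ξ ^ (1 / 2 : ℝ) * maxwellian u ξ ^ (s - 1 / 2) * wt u s (-(1 / 2)) ξ := by
    rw [wt, wt, mul_mul_mul_comm, ← Real.rpow_add hB, ← Real.rpow_add hM]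
    ring_nf
  have hw := wt_pos u s (-(1 / 2)) ξ
  rw [e2, e1]
  refine mul_le_mul_of_nonneg_right ?_ hw.le
  calc _ = bracket ξ ^ (1 / 2 : ℝ) * Real.exp (-(β * r ^ 2)) * amp u ^ (s - 1 / 2) := by ring
    _ ≤ _ := by gcongr

end HardSphere

end

/-! ### Assembly -/

theorem mainTheorem3 (u : HardSphere.FluidState) (s : ℝ) (hs : 1 / 2 ≤ s) (hs1 : s < 1) :
    -- the collision integrals defining `L f` converge absolutely almost everywhere
    (∀ f : HardSphere.Vel → ℂ, HardSphere.MemH u s (1 / 2) f →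
      ∀ᵐ ξ, MeasureTheory.Integrable
          (HardSphere.collisionIntegrand (HardSphere.maxwellianC u) f ξ)
          HardSphere.collisionMeasure ∧
        MeasureTheory.Integrable
          (HardSphere.collisionIntegrand f (HardSphere.maxwellianC u) ξ)
          HardSphere.collisionMeasure) ∧
    -- `L` is continuous from `⟨ξ⟩^{-1/2} ℍ^s` to `⟨ξ⟩^{1/2} ℍ^s ∩ ker R`, which lies in `𝕍` if `s > 1/2`
    (∃ T : HardSphere.HSpace u s (1 / 2) →L[ℂ] HardSphere.HSpace u s (-(1 / 2)),
      ∀ (f : HardSphere.Vel → ℂ) (hf : HardSphere.MemH u s (1 / 2) f),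
        T (MeasureTheory.MemLp.toLp f hf) =ᵐ[MeasureTheory.volume] HardSphere.linearized u f ∧
        HardSphere.InKerR (HardSphere.linearized u f) ∧
        (1 / 2 < s → HardSphere.MemH u (1 / 2) 0 (HardSphere.linearized u f))) ∧
    -- `L` is continuous from `⟨ξ⟩^{-1} ℍ^s` to `𝕍^s = ℍ^s ∩ ker R`
    (∃ T : HardSphere.HSpace u s 1 →L[ℂ] HardSphere.HSpace u s 0,
      ∀ (f : HardSphere.Vel → ℂ) (hf : HardSphere.MemH u s 1 f),
        T (MeasureTheory.MemLp.toLp f hf) =ᵐ[MeasureTheory.volume] HardSphere.linearized u f ∧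
        HardSphere.InKerR (HardSphere.linearized u f)) ∧
    -- coercivity in the equivalent norm
    ∃ lam : ℝ, 0 ≤ lam ∧
      (∃ C : ℝ, ∀ f : HardSphere.Vel → ℂ, HardSphere.MemH u s 0 f →
        HardSphere.hNormSq u s f ≤ HardSphere.tildeNormSq u s lam f ∧
        HardSphere.tildeNormSq u s lam f ≤ C * HardSphere.hNormSq u s f) ∧
      ∃ δ : ℝ, 0 < δ ∧
        ∀ f : HardSphere.HHalf u, HardSphere.MemH u s 1 f →
          (f ∈ HardSphere.kerR u ∨
            HardSphere.InKerR (fun ξ => (HardSphere.bracket ξ : ℂ) * f ξ)) →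
          HardSphere.MemH u s (1 / 2) (HardSphere.projV u f) ∧
          MeasureTheory.Integrable
            (HardSphere.hIntegrand u s (HardSphere.linearized u f) f) ∧
          MeasureTheory.Integrable
            (HardSphere.hIntegrand u (1 / 2) (HardSphere.linearized u f) f) ∧
          δ * HardSphere.tildeNormSq u s lam
              (fun ξ => ((HardSphere.bracket ξ ^ (1 / 2 : ℝ) : ℝ) : ℂ) *
                HardSphere.projV u f ξ) ≤
            -(HardSphere.tildeInner u s lam (HardSphere.linearized u f) f).re := by
  have hs0 : 0 < s := by linarith
  refine ⟨fun f hf => .of_forall fun ξ => ?_, ?_, ?_, ?_⟩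
  · obtain ⟨h1, h2, -⟩ := HardSphere.linearized_split hs0 hs1 (hf.mono (by norm_num)) ξ
    exact ⟨h1, h2⟩
  · obtain ⟨C, -, hL⟩ := HardSphere.exists_eLpNorm_linearized_le u hs0 hs1 (a := 1 / 2)
      (b := -(1 / 2)) (by norm_num) (by norm_num) (by norm_num)
    obtain ⟨T, hT⟩ := HardSphere.exists_linearizedCLM u hs0 hs1 (a := 1 / 2) (b := -(1 / 2))
      (by norm_num) (by norm_num) (by norm_num)
    refine ⟨T, fun f hf => ⟨hT f hf, HardSphere.inKerR_linearized u (hf.of_exponent_le hs),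
      fun hlt => ?_⟩⟩
    -- The half power of `⟨ξ⟩` lost by the operator is recovered from the Gaussian factor
    -- `M^{s-1/2}`, which decays only if `s > 1/2`.
    obtain ⟨D, hD⟩ := HardSphere.exists_wt_le u hlt
    refine (hL f hf).1.of_le (C := D) (hL f hf).1.aesm (.of_forall fun ξ => ?_)
    rw [← mul_assoc]
    exact mul_le_mul_of_nonneg_right (hD ξ) (norm_nonneg _)
  · obtain ⟨T, hT⟩ := HardSphere.exists_linearizedCLM u hs0 hs1 (a := 1) (b := 0)
      (by norm_num) (by norm_num) (by norm_num)
    exact ⟨T, fun f hf => ⟨hT f hf,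
      HardSphere.inKerR_linearized u ((hf.of_exponent_le hs).mono (by norm_num))⟩⟩
  · obtain ⟨lam, δ, hlam, hδ, h⟩ := HardSphere.exists_coercivity u hs hs1
    exact ⟨lam, hlam, HardSphere.exists_tildeNormSq_le u hs hlam, δ, hδ, h⟩
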